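/- **Setting.** Let $\mathcal S,\mathcal A$ be finite sets, $p(\cdot|s,a)$ a transition kernel on $\mathcal S$, $R:\mathcal S\times\mathcal A\to\mathbb R$ a mean reward, $\gamma\in(0,1)$, $\rho$ a probability distribution on $\mathcal S$, $U_R>0$, and let $\{\pi_\theta:\theta\in\mathbb R^d\}$ be a family of policies with score $\psi_\theta(s,a)=\nabla_\theta\ln\pi_\theta(a|s)$. Put $\tilde p(\cdot|s,a)=\gamma p(\cdot|s,a)+(1-\gamma)\rho$, $P_\theta(s'|s)=\sum_a p(s'|s,a)\pi_\theta(a|s)$, $\tilde P_\theta(s'|s)=\sum_a\tilde p(s'|s,a)\pi_\theta(a|s)$, $\tilde K_\theta(s',a'|s,a)=\tilde p(s'|s,a)\pi_\theta(a'|s')$, $R_\theta(s)=\sum_a\pi_\theta(a|s)R(s,a)$, $d_{\rho,\theta}(s)=(1-\gamma)\sum_{t\ge0}\gamma^t(\rho^TP_\theta^t)(s)$ and $D_{\rho,\theta}=\mathrm{diag}(d_{\rho,\theta})$. Let $\Phi\in\mathbb R^{|\mathcal S|\times m}$ be a feature matrix with rows $\phi(s)^T$, and put $$\bar G(\theta)=\Phi^TD_{\rho,\theta}\Phi,\qquad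 G(\theta)=\Phi^TD_{\rho,\theta}(I-\gamma P_\theta)\Phi,\qquad h(\theta)=\Phi^TD_{\rho,\theta}R_\theta .$$ **Algorithm.** Start from deterministic $\theta_0\in\mathbb R^d$, $\omega_0,\bar\omega_0\in\mathbb R^m$ and an arbitrary random $\tilde S_0$. At each step $t\ge0$, given the past, draw $\tilde A_t\sim\pi_{\theta_t}(\cdot|\tilde S_t)$ and $S_{t+1}\sim p(\cdot|\tilde S_t,\tilde A_t)$, and observe a reward $R_{t+1}\in[-U_R,U_R]$ with conditional mean $R(\tilde S_t,\tilde A_t)$ given the past and $\tilde A_t$; with $\delta_{t+1}=R_{t+1}+\gamma\phi(S_{t+1})^T\omega_t-\phi(\tilde S_t)^T\omega_t$ and $\bar\delta_{t+1}=R_{t+1}+\gamma\phi(S_{t+1})^T\bar\omega_t-\phi(\tilde S_t)^T\omega_t$ set $$\theta_{t+1}=\theta_t+\tfrac{\alpha_t}{1-\gamma}\,\delta_{t+1}\,\psi_{\theta_t}(\tilde S_t,\tilde A_t),\quad \omega_{t+1}=\omega_t+\beta_t\bar\delta_{t+1}\phi(\tilde S_t),\quad \bar\omega_{t+1}=\bar\omega_t+\xi_t(\omega_{t+1}-\bar\omega_t);$$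 finally draw, independently of each other and of everything so far, $S^\rho_{t+1}\sim\rho$ and $B_{t+1}\sim\mathrm{Bernoulli}(\gamma)$, and set $\tilde S_{t+1}=S_{t+1}$ if $B_{t+1}=1$ and $\tilde S_{t+1}=S^\rho_{t+1}$ otherwise. **Assumptions.** 1. For all $(s,a)$: $\pi_\theta(a|s)>0$ for every $\theta$; $\theta\mapsto\pi_\theta(a|s)$ is continuously differentiable and Lipschitz; $\theta\mapsto\psi_\theta(s,a)$ is bounded and Lipschitz. 2. Every matrix in the closure of $\{\tilde K_\theta:\theta\in\mathbb R^d\}$ is the transition matrix of an ergodic (irreducible and aperiodic) Markov chain on $\mathcal S\times\mathcal A$. 3. Stability: $\sup_t\|\theta_t\|<\infty$ almost surely, and $(\omega_t)$ is bounded almost surely by a deterministic constant, i.e. there is $B$ with $\sup_t\|\omega_t\|\le B$ almost surely. 4. $\Phi$ has full column rank. 5. Geometric mixing: there are $c>0$, $\sigma\in(0,1)$ with $\sup_{s}d_{TV}(\tilde P_\theta^t(\cdot|s),d_{\rho,\theta})\le c\,\sigma^t$ for all $t\in\mathbb N$ and $\theta\in\mathbb R^d$. 6. There is $\zeta>0$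 with $w^T\bar G(\theta)^{-1}G(\theta)w\ge\zeta\|w\|^2$ for all $\theta\in\mathbb R^d$, $w\in\mathbb R^m$. **Theorem.** Let $c_1,c_2,c_3>0$ and $0<\beta<\xi<\alpha<1$, and let $\alpha_t=c_1(1+t)^{-\alpha}$, $\xi_t=c_2(1+t)^{-\xi}$, $\beta_t=c_3(1+t)^{-\beta}$. Then for every $\theta\in\mathbb R^d$ the equation $G(\theta)w=h(\theta)$ has a unique solution $w=\bar\omega_*(\theta)$, the random variables $\|\omega_t-\bar\omega_*(\theta_t)\|^2$ are integrable, and there is a constant $C$, independent of $T$, such that for every integer $T\ge1$ $$\frac1T\sum_{t=1}^T\mathbb E\big[\|\omega_t-\bar\omega_*(\theta_t)\|^2\big]\le C\left(\frac1{T^{1-\xi}}+\frac{\ln T}{T^\beta}+\frac1{T^{2(\alpha-\xi)}}+\frac1{T^{2(\xi-\beta)}}\right).$$ -/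

import Mathlib

open MeasureTheory ProbabilityTheory

noncomputable section

namespace TargetAC

/-- A finite discounted Markov decision process with an initial state distribution.
`p s a s'` is the probability `p(s'|s,a)`, `R s a` the mean reward, `γ` the discount factor,
`ρ` the initial distribution, and `UR` the bound on the observed random rewards. -/
structure MDP (S A : Type*) [Fintype S] where
  p : S → A → S → ℝ
  p_nonneg : ∀ s a s', 0 ≤ p s a s'
  p_sum : ∀ s a, ∑ s', p s a s' = 1
  R : S → A → ℝ
  γ : ℝ
  γ_pos : 0 < γ
  γ_lt_one : γ < 1
  ρ : S → ℝ
  ρ_nonneg : ∀ s, 0 ≤ ρ s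
  ρ_sum : ∑ s, ρ s = 1
  UR : ℝ
  UR_pos : 0 < UR

/-- A family of randomized stationary policies `π_θ(a|s) = prob θ s a`, `θ ∈ ℝ^d`. -/
structure PolicyFamily (S A : Type*) [Fintype A] (d : ℕ) where
  prob : EuclideanSpace ℝ (Fin d) → S → A → ℝ
  nonneg : ∀ θ s a, 0 ≤ prob θ s a
  sum_one : ∀ θ s, ∑ a, prob θ s a = 1

variable {S A : Type*} [Fintype S] [DecidableEq S] [Fintype A] [DecidableEq A] {d m : ℕ}

/-- The score function `ψ_θ(s,a) = ∇_θ ln π_θ(a|s)`. -/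
def score (pol : PolicyFamily S A d) (θ : EuclideanSpace ℝ (Fin d)) (s : S) (a : A) :
    EuclideanSpace ℝ (Fin d) :=
  gradient (fun θ' => Real.log (pol.prob θ' s a)) θ

/-- Regularity of the policy parametrization: positive probabilities, continuously differentiable
and Lipschitz in `θ`, with a bounded and Lipschitz score function. -/
structure PolicyRegular (pol : PolicyFamily S A d) : Prop where
  pos : ∀ θ s a, 0 < pol.prob θ s a
  contDiff : ∀ s a, ContDiff ℝ 1 (fun θ => pol.prob θ s a)
  lipschitz : ∃ L : NNReal, ∀ s a, LipschitzWith L (fun θ => pol.prob θ s a)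
  score_bounded : ∃ C : ℝ, ∀ θ s a, ‖score pol θ s a‖ ≤ C
  score_lipschitz : ∃ L : NNReal, ∀ s a, LipschitzWith L (fun θ => score pol θ s a)

/-- The artificial kernel `p̃(s'|s,a) = γ p(s'|s,a) + (1-γ) ρ(s')`. -/
def MDP.pTilde (M : MDP S A) (s : S) (a : A) (s' : S) : ℝ :=
  M.γ * M.p s a s' + (1 - M.γ) * M.ρ s'

/-- The state transition matrix `P_θ(s'|s) = ∑_a p(s'|s,a) π_θ(a|s)`; row `s`, column `s'`. -/
def Pmat (M : MDP S A) (pol : PolicyFamily S A d) (θ : EuclideanSpace ℝ (Fin d)) :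
    Matrix S S ℝ :=
  Matrix.of fun s s' => ∑ a, M.p s a s' * pol.prob θ s a

/-- The state transition matrix of the artificial MDP controlled by `π_θ`. -/
def PmatTilde (M : MDP S A) (pol : PolicyFamily S A d) (θ : EuclideanSpace ℝ (Fin d)) :
    Matrix S S ℝ :=
  Matrix.of fun s s' => ∑ a, M.pTilde s a s' * pol.prob θ s a

/-- The state-action transition matrix
`K̃_θ(s',a'|s,a) = p̃(s'|s,a) π_θ(a'|s')`; row `(s,a)`, column `(s',a')`. -/
def Ktilde (M : MDP S A) (pol : PolicyFamily S A d) (θ : EuclideanSpace ℝ (Fin d)) :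
    Matrix (S × A) (S × A) ℝ :=
  Matrix.of fun x y => M.pTilde x.1 x.2 y.1 * pol.prob θ y.1 y.2

/-- A finite Markov chain with transition matrix `K` is ergodic: irreducible and aperiodic
(the only common divisor of the possible return times of any state is `1`). -/
structure IsErgodic {X : Type*} [Fintype X] [DecidableEq X] (K : Matrix X X ℝ) : Prop where
  irreducible : K.IsIrreducible
  aperiodic : ∀ (x : X) (g : ℕ), (∀ k : ℕ, 1 ≤ k → 0 < (K ^ k) x x → g ∣ k) → g = 1

/-- Every matrix in the closure of `{K̃_θ : θ ∈ ℝ^d}` induces an ergodic Markov chain. -/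
def ErgodicClosure (M : MDP S A) (pol : PolicyFamily S A d) : Prop :=
  ∀ K ∈ closure (Set.range (Ktilde M pol)), IsErgodic K

/-- The discounted state occupancy measure
`d_{ρ,θ}(s) = (1-γ) ∑_t γ^t P_{ρ,π_θ}(S_t = s)`. -/
def occ (M : MDP S A) (pol : PolicyFamily S A d) (θ : EuclideanSpace ℝ (Fin d)) (s : S) : ℝ :=
  (1 - M.γ) * ∑' t : ℕ, M.γ ^ t * Matrix.vecMul M.ρ (Pmat M pol θ ^ t) s

/-- Total variation distance between two probability vectors on a finite set. -/
def tvDist (μ ν : S → ℝ) : ℝ := (1 / 2) * ∑ s, |μ s - ν s|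

/-- Geometric mixing of the artificial state chain, uniformly in `θ` and in the initial state. -/
def GeomMixing (M : MDP S A) (pol : PolicyFamily S A d) : Prop :=
  ∃ c σ : ℝ, 0 < c ∧ 0 < σ ∧ σ < 1 ∧
    ∀ (t : ℕ) (θ : EuclideanSpace ℝ (Fin d)) (s : S),
      tvDist ((PmatTilde M pol θ ^ t) s) (occ M pol θ) ≤ c * σ ^ t

/-- The mean reward vector `R_θ(s) = ∑_a π_θ(a|s) R(s,a)`. -/
def Rvec (M : MDP S A) (pol : PolicyFamily S A d) (θ : EuclideanSpace ℝ (Fin d)) : S → ℝ :=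
  fun s => ∑ a, pol.prob θ s a * M.R s a

/-- The diagonal matrix `D_{ρ,θ}`. -/
def Dmat (M : MDP S A) (pol : PolicyFamily S A d) (θ : EuclideanSpace ℝ (Fin d)) :
    Matrix S S ℝ :=
  Matrix.diagonal (occ M pol θ)

/-- `Ḡ(θ) = Φᵀ D_{ρ,θ} Φ`. -/
def Gbar (M : MDP S A) (pol : PolicyFamily S A d) (Φ : Matrix S (Fin m) ℝ)
    (θ : EuclideanSpace ℝ (Fin d)) : Matrix (Fin m) (Fin m) ℝ :=
  Φ.transpose * Dmat M pol θ * Φ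

/-- `G(θ) = Φᵀ D_{ρ,θ} (I - γ P_θ) Φ`. -/
def Gmat (M : MDP S A) (pol : PolicyFamily S A d) (Φ : Matrix S (Fin m) ℝ)
    (θ : EuclideanSpace ℝ (Fin d)) : Matrix (Fin m) (Fin m) ℝ :=
  Φ.transpose * Dmat M pol θ * (1 - M.γ • Pmat M pol θ) * Φ

/-- `h(θ) = Φᵀ D_{ρ,θ} R_θ`. -/
def hvec (M : MDP S A) (pol : PolicyFamily S A d) (Φ : Matrix S (Fin m) ℝ)
    (θ : EuclideanSpace ℝ (Fin d)) : Fin m → ℝ :=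
  (Φ.transpose * Dmat M pol θ).mulVec (Rvec M pol θ)

/-- `ω̄_*(θ)`, the solution of the linear equation `G(θ) ω̄ = h(θ)`. -/
def omegaBarStar (M : MDP S A) (pol : PolicyFamily S A d) (Φ : Matrix S (Fin m) ℝ)
    (θ : EuclideanSpace ℝ (Fin d)) : EuclideanSpace ℝ (Fin m) :=
  WithLp.toLp 2 ((Gmat M pol Φ θ)⁻¹.mulVec (hvec M pol Φ θ))

/-- Positive definiteness of `Ḡ(θ)⁻¹ G(θ)`, uniformly in `θ`. -/
def UnifPosDef (M : MDP S A) (pol : PolicyFamily S A d) (Φ : Matrix S (Fin m) ℝ) : Prop :=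
  ∃ ζ : ℝ, 0 < ζ ∧ ∀ (θ : EuclideanSpace ℝ (Fin d)) (w : EuclideanSpace ℝ (Fin m)),
    ζ * ‖w‖ ^ 2 ≤ dotProduct w.ofLp (((Gbar M pol Φ θ)⁻¹ * Gmat M pol Φ θ).mulVec w.ofLp)

/-- The feature vector `φ(s) ∈ ℝ^m`, the row of `Φ` indexed by `s`. -/
def feat (Φ : Matrix S (Fin m) ℝ) (s : S) : EuclideanSpace ℝ (Fin m) :=
  WithLp.toLp 2 (Φ s)

/-- The random variables drawn along the algorithm: at step `t`, the current state
`stateT t = S̃_t`, the action `act t = Ã_t`, the next state `next t = S_{t+1}`, the reward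
`rew t = R_{t+1}`, the restart state `reset t = S^ρ_{t+1}` and the coin `coin t = B_{t+1}`. -/
structure Samples (S A Ω : Type*) where
  stateT : ℕ → Ω → S
  act : ℕ → Ω → A
  next : ℕ → Ω → S
  rew : ℕ → Ω → ℝ
  reset : ℕ → Ω → S
  coin : ℕ → Ω → Bool

/-- The parameters maintained by the algorithm: actor `θ`, critic `ω`, target variable `ω̄`. -/
structure Params (d m : ℕ) where
  theta : EuclideanSpace ℝ (Fin d)
  omega : EuclideanSpace ℝ (Fin m)
  omegaBar : EuclideanSpace ℝ (Fin m)

/-- One step of the target-based actor-critic update with stepsizes `at'` (actor), `xt` (target)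
and `bt` (critic), from the observations `(S̃_t, Ã_t, S_{t+1}, R_{t+1}) = (s, a, s', r)`. -/
def update (M : MDP S A) (pol : PolicyFamily S A d) (Φ : Matrix S (Fin m) ℝ)
    (at' xt bt : ℝ) (s : S) (a : A) (s' : S) (r : ℝ) (z : Params d m) : Params d m :=
  let δ : ℝ := r + M.γ * inner ℝ (feat Φ s') z.omega - inner ℝ (feat Φ s) z.omega
  let δbar : ℝ := r + M.γ * inner ℝ (feat Φ s') z.omegaBar - inner ℝ (feat Φ s) z.omega
  let θ' := z.theta + (at' * (1 / (1 - M.γ)) * δ) • score pol z.theta s a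
  let ω' := z.omega + (bt * δbar) • feat Φ s
  { theta := θ'
    omega := ω'
    omegaBar := z.omegaBar + xt • (ω' - z.omegaBar) }

/-- The iterates `(θ_t, ω_t, ω̄_t)` of the algorithm started from the deterministic `z₀`. -/
def iter {Ω : Type*} (M : MDP S A) (pol : PolicyFamily S A d) (Φ : Matrix S (Fin m) ℝ)
    (αs ξs βs : ℕ → ℝ) (z₀ : Params d m) (X : Samples S A Ω) : ℕ → Ω → Params d m
  | 0, _ => z₀
  | t + 1, x =>
      update M pol Φ (αs t) (ξs t) (βs t) (X.stateT t x) (X.act t x) (X.next t x) (X.rew t x)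
        (iter M pol Φ αs ξs βs z₀ X t x)

/-- The samples are generated as the algorithm prescribes, along the policies `π_{θ_t}`.
`𝓕 t` is the information available at time `t` before the action `Ã_t` is drawn. -/
structure IsSampling {Ω : Type*} [MeasurableSpace Ω] [MeasurableSpace S] [MeasurableSpace A]
    (M : MDP S A) (pol : PolicyFamily S A d) (θ : ℕ → Ω → EuclideanSpace ℝ (Fin d))
    (X : Samples S A Ω) (𝓕 : Filtration ℕ ‹MeasurableSpace Ω›) (P : Measure Ω) : Prop where
  meas_state : ∀ t, Measurable[𝓕 t] (X.stateT t)
  meas_act : ∀ t, Measurable[𝓕 (t + 1)] (X.act t)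
  meas_next : ∀ t, Measurable[𝓕 (t + 1)] (X.next t)
  meas_rew : ∀ t, Measurable[𝓕 (t + 1)] (X.rew t)
  meas_reset : ∀ t, Measurable[𝓕 (t + 1)] (X.reset t)
  meas_coin : ∀ t, Measurable[𝓕 (t + 1)] (X.coin t)
  /-- `Ã_t ∼ π_{θ_t}(·|S̃_t)` given the past. -/
  law_act : ∀ t a,
    P⟦X.act t ⁻¹' {a} | 𝓕 t⟧ =ᵐ[P] fun x => pol.prob (θ t x) (X.stateT t x) a
  /-- `S_{t+1} ∼ p(·|S̃_t, Ã_t)` given the past and `Ã_t`. -/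
  law_next : ∀ t s',
    P⟦X.next t ⁻¹' {s'} | (𝓕 t : MeasurableSpace Ω) ⊔ MeasurableSpace.comap (X.act t) inferInstance⟧
      =ᵐ[P] fun x => M.p (X.stateT t x) (X.act t x) s'
  /-- `R_{t+1} ∈ [-U_R, U_R]`. -/
  rew_bound : ∀ t, ∀ᵐ x ∂P, |X.rew t x| ≤ M.UR
  /-- `R_{t+1}` has mean `R(S̃_t, Ã_t)` given the past and `Ã_t`. -/
  mean_rew : ∀ t,
    P[X.rew t | (𝓕 t : MeasurableSpace Ω) ⊔ MeasurableSpace.comap (X.act t) inferInstance]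
      =ᵐ[P] fun x => M.R (X.stateT t x) (X.act t x)
  /-- Given the past and `(Ã_t, S_{t+1}, R_{t+1})`, `S^ρ_{t+1} ∼ ρ` and `B_{t+1} ∼ Bernoulli(γ)`
  are drawn independently. -/
  law_reset_coin : ∀ t s b,
    P⟦X.reset t ⁻¹' {s} ∩ X.coin t ⁻¹' {b} | (𝓕 t : MeasurableSpace Ω) ⊔
        MeasurableSpace.comap (fun x => (X.act t x, X.next t x, X.rew t x)) inferInstance⟧
      =ᵐ[P] fun _ => M.ρ s * (if b then M.γ else 1 - M.γ)
  /-- `S̃_{t+1} = S_{t+1}` if `B_{t+1} = 1` and `S̃_{t+1} = S^ρ_{t+1}` if `B_{t+1} = 0`. -/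
  state_succ : ∀ t x,
    X.stateT (t + 1) x = if X.coin t x then X.next t x else X.reset t x

end TargetAC

end

set_option linter.unusedSectionVars false

open MeasureTheory ProbabilityTheory

noncomputable section

namespace TargetAC

/-! Three timescales are separated by tracking two errors: x_t = ω_t - ω_*(θ_t, ω̄_t), where ω_*(θ,
w) = Ḡ⁻¹(h + (Ḡ - G)w) is the critic's equilibrium for frozen actor and target, and y_t = ω̄_t -
ω̄_*(θ_t). Since h = G ω̄_*, one has ω_*(θ, w) - w = -Ḡ⁻¹G(w - ω̄_*) (`omegaStar_sub`). Hence ω_t -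
ω̄_*(θ_t) = x_t + y_t - Ḡ⁻¹G y_t, and it suffices to average E‖x_t‖² and E‖y_t‖². Unique solvability
of G w = h follows from the coercivity of Ḡ⁻¹G.

Critic. Averaged over the occupancy measure, the drift of x_t is -Ḡ x_t (`sum_occ_mul_criticDrift`).
Ḡ is uniformly coercive, because irreducibility on a compact family of kernels bounds the occupancy
measure below (`exists_occ_lower_bound`) and Φ has full rank. The state S̃_t is not distributed as
the occupancy measure, but P̃ = γP + (1 - γ)1ρᵀ makes the value function (I - γP)⁻¹f an explicit
solution of the Poisson equation (`poisson_equation`). It is bounded and Lipschitz in the policy, so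
the Markovian noise is a telescoping term plus O(β_t). The moving equilibrium contributes (ξ_t/β_t)²
(`exists_critic_recursion`).

Target. Its mean field -Ḡ⁻¹G y_t contracts by positive definiteness; the perturbations are x_t, one
critic step and the motion of ω̄_*, which contributes (α_t/ξ_t)² (`exists_target_recursion`).

Summation by parts turns both recursions into averages (`avgLE_of_recursions`). The boundary terms
give T^{-(1-ξ)}, the stepsizes T^{-β} and the ratios T^{-2(ξ-β)} and T^{-2(α-ξ)}. Lipschitz
estimates are carried along trajectories: every quantity is shown to be an adapted bounded process
with increments of the order of a stepsize. -/

lemma stronglyMeasurable_pi_lambda {Ω ι : Type*} [Countable ι] {m' : MeasurableSpace Ω}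
    {f : ι → Ω → ℝ} (hf : ∀ i, StronglyMeasurable (f i)) :
    StronglyMeasurable (fun x i => f i x) :=
  (measurable_pi_lambda _ fun i => (hf i).measurable).stronglyMeasurable

/-- An adapted process with values in a normed space that is almost surely bounded by a
deterministic constant and whose increments are almost surely `O(r t)`. -/
structure SlowAdapted {Ω E : Type*} {mΩ : MeasurableSpace Ω} [NormedAddCommGroup E]
    (P : Measure Ω) (𝓕 : Filtration ℕ mΩ) (r : ℕ → ℝ) (u : ℕ → Ω → E) : Prop where
  meas : ∀ t, StronglyMeasurable[𝓕 t] (u t)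
  bdd : ∃ C : ℝ, ∀ᵐ x ∂P, ∀ t, ‖u t x‖ ≤ C
  incr : ∃ C : ℝ, ∀ᵐ x ∂P, ∀ t, ‖u (t + 1) x - u t x‖ ≤ C * r t

/-! ### Calculus of bounded, slowly varying adapted processes -/

namespace SlowAdapted

variable {Ω E : Type*} {mΩ : MeasurableSpace Ω} [NormedAddCommGroup E]
  {P : Measure Ω} {𝓕 : Filtration ℕ mΩ} {r : ℕ → ℝ}

lemma const (c : E) : SlowAdapted P 𝓕 r (fun _ _ => c) :=
  ⟨fun _ => stronglyMeasurable_const, ⟨‖c‖, by simp⟩, ⟨0, by simp⟩⟩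

lemma mono_rate {u : ℕ → Ω → E} (hu : SlowAdapted P 𝓕 r u) {r' : ℕ → ℝ} (hr : ∀ t, 0 ≤ r t)
    {c : ℝ} (h : ∀ t, r t ≤ c * r' t) : SlowAdapted P 𝓕 r' u := by
  obtain ⟨C, hC⟩ := hu.incr
  refine ⟨hu.meas, hu.bdd, |C| * c, ?_⟩
  filter_upwards [hC] with x hx t
  calc _ ≤ C * r t := hx t
    _ ≤ |C| * r t := mul_le_mul_of_nonneg_right (le_abs_self C) (hr t)
    _ ≤ |C| * (c * r' t) := mul_le_mul_of_nonneg_left (h t) (abs_nonneg C)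
    _ = _ := by ring

lemma add {u v : ℕ → Ω → E} (hu : SlowAdapted P 𝓕 r u) (hv : SlowAdapted P 𝓕 r v) :
    SlowAdapted P 𝓕 r (fun t x => u t x + v t x) := by
  obtain ⟨C₁, h₁⟩ := hu.bdd
  obtain ⟨C₂, h₂⟩ := hv.bdd
  obtain ⟨L₁, k₁⟩ := hu.incr
  obtain ⟨L₂, k₂⟩ := hv.incr
  refine ⟨fun t => (hu.meas t).add (hv.meas t), ⟨C₁ + C₂, ?_⟩, ⟨L₁ + L₂, ?_⟩⟩
  · filter_upwards [h₁, h₂] with x a b t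
    exact norm_add_le_of_le (a t) (b t)
  · filter_upwards [k₁, k₂] with x a b t
    rw [add_sub_add_comm, add_mul]
    exact norm_add_le_of_le (a t) (b t)

lemma neg {u : ℕ → Ω → E} (hu : SlowAdapted P 𝓕 r u) :
    SlowAdapted P 𝓕 r (fun t x => - u t x) := by
  obtain ⟨C₁, h₁⟩ := hu.bdd
  obtain ⟨L₁, k₁⟩ := hu.incr
  refine ⟨fun t => (hu.meas t).neg, ⟨C₁, ?_⟩, ⟨L₁, ?_⟩⟩
  · filter_upwards [h₁] with x a t
    simpa using a t
  · filter_upwards [k₁] with x a t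
    rw [neg_sub_neg, norm_sub_rev]
    exact a t

lemma sub {u v : ℕ → Ω → E} (hu : SlowAdapted P 𝓕 r u) (hv : SlowAdapted P 𝓕 r v) :
    SlowAdapted P 𝓕 r (fun t x => u t x - v t x) := by
  simpa only [sub_eq_add_neg] using hu.add hv.neg

lemma mul {u v : ℕ → Ω → ℝ} (hu : SlowAdapted P 𝓕 r u) (hv : SlowAdapted P 𝓕 r v) :
    SlowAdapted P 𝓕 r (fun t x => u t x * v t x) := by
  obtain ⟨C₁, h₁⟩ := hu.bdd
  obtain ⟨C₂, h₂⟩ := hv.bdd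
  obtain ⟨L₁, k₁⟩ := hu.incr
  obtain ⟨L₂, k₂⟩ := hv.incr
  refine ⟨fun t => (hu.meas t).mul (hv.meas t), ⟨C₁ * C₂, ?_⟩, ⟨C₁ * L₂ + L₁ * C₂, ?_⟩⟩
  · filter_upwards [h₁, h₂] with x a b t
    rw [norm_mul]
    exact mul_le_mul (a t) (b t) (norm_nonneg _) ((norm_nonneg _).trans (a t))
  · filter_upwards [h₁, h₂, k₁, k₂] with x a b a' b' t
    have e : u (t + 1) x * v (t + 1) x - u t x * v t x
        = u (t + 1) x * (v (t + 1) x - v t x) + (u (t + 1) x - u t x) * v t x := by ring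
    rw [e]
    refine (norm_add_le _ _).trans ?_
    rw [norm_mul, norm_mul]
    have i₁ := mul_le_mul (a (t + 1)) (b' t) (norm_nonneg _) ((norm_nonneg _).trans (a 0))
    have i₂ := mul_le_mul (a' t) (b t) (norm_nonneg _) ((norm_nonneg _).trans (a' t))
    linarith

lemma sum {ι : Type*} (s : Finset ι) {u : ι → ℕ → Ω → E}
    (hu : ∀ i ∈ s, SlowAdapted P 𝓕 r (u i)) :
    SlowAdapted P 𝓕 r (fun t x => ∑ i ∈ s, u i t x) := by
  classical
  induction s using Finset.induction_on with
  | empty => simpa using const (0 : E)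
  | insert i s hi ih =>
    simp only [Finset.sum_insert hi]
    exact (hu i (Finset.mem_insert_self i s)).add
      (ih fun j hj => hu j (Finset.mem_insert_of_mem hj))

/-- The bound comes from `f` and not from `u`, since the actor has no deterministic bound; only
functions of it, such as action probabilities, do. -/
lemma lipschitz_comp {Y : Type*} [NormedAddCommGroup Y] {L : NNReal} {f : Y → E}
    (hf : LipschitzWith L f) {C : ℝ} (hC : ∀ y, ‖f y‖ ≤ C) {u : ℕ → Ω → Y}
    (hm : ∀ t, StronglyMeasurable[𝓕 t] (u t)) {K : ℝ}
    (hu : ∀ᵐ x ∂P, ∀ t, ‖u (t + 1) x - u t x‖ ≤ K * r t) :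
    SlowAdapted P 𝓕 r (fun t x => f (u t x)) := by
  refine ⟨fun t => hf.continuous.comp_stronglyMeasurable (hm t), ⟨C, by simp [hC]⟩, ⟨L * K, ?_⟩⟩
  filter_upwards [hu] with x hx t
  calc ‖f (u (t + 1) x) - f (u t x)‖ ≤ L * ‖u (t + 1) x - u t x‖ := hf.norm_sub_le _ _
    _ ≤ L * (K * r t) := by gcongr; exact hx t
    _ = _ := by ring

section Euclidean

variable {n : ℕ}

lemma coord {u : ℕ → Ω → EuclideanSpace ℝ (Fin n)} (hu : SlowAdapted P 𝓕 r u) (i : Fin n) :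
    SlowAdapted P 𝓕 r (fun t x => u t x i) := by
  obtain ⟨C, h⟩ := hu.bdd
  obtain ⟨L, k⟩ := hu.incr
  refine ⟨fun t => Continuous.comp_stronglyMeasurable (g := fun w : EuclideanSpace ℝ (Fin n) => w i)
    (by fun_prop) (hu.meas t), ⟨C, ?_⟩, ⟨L, ?_⟩⟩
  · filter_upwards [h] with x a t
    exact (PiLp.norm_apply_le (u t x) i).trans (a t)
  · filter_upwards [k] with x a t
    exact (PiLp.norm_apply_le (u (t + 1) x - u t x) i).trans (a t)

lemma norm_le_sum_abs (w : EuclideanSpace ℝ (Fin n)) : ‖w‖ ≤ ∑ i, |w i| := by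
  rw [EuclideanSpace.norm_eq]
  refine Real.sqrt_le_iff.2 ⟨Finset.sum_nonneg fun i _ => abs_nonneg _, ?_⟩
  simpa using Finset.sum_sq_le_sq_sum_of_nonneg (s := Finset.univ) (f := fun i => |w i|)
    fun i _ => abs_nonneg (w i)

lemma of_coord {u : ℕ → Ω → EuclideanSpace ℝ (Fin n)}
    (hu : ∀ i, SlowAdapted P 𝓕 r (fun t x => u t x i)) : SlowAdapted P 𝓕 r u := by
  choose C hC using fun i => (hu i).bdd
  choose L hL using fun i => (hu i).incr
  refine ⟨fun t => ?_, ⟨∑ i, C i, ?_⟩, ⟨∑ i, L i, ?_⟩⟩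
  · have : StronglyMeasurable[𝓕 t] (fun x => (fun i => u t x i : Fin n → ℝ)) :=
      stronglyMeasurable_pi_lambda fun i => (hu i).meas t
    exact Continuous.comp_stronglyMeasurable (g := fun w : Fin n → ℝ => WithLp.toLp 2 w)
      (by fun_prop) this
  · filter_upwards [ae_all_iff.2 hC] with x a t
    exact (norm_le_sum_abs _).trans (Finset.sum_le_sum fun i _ => a i t)
  · filter_upwards [ae_all_iff.2 hL] with x a t
    rw [Finset.sum_mul]
    exact (norm_le_sum_abs _).trans (Finset.sum_le_sum fun i _ => a i t)

end Euclidean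

section Matrix

variable {l n o : Type*} [Fintype n]

lemma matrix_mul {A : ℕ → Ω → Matrix l n ℝ} {B : ℕ → Ω → Matrix n o ℝ}
    (hA : ∀ i j, SlowAdapted P 𝓕 r (fun t x => A t x i j))
    (hB : ∀ i j, SlowAdapted P 𝓕 r (fun t x => B t x i j)) (i : l) (j : o) :
    SlowAdapted P 𝓕 r (fun t x => (A t x * B t x) i j) := by
  simp only [Matrix.mul_apply]
  exact sum _ fun k _ => (hA i k).mul (hB k j)

lemma mulVec {A : ℕ → Ω → Matrix l n ℝ} {v : ℕ → Ω → n → ℝ}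
    (hA : ∀ i j, SlowAdapted P 𝓕 r (fun t x => A t x i j))
    (hv : ∀ i, SlowAdapted P 𝓕 r (fun t x => v t x i)) (i : l) :
    SlowAdapted P 𝓕 r (fun t x => (A t x).mulVec (v t x) i) := by
  simp only [Matrix.mulVec, dotProduct]
  exact sum _ fun k _ => (hA i k).mul (hv k)

lemma stronglyMeasurable_det {m' : MeasurableSpace Ω} [DecidableEq n] {A : Ω → Matrix n n ℝ}
    (hA : ∀ i j, StronglyMeasurable[m'] (fun x => A x i j)) :
    StronglyMeasurable[m'] (fun x => (A x).det) := by
  simp only [Matrix.det_apply]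
  refine Finset.stronglyMeasurable_fun_sum _ fun σ _ => ?_
  exact (Finset.stronglyMeasurable_fun_prod _ fun i _ => hA _ _).const_smul _

/-- Cramer's rule makes each entry of the inverse a quotient of two determinants, which are
polynomials in the entries. -/
lemma stronglyMeasurable_inv {m' : MeasurableSpace Ω} [DecidableEq n] {A : Ω → Matrix n n ℝ}
    (hA : ∀ i j, StronglyMeasurable[m'] (fun x => A x i j)) (i j : n) :
    StronglyMeasurable[m'] (fun x => (A x)⁻¹ i j) := by
  have h : ∀ x, (A x)⁻¹ i j = (A x).det⁻¹ * ((A x).updateRow j (Pi.single i 1)).det := fun x => by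
    rw [Matrix.inv_def, Ring.inverse_eq_inv', Matrix.smul_apply, Matrix.adjugate_apply,
      smul_eq_mul]
  simp only [h]
  refine (stronglyMeasurable_det hA).measurable.inv.stronglyMeasurable.mul
    (stronglyMeasurable_det fun k l => ?_)
  by_cases hk : k = j
  · subst hk
    simpa only [Matrix.updateRow_self] using stronglyMeasurable_const
  · simpa only [Matrix.updateRow_ne hk] using hA k l

/-- By the identity B⁻¹ - A⁻¹ = B⁻¹(A - B)A⁻¹, uniformly bounded inverses vary no faster than the
matrices themselves. -/
lemma matrix_inv [DecidableEq n] {A : ℕ → Ω → Matrix n n ℝ}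
    (hA : ∀ i j, SlowAdapted P 𝓕 r (fun t x => A t x i j))
    (hdet : ∀ t x, IsUnit (A t x).det) {C : ℝ} (hC : ∀ t x i j, |(A t x)⁻¹ i j| ≤ C) (i j : n) :
    SlowAdapted P 𝓕 r (fun t x => (A t x)⁻¹ i j) := by
  choose L hL using fun k l => (hA k l).incr
  refine ⟨fun t => stronglyMeasurable_inv (fun k l => (hA k l).meas t) i j,
    ⟨C, ae_of_all _ fun x t => hC t x i j⟩, ⟨∑ k, ∑ l, C * L l k * C, ?_⟩⟩
  filter_upwards [ae_all_iff.2 fun k => ae_all_iff.2 (hL k)] with x hx t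
  have e : (A (t + 1) x)⁻¹ - (A t x)⁻¹
      = (A (t + 1) x)⁻¹ * (A t x - A (t + 1) x) * (A t x)⁻¹ := by
    rw [Matrix.mul_sub, Matrix.sub_mul, Matrix.nonsing_inv_mul _ (hdet _ _), Matrix.one_mul,
      Matrix.mul_assoc, Matrix.mul_nonsing_inv _ (hdet _ _), Matrix.mul_one]
  rw [← Matrix.sub_apply, e, Matrix.mul_apply]
  simp only [Matrix.mul_apply, Finset.sum_mul]
  refine (norm_sum_le _ _).trans (Finset.sum_le_sum fun k _ => (norm_sum_le _ _).trans
    (Finset.sum_le_sum fun l _ => ?_))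
  rw [norm_mul, norm_mul]
  have h := hx l k t
  rw [norm_sub_rev] at h
  have h1 := mul_le_mul (hC (t + 1) x i l) h (norm_nonneg _) ((abs_nonneg _).trans (hC 0 x i l))
  have h2 := mul_le_mul h1 (hC t x k j) (abs_nonneg _)
    ((mul_nonneg (abs_nonneg _) (norm_nonneg _)).trans h1)
  calc _ ≤ C * (L l k * r t) * C := h2
    _ = _ := by ring

end Matrix

end SlowAdapted

variable {S A : Type*} [Fintype S] [DecidableEq S] [Fintype A] [DecidableEq A] {d m : ℕ}

/-! ### Discounted occupancy measure, resolvent and Poisson equation -/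

section Discounted

lemma Pmat_nonneg (M : MDP S A) (pol : PolicyFamily S A d) (θ : EuclideanSpace ℝ (Fin d))
    (s s' : S) : 0 ≤ Pmat M pol θ s s' :=
  Finset.sum_nonneg fun a _ => mul_nonneg (M.p_nonneg s a s') (pol.nonneg θ s a)

lemma Pmat_row_sum (M : MDP S A) (pol : PolicyFamily S A d) (θ : EuclideanSpace ℝ (Fin d))
    (s : S) : ∑ s', Pmat M pol θ s s' = 1 := by
  simp only [Pmat, Matrix.of_apply]
  rw [Finset.sum_comm]
  simp [← Finset.sum_mul, M.p_sum, pol.sum_one]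

lemma PmatTilde_apply (M : MDP S A) (pol : PolicyFamily S A d) (θ : EuclideanSpace ℝ (Fin d))
    (s s' : S) : PmatTilde M pol θ s s' = M.γ * Pmat M pol θ s s' + (1 - M.γ) * M.ρ s' := by
  simp only [PmatTilde, Pmat, Matrix.of_apply, MDP.pTilde, add_mul, Finset.sum_add_distrib,
    ← Finset.mul_sum, pol.sum_one, mul_one, mul_assoc]

lemma MDP.nonempty_state (M : MDP S A) : Nonempty S := by
  by_contra h
  rw [not_nonempty_iff] at h
  have := M.ρ_sum
  simp at this

/-- The resolvent `(I - γ P_θ)⁻¹`, whose products with cost vectors are value functions. -/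
def resolvent (M : MDP S A) (pol : PolicyFamily S A d) (θ : EuclideanSpace ℝ (Fin d)) :
    Matrix S S ℝ :=
  (1 - M.γ • Pmat M pol θ)⁻¹

/-- Maximum principle: at a state maximizing |v|, the averaging by the stochastic matrix gives |v| ≤
C + γ|v|. -/
lemma abs_le_of_discounted_mulVec (M : MDP S A) (pol : PolicyFamily S A d)
    (θ : EuclideanSpace ℝ (Fin d)) (v : S → ℝ) {C : ℝ}
    (h : ∀ s, |(1 - M.γ • Pmat M pol θ).mulVec v s| ≤ C) (s : S) : |v s| ≤ C / (1 - M.γ) := by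
  have := M.nonempty_state
  obtain ⟨s₀, hs₀⟩ := Finite.exists_max fun s => |v s|
  have hγ : 0 < 1 - M.γ := sub_pos.2 M.γ_lt_one
  refine (hs₀ s).trans ?_
  rw [le_div_iff₀ hγ]
  have e : v s₀ = (1 - M.γ • Pmat M pol θ).mulVec v s₀ + M.γ * ∑ s', Pmat M pol θ s₀ s' * v s' := by
    rw [Matrix.sub_mulVec, Matrix.one_mulVec, Matrix.smul_mulVec]
    simp [Matrix.mulVec, dotProduct]
  have b : |∑ s', Pmat M pol θ s₀ s' * v s'| ≤ |v s₀| := by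
    calc _ ≤ ∑ s', Pmat M pol θ s₀ s' * |v s₀| := by
          refine (Finset.abs_sum_le_sum_abs _ _).trans (Finset.sum_le_sum fun s' _ => ?_)
          rw [abs_mul, abs_of_nonneg (Pmat_nonneg M pol θ s₀ s')]
          exact mul_le_mul_of_nonneg_left (hs₀ s') (Pmat_nonneg M pol θ s₀ s')
      _ = |v s₀| := by rw [← Finset.sum_mul, Pmat_row_sum, one_mul]
  have b' : |v s₀| ≤ C + M.γ * |v s₀| := by
    conv_lhs => rw [e]
    refine (abs_add_le _ _).trans (add_le_add (h s₀) ?_)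
    rw [abs_mul, abs_of_pos M.γ_pos]
    exact mul_le_mul_of_nonneg_left b M.γ_pos.le
  linarith

lemma isUnit_det_discounted (M : MDP S A) (pol : PolicyFamily S A d)
    (θ : EuclideanSpace ℝ (Fin d)) : IsUnit (1 - M.γ • Pmat M pol θ).det := by
  rw [← Matrix.isUnit_iff_isUnit_det, ← Matrix.mulVec_injective_iff_isUnit]
  intro v w hvw
  have h0 : (1 - M.γ • Pmat M pol θ).mulVec (v - w) = 0 := by
    rw [Matrix.mulVec_sub, sub_eq_zero]
    exact hvw
  funext s
  have := abs_le_of_discounted_mulVec M pol θ (v - w) (C := 0) (by simp [h0]) s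
  simpa [sub_eq_zero] using this

/-- The maximum principle applies to each column of the resolvent, whose image under I - γP is a
basis vector. -/
lemma abs_resolvent_le (M : MDP S A) (pol : PolicyFamily S A d) (θ : EuclideanSpace ℝ (Fin d))
    (s s' : S) : |resolvent M pol θ s s'| ≤ 1 / (1 - M.γ) := by
  refine abs_le_of_discounted_mulVec M pol θ (fun s => resolvent M pol θ s s') (fun i => ?_) s
  have : (1 - M.γ • Pmat M pol θ).mulVec (fun s => resolvent M pol θ s s') i
      = ((1 - M.γ • Pmat M pol θ) * resolvent M pol θ) i s' := rfl
  rw [this, resolvent, Matrix.mul_nonsing_inv _ (isUnit_det_discounted M pol θ), Matrix.one_apply]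
  split_ifs <;> simp

lemma vecMul_pow_bounds (M : MDP S A) (pol : PolicyFamily S A d) (θ : EuclideanSpace ℝ (Fin d))
    (t : ℕ) : (∀ s, 0 ≤ Matrix.vecMul M.ρ (Pmat M pol θ ^ t) s) ∧
      ∑ s, Matrix.vecMul M.ρ (Pmat M pol θ ^ t) s = 1 := by
  induction t with
  | zero => simpa using ⟨M.ρ_nonneg, M.ρ_sum⟩
  | succ t ih =>
    rw [pow_succ, ← Matrix.vecMul_vecMul]
    refine ⟨fun s => Finset.sum_nonneg fun i _ => mul_nonneg (ih.1 i) (Pmat_nonneg M pol θ i s), ?_⟩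
    simp only [Matrix.vecMul, dotProduct] at ih ⊢
    rw [Finset.sum_comm]
    simp only [← Finset.mul_sum, Pmat_row_sum, mul_one]
    exact ih.2

lemma summable_occ (M : MDP S A) (pol : PolicyFamily S A d) (θ : EuclideanSpace ℝ (Fin d))
    (s : S) : Summable fun t : ℕ => M.γ ^ t * Matrix.vecMul M.ρ (Pmat M pol θ ^ t) s := by
  refine Summable.of_nonneg_of_le (fun t => mul_nonneg (pow_nonneg M.γ_pos.le t)
    ((vecMul_pow_bounds M pol θ t).1 s)) (fun t => ?_)
    (summable_geometric_of_lt_one M.γ_pos.le M.γ_lt_one)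
  have h := vecMul_pow_bounds M pol θ t
  have : Matrix.vecMul M.ρ (Pmat M pol θ ^ t) s ≤ 1 := by
    rw [← h.2]
    exact Finset.single_le_sum (fun i _ => h.1 i) (Finset.mem_univ s)
  exact mul_le_of_le_one_right (pow_nonneg M.γ_pos.le t) this

lemma occ_nonneg (M : MDP S A) (pol : PolicyFamily S A d) (θ : EuclideanSpace ℝ (Fin d))
    (s : S) : 0 ≤ occ M pol θ s :=
  mul_nonneg (sub_nonneg.2 M.γ_lt_one.le) (tsum_nonneg fun t =>
    mul_nonneg (pow_nonneg M.γ_pos.le t) ((vecMul_pow_bounds M pol θ t).1 s))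

lemma occ_sum (M : MDP S A) (pol : PolicyFamily S A d) (θ : EuclideanSpace ℝ (Fin d)) :
    ∑ s, occ M pol θ s = 1 := by
  have hγ : (1 - M.γ) ≠ 0 := (sub_pos.2 M.γ_lt_one).ne'
  simp only [occ]
  rw [← Finset.mul_sum, ← Summable.tsum_finsetSum fun s _ => summable_occ M pol θ s]
  simp only [← Finset.mul_sum, (vecMul_pow_bounds M pol θ _).2, mul_one]
  rw [tsum_geometric_of_lt_one M.γ_pos.le M.γ_lt_one, mul_inv_cancel₀ hγ]

/-- The flow equation `d_{ρ,θ}ᵀ = (1 - γ) ρᵀ + γ d_{ρ,θ}ᵀ P_θ`. -/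
lemma occ_flow (M : MDP S A) (pol : PolicyFamily S A d) (θ : EuclideanSpace ℝ (Fin d)) (s : S) :
    occ M pol θ s = (1 - M.γ) * M.ρ s + M.γ * ∑ s', occ M pol θ s' * Pmat M pol θ s' s := by
  have h := (summable_occ M pol θ s).tsum_eq_zero_add
  have e : ∀ t : ℕ, M.γ ^ (t + 1) * Matrix.vecMul M.ρ (Pmat M pol θ ^ (t + 1)) s
      = ∑ s', (M.γ ^ t * Matrix.vecMul M.ρ (Pmat M pol θ ^ t) s') * (M.γ * Pmat M pol θ s' s) := by
    intro t
    rw [pow_succ (Pmat M pol θ), ← Matrix.vecMul_vecMul]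
    conv_lhs => rw [Matrix.vecMul, dotProduct, Finset.mul_sum]
    exact Finset.sum_congr rfl fun i _ => by ring
  simp only [e] at h
  rw [Summable.tsum_finsetSum fun s' _ => (summable_occ M pol θ s').mul_right _] at h
  simp only [tsum_mul_right] at h
  conv_lhs => rw [occ, h]
  simp only [pow_zero, one_mul, Matrix.vecMul_one, mul_add, Finset.mul_sum, occ]
  congr 1
  exact Finset.sum_congr rfl fun i _ => by ring

lemma occ_vecMul_discounted (M : MDP S A) (pol : PolicyFamily S A d)
    (θ : EuclideanSpace ℝ (Fin d)) :
    Matrix.vecMul (occ M pol θ) (1 - M.γ • Pmat M pol θ) = (1 - M.γ) • M.ρ := by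
  funext s
  have := occ_flow M pol θ s
  rw [Matrix.vecMul_sub, Matrix.vecMul_one, Matrix.vecMul_smul]
  simp only [Pi.sub_apply, Pi.smul_apply, smul_eq_mul, Matrix.vecMul, dotProduct]
  linarith

/-- Replaces the series by a matrix inverse, so that slow variation of the occupancy measure is
inherited from `SlowAdapted.matrix_inv`. -/
lemma occ_eq_resolvent (M : MDP S A) (pol : PolicyFamily S A d) (θ : EuclideanSpace ℝ (Fin d))
    (s : S) : occ M pol θ s = (1 - M.γ) * ∑ s', M.ρ s' * resolvent M pol θ s' s := by
  have h := congrArg (fun v => Matrix.vecMul v (resolvent M pol θ)) (occ_vecMul_discounted M pol θ)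
  simp only [Matrix.vecMul_vecMul] at h
  rw [resolvent, Matrix.mul_nonsing_inv _ (isUnit_det_discounted M pol θ), Matrix.vecMul_one,
    Matrix.smul_vecMul] at h
  exact congrFun h s

/-- The discounted value function solves the Poisson equation of the artificial chain. -/
lemma poisson_equation (M : MDP S A) (pol : PolicyFamily S A d) (θ : EuclideanSpace ℝ (Fin d))
    (f : S → ℝ) (s : S) :
    (resolvent M pol θ).mulVec f s
        - ∑ s', PmatTilde M pol θ s s' * (resolvent M pol θ).mulVec f s'
      = f s - ∑ s', occ M pol θ s' * f s' := by
  have h : (1 - M.γ • Pmat M pol θ).mulVec ((resolvent M pol θ).mulVec f) s = f s := by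
    rw [Matrix.mulVec_mulVec, resolvent, Matrix.mul_nonsing_inv _ (isUnit_det_discounted M pol θ),
      Matrix.one_mulVec]
  rw [Matrix.sub_mulVec, Matrix.one_mulVec, Matrix.smul_mulVec] at h
  simp only [Pi.sub_apply, Pi.smul_apply, smul_eq_mul] at h
  -- The restart part of P̃ contributes (1 - γ)ρᵀV, the same number from every state; it is exactly
  -- the occupancy mean of `f`.
  have h2 : ∑ s', occ M pol θ s' * f s'
      = (1 - M.γ) * ∑ s', M.ρ s' * (resolvent M pol θ).mulVec f s' := by
    simp only [occ_eq_resolvent, Matrix.mulVec, dotProduct, Finset.mul_sum, Finset.sum_mul]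
    rw [Finset.sum_comm]
    exact Finset.sum_congr rfl fun i _ => Finset.sum_congr rfl fun j _ => by ring
  simp only [PmatTilde_apply, add_mul, Finset.sum_add_distrib, mul_assoc, ← Finset.mul_sum]
  rw [h2]
  simp only [Matrix.mulVec, dotProduct] at h ⊢
  linarith

end Discounted

/-! ### Uniform lower bound for the occupancy measure -/

section LowerBound

/-- Along a compact family of irreducible matrices the positive entries of powers are
bounded below. -/
lemma exists_pow_lower_bound {X : Type*} [Fintype X] [DecidableEq X] {𝒦 : Set (Matrix X X ℝ)}
    (hc : IsCompact 𝒦) (hirr : ∀ K ∈ 𝒦, K.IsIrreducible) :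
    ∃ ε > 0, ∀ K ∈ 𝒦, ∀ x y, ∃ k : ℕ, ε ≤ (K ^ k) x y := by
  have key : ∀ x y, ∃ ε > 0, ∀ K ∈ 𝒦, ∃ k : ℕ, ε ≤ (K ^ k) x y := by
    intro x y
    -- Compactness reduces the bound to a local one: it passes to subsets and to finite unions.
    refine hc.induction_on (p := fun s => ∃ ε > 0, ∀ K ∈ s, ∃ k : ℕ, ε ≤ (K ^ k) x y)
      ⟨1, one_pos, by simp⟩ ?_ ?_ ?_
    · rintro s t hst ⟨ε, hε, h⟩
      exact ⟨ε, hε, fun K hK => h K (hst hK)⟩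
    · rintro s t ⟨ε, hε, h⟩ ⟨ε', hε', h'⟩
      refine ⟨min ε ε', lt_min hε hε', ?_⟩
      rintro K (hK | hK)
      · exact (h K hK).imp fun k hk => (min_le_left _ _).trans hk
      · exact (h' K hK).imp fun k hk => (min_le_right _ _).trans hk
    · intro K hK
      -- Irreducibility makes some power positive at (x, y), and by continuity the same power keeps
      -- half of that value on a neighbourhood of `K`.
      obtain ⟨k, -, hk⟩ :=
        (Matrix.isIrreducible_iff_exists_pow_pos (hirr K hK).nonneg).1 (hirr K hK) x y
      have hcont : Continuous fun K : Matrix X X ℝ => (K ^ k) x y :=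
        (continuous_id.pow k).matrix_elem x y
      refine ⟨{L | (K ^ k) x y / 2 < (L ^ k) x y}, mem_nhdsWithin_of_mem_nhds
        ((isOpen_lt continuous_const hcont).mem_nhds (half_lt_self hk)), _, half_pos hk, ?_⟩
      exact fun L hL => ⟨k, le_of_lt hL⟩
  choose ε hε h using key
  rcases isEmpty_or_nonempty X with hX | hX
  · exact ⟨1, one_pos, fun K _ x => hX.elim x⟩
  · obtain ⟨z, hz⟩ := Finite.exists_min fun z : X × X => ε z.1 z.2
    exact ⟨ε z.1 z.2, hε _ _, fun K hK x y => (h x y K hK).imp fun k hk => (hz (x, y)).trans hk⟩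

/-- All entries of these kernels lie in [0, 1], so the closure is a closed subset of a compact cube.
-/
lemma isCompact_closure_Ktilde (M : MDP S A) (pol : PolicyFamily S A d) :
    IsCompact (closure (Set.range (Ktilde M pol))) := by
  have hc : IsCompact (Set.univ.pi fun _ : S × A => Set.univ.pi fun _ : S × A =>
      Set.Icc (0 : ℝ) 1) := isCompact_univ_pi fun _ => isCompact_univ_pi fun _ => isCompact_Icc
  refine hc.of_isClosed_subset isClosed_closure (closure_minimal ?_ hc.isClosed)
  rintro _ ⟨θ, rfl⟩ x - y -
  have h1 : 0 ≤ M.pTilde x.1 x.2 y.1 := add_nonneg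
    (mul_nonneg M.γ_pos.le (M.p_nonneg _ _ _))
    (mul_nonneg (sub_nonneg.2 M.γ_lt_one.le) (M.ρ_nonneg _))
  have hp : M.p x.1 x.2 y.1 ≤ 1 := by
    rw [← M.p_sum x.1 x.2]
    exact Finset.single_le_sum (fun i _ => M.p_nonneg _ _ i) (Finset.mem_univ y.1)
  have hρ : M.ρ y.1 ≤ 1 := by
    rw [← M.ρ_sum]
    exact Finset.single_le_sum (fun i _ => M.ρ_nonneg i) (Finset.mem_univ y.1)
  have h2 : M.pTilde x.1 x.2 y.1 ≤ 1 := by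
    have a := mul_le_mul_of_nonneg_left hp M.γ_pos.le
    have b := mul_le_mul_of_nonneg_left hρ (sub_nonneg.2 M.γ_lt_one.le)
    simp only [MDP.pTilde]
    linarith
  have hπ : pol.prob θ y.1 y.2 ≤ 1 := by
    rw [← pol.sum_one θ y.1]
    exact Finset.single_le_sum (fun i _ => pol.nonneg θ _ i) (Finset.mem_univ y.2)
  exact ⟨mul_nonneg h1 (pol.nonneg _ _ _), mul_le_one₀ h2 (pol.nonneg _ _ _) hπ⟩

/-- `d_{ρ,θ} ⊗ π_θ` is stationary for `K̃_θ`. -/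
lemma occ_mul_prob_stationary (M : MDP S A) (pol : PolicyFamily S A d)
    (θ : EuclideanSpace ℝ (Fin d)) (k : ℕ) (y : S × A) :
    ∑ x : S × A, (occ M pol θ x.1 * pol.prob θ x.1 x.2) * (Ktilde M pol θ ^ k) x y
      = occ M pol θ y.1 * pol.prob θ y.1 y.2 := by
  induction k generalizing y with
  | zero => simp [Matrix.one_apply]
  | succ k ih =>
    simp only [pow_succ, Matrix.mul_apply, Finset.mul_sum]
    rw [Finset.sum_comm]
    simp only [← mul_assoc, ← Finset.sum_mul, ih]
    -- Summing out the action reduces K̃ to P̃, for which the flow equation is the statement that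
    -- the occupancy measure is stationary.
    have h1 : ∀ s, ∑ a, occ M pol θ s * pol.prob θ s a * M.pTilde s a y.1
        = occ M pol θ s * PmatTilde M pol θ s y.1 := fun s => by
      rw [PmatTilde, Matrix.of_apply, Finset.mul_sum]
      exact Finset.sum_congr rfl fun a _ => by ring
    have h2 : ∑ s, occ M pol θ s * PmatTilde M pol θ s y.1 = occ M pol θ y.1 := by
      simp only [PmatTilde_apply, mul_add, Finset.sum_add_distrib, ← Finset.sum_mul, occ_sum]
      rw [occ_flow M pol θ y.1, Finset.mul_sum]
      rw [add_comm, one_mul]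
      congr 1
      exact Finset.sum_congr rfl fun a _ => by ring
    simp only [Ktilde, Matrix.of_apply, ← mul_assoc, ← Finset.sum_mul]
    rw [Fintype.sum_prod_type]
    simp only [h1, h2]

/-- The stationary law of K̃ gives some pair mass at least 1/|S × A|, and from there a suitable
power carries a fraction ε to any (s, a). The power may depend on θ, since stationarity holds for
all powers. -/
lemma exists_occ_lower_bound (M : MDP S A) (pol : PolicyFamily S A d)
    (herg : ErgodicClosure M pol) :
    ∃ ε > 0, ∀ θ s, ε ≤ occ M pol θ s := by
  obtain ⟨ε, hε, h⟩ := exists_pow_lower_bound (isCompact_closure_Ktilde M pol)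
    fun K hK => (herg K hK).irreducible
  have := M.nonempty_state
  have hA : ∀ _ : EuclideanSpace ℝ (Fin d), Nonempty A := fun θ => by
    by_contra hA
    rw [not_nonempty_iff] at hA
    have := pol.sum_one θ (Classical.arbitrary S)
    simp at this
  have := hA 0
  have hcard : 0 < (Fintype.card (S × A) : ℝ) := by exact_mod_cast Fintype.card_pos
  refine ⟨ε / Fintype.card (S × A), div_pos hε hcard, fun θ s => ?_⟩
  set μ : S × A → ℝ := fun x => occ M pol θ x.1 * pol.prob θ x.1 x.2 with hμ
  have hμ0 : ∀ x, 0 ≤ μ x := fun x => mul_nonneg (occ_nonneg _ _ _ _) (pol.nonneg _ _ _)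
  have hμ1 : ∑ x, μ x = 1 := by
    rw [Fintype.sum_prod_type]
    simp only [hμ, ← Finset.mul_sum, pol.sum_one, mul_one, occ_sum]
  obtain ⟨x₀, hx₀⟩ := Finite.exists_max μ
  have hbig : 1 ≤ Fintype.card (S × A) * μ x₀ := by
    rw [← hμ1]
    refine (Finset.sum_le_sum fun x _ => hx₀ x).trans_eq ?_
    simp
  let a : A := Classical.arbitrary A
  obtain ⟨k, hk⟩ := h _ (subset_closure ⟨θ, rfl⟩) x₀ (s, a)
  have hnn : ∀ (k : ℕ) x y, 0 ≤ (Ktilde M pol θ ^ k) x y := by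
    intro k
    induction k with
    | zero => intro x y; rw [pow_zero, Matrix.one_apply]; split_ifs <;> norm_num
    | succ k ih =>
      intro x y
      rw [pow_succ, Matrix.mul_apply]
      exact Finset.sum_nonneg fun z _ => mul_nonneg (ih x z)
        ((herg _ (subset_closure ⟨θ, rfl⟩)).irreducible.nonneg z y)
  have h1 : μ x₀ * ε ≤ μ (s, a) := by
    have e : μ (s, a) = _ := (occ_mul_prob_stationary M pol θ k (s, a)).symm
    rw [e]
    refine (mul_le_mul_of_nonneg_left hk (hμ0 x₀)).trans ?_
    exact Finset.single_le_sum (f := fun x => μ x * (Ktilde M pol θ ^ k) x (s, a))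
      (fun x _ => mul_nonneg (hμ0 x) (hnn k x _)) (Finset.mem_univ x₀)
  have hπ : pol.prob θ s a ≤ 1 := by
    rw [← pol.sum_one θ s]
    exact Finset.single_le_sum (fun i _ => pol.nonneg θ _ i) (Finset.mem_univ a)
  have h2 : μ (s, a) ≤ occ M pol θ s := mul_le_of_le_one_right (occ_nonneg _ _ _ _) hπ
  rw [div_le_iff₀ hcard]
  nlinarith

end LowerBound

/-! ### Coercivity and the equilibria of critic and target -/

section Coercive

lemma isUnit_det_of_coercive {B : Matrix (Fin m) (Fin m) ℝ} {ζ : ℝ} (hζ : 0 < ζ)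
    (h : ∀ w : EuclideanSpace ℝ (Fin m), ζ * ‖w‖ ^ 2 ≤ dotProduct w.ofLp (B.mulVec w.ofLp)) :
    IsUnit B.det := by
  rw [← Matrix.isUnit_iff_isUnit_det, ← Matrix.mulVec_injective_iff_isUnit]
  intro v w hvw
  have h0 : B.mulVec (v - w) = 0 := by
    rw [Matrix.mulVec_sub, sub_eq_zero]
    exact hvw
  have h1 := h (WithLp.toLp 2 (v - w))
  simp only [h0, dotProduct_zero] at h1
  have h2 : ‖WithLp.toLp 2 (v - w)‖ = 0 := by
    by_contra hne
    have : 0 < ‖WithLp.toLp 2 (v - w)‖ ^ 2 := by positivity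
    nlinarith
  exact sub_eq_zero.1 ((WithLp.toLp_eq_zero 2).1 (norm_eq_zero.1 h2))

/-- For the j-th column w of the inverse, B w is the j-th basis vector, so coercivity reads ζ‖w‖² ≤
w_j ≤ ‖w‖. -/
lemma abs_inv_le_of_coercive {B : Matrix (Fin m) (Fin m) ℝ} {ζ : ℝ} (hζ : 0 < ζ)
    (h : ∀ w : EuclideanSpace ℝ (Fin m), ζ * ‖w‖ ^ 2 ≤ dotProduct w.ofLp (B.mulVec w.ofLp))
    (i j : Fin m) : |B⁻¹ i j| ≤ 1 / ζ := by
  set w : EuclideanSpace ℝ (Fin m) := WithLp.toLp 2 (B⁻¹.mulVec (Pi.single j 1)) with hw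
  have hwi : ∀ i, w i = B⁻¹ i j := fun i => by simp [hw]
  have h1 := h w
  have h2 : B.mulVec w.ofLp = Pi.single j 1 := by
    simp only [hw]
    rw [Matrix.mulVec_mulVec, Matrix.mul_nonsing_inv _ (isUnit_det_of_coercive hζ h),
      Matrix.one_mulVec]
  rw [h2, dotProduct_single_one] at h1
  have h3 : w j ≤ ‖w‖ := (le_abs_self _).trans (PiLp.norm_apply_le w j)
  have h4 : ‖w‖ ≤ 1 / ζ := by
    rw [le_div_iff₀ hζ]
    rcases (norm_nonneg w).eq_or_lt with h0 | h0
    · rw [← h0]; simp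
    · nlinarith
  rw [← hwi]
  exact (PiLp.norm_apply_le w i).trans h4

/-- Full column rank means injectivity, and an injective linear map on a finite-dimensional space is
bounded below. -/
lemma exists_feature_lower_bound (Φ : Matrix S (Fin m) ℝ) (hΦ : Φ.rank = m) :
    ∃ κ > 0, ∀ w : EuclideanSpace ℝ (Fin m), κ * ‖w‖ ^ 2 ≤ ∑ s, (Φ.mulVec w.ofLp s) ^ 2 := by
  have hli : LinearIndependent ℝ Φ.col := by
    rw [linearIndependent_iff_card_eq_finrank_span, Set.finrank, ← Matrix.rank_eq_finrank_span_cols,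
      hΦ, Fintype.card_fin]
  have hinj : Function.Injective Φ.mulVec := Matrix.mulVec_injective_iff.2 hli
  let f : EuclideanSpace ℝ (Fin m) →ₗ[ℝ] (S → ℝ) :=
    Φ.mulVecLin ∘ₗ (WithLp.linearEquiv 2 ℝ (Fin m → ℝ)).toLinearMap
  have hf : LinearMap.ker f = ⊥ := by
    rw [LinearMap.ker_eq_bot]
    exact hinj.comp (WithLp.linearEquiv 2 ℝ (Fin m → ℝ)).injective
  obtain ⟨K, hK, hanti⟩ := f.exists_antilipschitzWith hf
  have hK' : (0 : ℝ) < K := hK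
  refine ⟨1 / (K : ℝ) ^ 2, by positivity, fun w => ?_⟩
  have h1 : ‖w‖ ≤ K * ‖f w‖ := by simpa using hanti.le_mul_dist w 0
  -- The norm on `S → ℝ` is the sup norm, which is at most the Euclidean one.
  have h2 : ‖f w‖ ^ 2 ≤ ∑ s, (Φ.mulVec w.ofLp s) ^ 2 := by
    have h0 : 0 ≤ ∑ s, (Φ.mulVec w.ofLp s) ^ 2 := Finset.sum_nonneg fun s _ => sq_nonneg _
    have : ‖f w‖ ≤ Real.sqrt (∑ s, (Φ.mulVec w.ofLp s) ^ 2) := by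
      refine (pi_norm_le_iff_of_nonneg (Real.sqrt_nonneg _)).2 fun s => ?_
      refine Real.abs_le_sqrt ?_
      exact Finset.single_le_sum (f := fun s => (Φ.mulVec w.ofLp s) ^ 2)
        (fun s _ => sq_nonneg _) (Finset.mem_univ s)
    calc ‖f w‖ ^ 2 ≤ Real.sqrt (∑ s, (Φ.mulVec w.ofLp s) ^ 2) ^ 2 := by gcongr
      _ = _ := Real.sq_sqrt h0
  calc 1 / (K : ℝ) ^ 2 * ‖w‖ ^ 2 ≤ 1 / (K : ℝ) ^ 2 * (K * ‖f w‖) ^ 2 := by gcongr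
    _ = ‖f w‖ ^ 2 := by field_simp
    _ ≤ _ := h2

lemma dotProduct_Gbar_mulVec (M : MDP S A) (pol : PolicyFamily S A d) (Φ : Matrix S (Fin m) ℝ)
    (θ : EuclideanSpace ℝ (Fin d)) (w : Fin m → ℝ) :
    dotProduct w ((Gbar M pol Φ θ).mulVec w) = ∑ s, occ M pol θ s * (Φ.mulVec w s) ^ 2 := by
  rw [Gbar, ← Matrix.mulVec_mulVec, ← Matrix.mulVec_mulVec, Matrix.dotProduct_mulVec,
    Matrix.vecMul_transpose]
  simp only [dotProduct, Dmat, Matrix.mulVec_diagonal]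
  exact Finset.sum_congr rfl fun s _ => by ring

/-- The quadratic form is Σ d(s)(Φw)(s)²: ergodicity bounds the weights below, and the rank
condition bounds the sum of squares. -/
lemma exists_Gbar_coercive (M : MDP S A) (pol : PolicyFamily S A d) (Φ : Matrix S (Fin m) ℝ)
    (herg : ErgodicClosure M pol) (hΦ : Φ.rank = m) :
    ∃ κ > 0, ∀ (θ : EuclideanSpace ℝ (Fin d)) (w : EuclideanSpace ℝ (Fin m)),
      κ * ‖w‖ ^ 2 ≤ dotProduct w.ofLp ((Gbar M pol Φ θ).mulVec w.ofLp) := by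
  obtain ⟨ε, hε, h⟩ := exists_occ_lower_bound M pol herg
  obtain ⟨κ, hκ, h'⟩ := exists_feature_lower_bound Φ hΦ
  refine ⟨ε * κ, mul_pos hε hκ, fun θ w => ?_⟩
  rw [dotProduct_Gbar_mulVec]
  calc ε * κ * ‖w‖ ^ 2 = ε * (κ * ‖w‖ ^ 2) := by ring
    _ ≤ ε * ∑ s, (Φ.mulVec w.ofLp s) ^ 2 := by gcongr; exact h' w
    _ ≤ _ := by
      rw [Finset.mul_sum]
      exact Finset.sum_le_sum fun s _ => mul_le_mul_of_nonneg_right (h θ s) (sq_nonneg _)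

lemma isUnit_det_Gmat {M : MDP S A} {pol : PolicyFamily S A d} {Φ : Matrix S (Fin m) ℝ}
    {θ : EuclideanSpace ℝ (Fin d)} (h : IsUnit ((Gbar M pol Φ θ)⁻¹ * Gmat M pol Φ θ).det) :
    IsUnit (Gmat M pol Φ θ).det := by
  rw [Matrix.det_mul] at h
  exact isUnit_of_mul_isUnit_right h

lemma Gmat_mulVec_eq_iff {M : MDP S A} {pol : PolicyFamily S A d} {Φ : Matrix S (Fin m) ℝ}
    {θ : EuclideanSpace ℝ (Fin d)} (h : IsUnit (Gmat M pol Φ θ).det)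
    (w : EuclideanSpace ℝ (Fin m)) :
    (Gmat M pol Φ θ).mulVec w.ofLp = hvec M pol Φ θ ↔ w = omegaBarStar M pol Φ θ := by
  constructor
  · intro hw
    rw [omegaBarStar, ← hw, Matrix.mulVec_mulVec, Matrix.nonsing_inv_mul _ h, Matrix.one_mulVec]
  · rintro rfl
    simp only [omegaBarStar]
    rw [Matrix.mulVec_mulVec, Matrix.mul_nonsing_inv _ h, Matrix.one_mulVec]

/-- The equilibrium `ω_*(θ, ω̄)` of the critic for a frozen actor `θ` and target `ω̄`. -/
def omegaStar (M : MDP S A) (pol : PolicyFamily S A d) (Φ : Matrix S (Fin m) ℝ)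
    (θ : EuclideanSpace ℝ (Fin d)) (w : EuclideanSpace ℝ (Fin m)) : EuclideanSpace ℝ (Fin m) :=
  WithLp.toLp 2 ((Gbar M pol Φ θ)⁻¹.mulVec
    (hvec M pol Φ θ + (Gbar M pol Φ θ - Gmat M pol Φ θ).mulVec w.ofLp))

/-- The mean field `Ḡ(θ)⁻¹ G(θ)` of the target variable. -/
def targetDrift (M : MDP S A) (pol : PolicyFamily S A d) (Φ : Matrix S (Fin m) ℝ)
    (θ : EuclideanSpace ℝ (Fin d)) (w : EuclideanSpace ℝ (Fin m)) : EuclideanSpace ℝ (Fin m) :=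
  WithLp.toLp 2 (((Gbar M pol Φ θ)⁻¹ * Gmat M pol Φ θ).mulVec w.ofLp)

/-- Substitute h = G ω̄_* in the definition of ω_*. This identity shows the target's mean field and
also links the critic's equilibrium to ω̄_*. -/
lemma omegaStar_sub {M : MDP S A} {pol : PolicyFamily S A d} {Φ : Matrix S (Fin m) ℝ}
    {θ : EuclideanSpace ℝ (Fin d)} (hb : IsUnit (Gbar M pol Φ θ).det)
    (h : IsUnit (Gmat M pol Φ θ).det) (w : EuclideanSpace ℝ (Fin m)) :
    omegaStar M pol Φ θ w - w = - targetDrift M pol Φ θ (w - omegaBarStar M pol Φ θ) := by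
  have h1 : hvec M pol Φ θ = (Gmat M pol Φ θ).mulVec (omegaBarStar M pol Φ θ).ofLp :=
    ((Gmat_mulVec_eq_iff h _).2 rfl).symm
  apply WithLp.ofLp_injective
  simp only [omegaStar, targetDrift, WithLp.ofLp_sub, WithLp.ofLp_neg]
  rw [h1, Matrix.mulVec_add, Matrix.sub_mulVec, Matrix.mulVec_sub, Matrix.mulVec_mulVec,
    Matrix.mulVec_mulVec, Matrix.mulVec_mulVec, Matrix.nonsing_inv_mul _ hb, Matrix.one_mulVec,
    Matrix.mulVec_sub]
  abel

/-- The mean temporal difference at `s` times the projection of `x` on the feature of `s`. -/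
def criticDrift (M : MDP S A) (pol : PolicyFamily S A d) (Φ : Matrix S (Fin m) ℝ)
    (θ : EuclideanSpace ℝ (Fin d)) (w wbar x : EuclideanSpace ℝ (Fin m)) (s : S) : ℝ :=
  Φ.mulVec x.ofLp s * (Rvec M pol θ s
    + M.γ * (Pmat M pol θ).mulVec (Φ.mulVec wbar.ofLp) s - Φ.mulVec w.ofLp s)

/-- Occupancy averaging turns the temporal difference into h + (Ḡ - G)w̄ - Ḡw, and the first two
terms are Ḡω_* by definition. With x = w - ω_* the right side is the negative of a coercive form. -/
lemma sum_occ_mul_criticDrift {M : MDP S A} {pol : PolicyFamily S A d} {Φ : Matrix S (Fin m) ℝ}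
    {θ : EuclideanSpace ℝ (Fin d)} (hb : IsUnit (Gbar M pol Φ θ).det)
    (w wbar x : EuclideanSpace ℝ (Fin m)) :
    ∑ s, occ M pol θ s * criticDrift M pol Φ θ w wbar x s
      = - dotProduct x.ofLp
          ((Gbar M pol Φ θ).mulVec (w - omegaStar M pol Φ θ wbar).ofLp) := by
  set f : S → ℝ := Rvec M pol θ + M.γ • (Pmat M pol θ).mulVec (Φ.mulVec wbar.ofLp)
    - Φ.mulVec w.ofLp with hf
  have h1 : ∑ s, occ M pol θ s * criticDrift M pol Φ θ w wbar x s
      = dotProduct x.ofLp ((Φ.transpose * Dmat M pol θ).mulVec f) := by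
    rw [← Matrix.mulVec_mulVec, Matrix.dotProduct_mulVec, Matrix.vecMul_transpose]
    simp only [dotProduct, Dmat, Matrix.mulVec_diagonal, criticDrift, hf, Pi.sub_apply,
      Pi.add_apply, Pi.smul_apply, smul_eq_mul]
    exact Finset.sum_congr rfl fun s _ => by ring
  have h2 : (Gbar M pol Φ θ).mulVec (omegaStar M pol Φ θ wbar).ofLp
      = hvec M pol Φ θ + (Gbar M pol Φ θ - Gmat M pol Φ θ).mulVec wbar.ofLp := by
    simp only [omegaStar]
    rw [Matrix.mulVec_mulVec, Matrix.mul_nonsing_inv _ hb, Matrix.one_mulVec]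
  -- The difference is exactly the bootstrap term γΦᵀDPΦ.
  have h3 : Gbar M pol Φ θ - Gmat M pol Φ θ
      = (Φ.transpose * Dmat M pol θ) * (M.γ • Pmat M pol θ) * Φ := by
    simp only [Gbar, Gmat, Matrix.mul_sub, Matrix.sub_mul, Matrix.mul_one, sub_sub_cancel]
  rw [h1, WithLp.ofLp_sub, Matrix.mulVec_sub (Gbar M pol Φ θ), h2, ← dotProduct_neg, h3, hf]
  congr 1
  rw [Matrix.mulVec_sub, Matrix.mulVec_add, hvec, Gbar]
  simp only [← Matrix.mulVec_mulVec, Matrix.smul_mulVec]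
  abel

end Coercive

/-- Strong measurability with respect to a sub-σ-algebra, together with essential boundedness. -/
structure EssBdd {Ω : Type*} {mΩ : MeasurableSpace Ω} (P : Measure Ω) (m' : MeasurableSpace Ω)
    (Y : Ω → ℝ) : Prop where
  meas : StronglyMeasurable[m'] Y
  bdd : ∃ C : ℝ, ∀ᵐ x ∂P, ‖Y x‖ ≤ C

/-! ### Bounded test variables -/

namespace EssBdd

variable {Ω : Type*} {mΩ : MeasurableSpace Ω} {P : Measure Ω} {m' : MeasurableSpace Ω}

lemma mul {Y Z : Ω → ℝ} (hY : EssBdd P m' Y) (hZ : EssBdd P m' Z) :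
    EssBdd P m' (fun x => Y x * Z x) := by
  obtain ⟨C, hC⟩ := hY.bdd
  obtain ⟨D, hD⟩ := hZ.bdd
  refine ⟨hY.meas.mul hZ.meas, C * D, ?_⟩
  filter_upwards [hC, hD] with x a b
  rw [norm_mul]
  exact mul_le_mul a b (norm_nonneg _) ((norm_nonneg _).trans a)

lemma const (c : ℝ) : EssBdd P m' (fun _ => c) :=
  ⟨stronglyMeasurable_const, ‖c‖, by simp⟩

lemma add {Y Z : Ω → ℝ} (hY : EssBdd P m' Y) (hZ : EssBdd P m' Z) :
    EssBdd P m' (fun x => Y x + Z x) := by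
  obtain ⟨C, hC⟩ := hY.bdd
  obtain ⟨D, hD⟩ := hZ.bdd
  refine ⟨hY.meas.add hZ.meas, C + D, ?_⟩
  filter_upwards [hC, hD] with x a b
  exact norm_add_le_of_le a b

lemma sum {ι : Type*} (s : Finset ι) {Y : ι → Ω → ℝ} (hY : ∀ i ∈ s, EssBdd P m' (Y i)) :
    EssBdd P m' (fun x => ∑ i ∈ s, Y i x) := by
  classical
  induction s using Finset.induction_on with
  | empty => simpa using const 0
  | insert i s hi ih =>
    simp only [Finset.sum_insert hi]
    exact (hY i (Finset.mem_insert_self i s)).add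
      (ih fun j hj => hY j (Finset.mem_insert_of_mem hj))

lemma mono {m'' : MeasurableSpace Ω} {Y : Ω → ℝ} (hY : EssBdd P m' Y) (h : m' ≤ m'') :
    EssBdd P m'' Y :=
  ⟨hY.meas.mono h, hY.bdd⟩

lemma integrable [IsFiniteMeasure P] {Y : Ω → ℝ} (hY : EssBdd P m' Y) (h : m' ≤ mΩ) :
    Integrable Y P := by
  obtain ⟨C, hC⟩ := hY.bdd
  exact Integrable.of_bound (hY.meas.mono h).aestronglyMeasurable C hC

lemma indicator {Y : Ω → ℝ} (hY : EssBdd P m' Y) {s : Set Ω} (hs : MeasurableSet[m'] s) :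
    EssBdd P m' (s.indicator Y) := by
  obtain ⟨C, hC⟩ := hY.bdd
  refine ⟨hY.meas.indicator hs, C, ?_⟩
  filter_upwards [hC] with x a
  exact (norm_indicator_le_norm_self Y x).trans a

end EssBdd

lemma essBdd_comp_finite {Ω T : Type*} {mΩ : MeasurableSpace Ω} (P : Measure Ω) [Finite T]
    [MeasurableSpace T] [MeasurableSingletonClass T] {m' : MeasurableSpace Ω} {f : Ω → T}
    (hf : Measurable f) (g : T → ℝ) : EssBdd (mΩ := mΩ) P m' (fun x => g (f x)) := by
  cases nonempty_fintype T
  refine ⟨((measurable_of_finite g).comp hf).stronglyMeasurable, ∑ y, ‖g y‖, ?_⟩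
  exact ae_of_all _ fun x => Finset.single_le_sum (f := fun y => ‖g y‖)
    (fun y _ => norm_nonneg _) (Finset.mem_univ (f x))

lemma SlowAdapted.essBdd {Ω : Type*} {mΩ : MeasurableSpace Ω} {P : Measure Ω}
    {𝓕 : Filtration ℕ mΩ} {r : ℕ → ℝ} {u : ℕ → Ω → ℝ} (hu : SlowAdapted P 𝓕 r u) (t : ℕ) :
    EssBdd P (𝓕 t) (u t) := by
  obtain ⟨C, hC⟩ := hu.bdd
  exact ⟨hu.meas t, C, hC.mono fun x hx => hx t⟩

/-- The form in which every conditional law is used: integrated against bounded weights measurable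
with respect to the conditioning σ-algebra. -/
lemma integral_mul_condExp {Ω : Type*} {mΩ : MeasurableSpace Ω} {P : Measure Ω}
    [IsFiniteMeasure P] {m' : MeasurableSpace Ω} (hm : m' ≤ mΩ) {Y f g : Ω → ℝ}
    (hY : EssBdd P m' Y) (hf : Integrable f P) (hg : P[f | m'] =ᵐ[P] g) :
    ∫ x, Y x * f x ∂P = ∫ x, Y x * g x ∂P := by
  obtain ⟨C, hC⟩ := hY.bdd
  have h := condExp_stronglyMeasurable_mul_of_bound hm hY.meas hf C hC
  rw [← integral_condExp hm (f := fun x => Y x * f x)]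
  refine integral_congr_ae ?_
  filter_upwards [h, hg] with x a b
  rw [← b]
  exact a

/-! ### One-step laws of the samples, tested against the past -/

section Sampling

variable {Ω : Type*} [mΩ : MeasurableSpace Ω] [MeasurableSpace S] [MeasurableSingletonClass S]
  [MeasurableSpace A] [MeasurableSingletonClass A] {P : Measure Ω} [IsProbabilityMeasure P]
  {M : MDP S A} {pol : PolicyFamily S A d} {θ : ℕ → Ω → EuclideanSpace ℝ (Fin d)}
  {X : Samples S A Ω} {𝓕 : Filtration ℕ mΩ}

lemma integrable_indicator_one {s : Set Ω} (hs : MeasurableSet s) :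
    Integrable (s.indicator fun _ => (1 : ℝ)) P :=
  (integrable_const 1).indicator hs

lemma IsSampling.integral_indicator_act (hX : IsSampling M pol θ X 𝓕 P) (t : ℕ) (a : A)
    {Y : Ω → ℝ} (hY : EssBdd P (𝓕 t) Y) :
    ∫ x, Y x * (X.act t ⁻¹' {a}).indicator (fun _ => (1 : ℝ)) x ∂P
      = ∫ x, Y x * pol.prob (θ t x) (X.stateT t x) a ∂P :=
  integral_mul_condExp (𝓕.le t) hY
    (integrable_indicator_one (((hX.meas_act t).mono (𝓕.le _) le_rfl) (measurableSet_singleton a)))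
    (hX.law_act t a)

lemma IsSampling.integral_comp_state_act (hX : IsSampling M pol θ X 𝓕 P) (t : ℕ) (g : S → A → ℝ)
    {Y : Ω → ℝ} (hY : EssBdd P (𝓕 t) Y)
    (hπ : ∀ a, EssBdd P (𝓕 t) (fun x => pol.prob (θ t x) (X.stateT t x) a)) :
    ∫ x, Y x * g (X.stateT t x) (X.act t x) ∂P
      = ∫ x, Y x * ∑ a, pol.prob (θ t x) (X.stateT t x) a * g (X.stateT t x) a ∂P := by
  have hYg : ∀ a, EssBdd P (𝓕 t) (fun x => Y x * g (X.stateT t x) a) := fun a =>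
    hY.mul (essBdd_comp_finite P (hX.meas_state t) fun s => g s a)
  have hms : ∀ a, MeasurableSet (X.act t ⁻¹' {a}) := fun a =>
    ((hX.meas_act t).mono (𝓕.le _) le_rfl) (measurableSet_singleton a)
  have e1 : ∀ x, Y x * g (X.stateT t x) (X.act t x)
      = ∑ a, (Y x * g (X.stateT t x) a) * (X.act t ⁻¹' {a}).indicator (fun _ => (1 : ℝ)) x := by
    intro x
    rw [Finset.sum_eq_single (X.act t x)]
    · simp
    · intro b _ hb
      rw [Set.indicator_of_notMem (fun h => hb h.symm), mul_zero]
    · simp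
  have e2 : ∀ x, Y x * ∑ a, pol.prob (θ t x) (X.stateT t x) a * g (X.stateT t x) a
      = ∑ a, (Y x * g (X.stateT t x) a) * pol.prob (θ t x) (X.stateT t x) a := by
    intro x
    rw [Finset.mul_sum]
    exact Finset.sum_congr rfl fun a _ => by ring
  simp only [e1, e2]
  rw [integral_finsetSum, integral_finsetSum]
  · exact Finset.sum_congr rfl fun a _ => hX.integral_indicator_act t a (hYg a)
  · exact fun a _ => ((hYg a).mul (hπ a)).integrable (𝓕.le t)
  · intro a _
    refine EssBdd.integrable (m' := mΩ) ?_ le_rfl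
    exact ((hYg a).mono (𝓕.le t)).mul ((EssBdd.const 1).indicator (hms a))

lemma IsSampling.sup_comap_act_le (hX : IsSampling M pol θ X 𝓕 P) (t : ℕ) :
    (𝓕 t : MeasurableSpace Ω) ⊔ MeasurableSpace.comap (X.act t) inferInstance ≤ mΩ :=
  sup_le (𝓕.le t) (((hX.meas_act t).mono (𝓕.le _) le_rfl).comap_le)

lemma IsSampling.integrable_rew (hX : IsSampling M pol θ X 𝓕 P) (t : ℕ) :
    Integrable (X.rew t) P :=
  Integrable.of_bound ((hX.meas_rew t).mono (𝓕.le _) le_rfl).aestronglyMeasurable M.UR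
    (hX.rew_bound t)

/-- Two conditionings: on the past with the action, which yields the mean reward, and then on the
past alone, which averages over the policy. -/
lemma IsSampling.integral_rew (hX : IsSampling M pol θ X 𝓕 P) (t : ℕ)
    {Y : Ω → ℝ} (hY : EssBdd P (𝓕 t) Y)
    (hπ : ∀ a, EssBdd P (𝓕 t) (fun x => pol.prob (θ t x) (X.stateT t x) a)) :
    ∫ x, Y x * X.rew t x ∂P = ∫ x, Y x * Rvec M pol (θ t x) (X.stateT t x) ∂P := by
  rw [integral_mul_condExp (hX.sup_comap_act_le t) (hY.mono le_sup_left) (hX.integrable_rew t)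
    (hX.mean_rew t), hX.integral_comp_state_act t M.R hY hπ]
  rfl

lemma IsSampling.integral_indicator_next (hX : IsSampling M pol θ X 𝓕 P) (t : ℕ) (s' : S)
    {Y : Ω → ℝ} (hY : EssBdd P (𝓕 t) Y)
    (hπ : ∀ a, EssBdd P (𝓕 t) (fun x => pol.prob (θ t x) (X.stateT t x) a)) :
    ∫ x, Y x * (X.next t ⁻¹' {s'}).indicator (fun _ => (1 : ℝ)) x ∂P
      = ∫ x, Y x * Pmat M pol (θ t x) (X.stateT t x) s' ∂P := by
  rw [integral_mul_condExp (hX.sup_comap_act_le t) (hY.mono le_sup_left)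
    (integrable_indicator_one (((hX.meas_next t).mono (𝓕.le _) le_rfl)
      (measurableSet_singleton s'))) (hX.law_next t s'),
    hX.integral_comp_state_act t (fun s a => M.p s a s') hY hπ]
  simp only [Pmat, Matrix.of_apply, mul_comm]

/-- The information available before the restart state and the coin are drawn. -/
abbrev Samples.sigmaBeforeRestart (X : Samples S A Ω) (𝓕 : Filtration ℕ mΩ) (t : ℕ) :
    MeasurableSpace Ω :=
  (𝓕 t : MeasurableSpace Ω) ⊔
    MeasurableSpace.comap (fun x => (X.act t x, X.next t x, X.rew t x)) inferInstance

/-- The next state equals s' either through the transition, with the coin true, or through the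
restart, with the coin false. The two parts give the summands γP and (1 - γ)ρ of P̃. -/
lemma IsSampling.integral_indicator_state_succ (hX : IsSampling M pol θ X 𝓕 P) (t : ℕ) (s' : S)
    {Y : Ω → ℝ} (hY : EssBdd P (𝓕 t) Y)
    (hπ : ∀ a, EssBdd P (𝓕 t) (fun x => pol.prob (θ t x) (X.stateT t x) a)) :
    ∫ x, Y x * (X.stateT (t + 1) ⁻¹' {s'}).indicator (fun _ => (1 : ℝ)) x ∂P
      = ∫ x, Y x * PmatTilde M pol (θ t x) (X.stateT t x) s' ∂P := by
  have mact := (hX.meas_act t).mono (𝓕.le _) le_rfl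
  have mnext := (hX.meas_next t).mono (𝓕.le _) le_rfl
  have mrew := (hX.meas_rew t).mono (𝓕.le _) le_rfl
  have mreset := (hX.meas_reset t).mono (𝓕.le _) le_rfl
  have mcoin := (hX.meas_coin t).mono (𝓕.le _) le_rfl
  have h𝒢le : X.sigmaBeforeRestart 𝓕 t ≤ mΩ := sup_le (𝓕.le t) (mact.prodMk (mnext.prodMk mrew)).comap_le
  have hnext𝒢 : MeasurableSet[X.sigmaBeforeRestart 𝓕 t] (X.next t ⁻¹' {s'}) := by
    have h1 : MeasurableSet[MeasurableSpace.comap (fun x => (X.act t x, X.next t x, X.rew t x))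
        inferInstance] (X.next t ⁻¹' {s'}) :=
      ⟨(fun z : A × S × ℝ => z.2.1) ⁻¹' {s'},
        (measurable_fst.comp measurable_snd) (measurableSet_singleton s'), rfl⟩
    exact (le_sup_right : _ ≤ X.sigmaBeforeRestart 𝓕 t) _ h1
  set J : S → Bool → Ω → ℝ := fun s b =>
    (X.reset t ⁻¹' {s} ∩ X.coin t ⁻¹' {b}).indicator (fun _ => (1 : ℝ)) with hJ
  have mJ : ∀ s b, MeasurableSet (X.reset t ⁻¹' {s} ∩ X.coin t ⁻¹' {b}) := fun s b =>
    (mreset (measurableSet_singleton s)).inter (mcoin (measurableSet_singleton b))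
  have hJint : ∀ (W : Ω → ℝ), EssBdd P (X.sigmaBeforeRestart 𝓕 t) W → ∀ s b, Integrable (fun x => W x * J s b x) P := by
    intro W hW s b
    refine EssBdd.integrable (m' := mΩ) ?_ le_rfl
    exact (hW.mono h𝒢le).mul ((EssBdd.const 1).indicator (mJ s b))
  have hJlaw : ∀ (W : Ω → ℝ), EssBdd P (X.sigmaBeforeRestart 𝓕 t) W → ∀ s b,
      ∫ x, W x * J s b x ∂P = (M.ρ s * (if b then M.γ else 1 - M.γ)) * ∫ x, W x ∂P := by
    intro W hW s b
    rw [integral_mul_condExp h𝒢le hW (integrable_indicator_one (mJ s b)) (hX.law_reset_coin t s b),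
      integral_mul_const, mul_comm]
  have hY𝒢 : EssBdd P (X.sigmaBeforeRestart 𝓕 t) Y := hY.mono le_sup_left
  set W : Ω → ℝ := fun x => Y x * (X.next t ⁻¹' {s'}).indicator (fun _ => (1 : ℝ)) x with hW
  have hW𝒢 : EssBdd P (X.sigmaBeforeRestart 𝓕 t) W := hY𝒢.mul ((EssBdd.const 1).indicator hnext𝒢)
  -- Only the joint law of restart state and coin is available, so the coin alone is recovered by
  -- summing over all restart states.
  have e1 : ∀ x, Y x * (X.stateT (t + 1) ⁻¹' {s'}).indicator (fun _ => (1 : ℝ)) x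
      = (∑ s, W x * J s true x) + Y x * J s' false x := by
    intro x
    rw [← Finset.mul_sum, Finset.sum_eq_single (X.reset t x)]
    · simp only [hW, hJ, Set.indicator, Set.mem_preimage, Set.mem_singleton_iff, Set.mem_inter_iff,
        hX.state_succ]
      cases X.coin t x <;> simp
    · intro b _ hb
      rw [hJ]
      exact Set.indicator_of_notMem (fun h => hb h.1.symm) _
    · simp
  simp only [e1]
  rw [integral_add (integrable_finsetSum _ fun s _ => hJint W hW𝒢 s true)
    (hJint Y hY𝒢 s' false), integral_finsetSum _ fun s _ => hJint W hW𝒢 s true]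
  simp only [hJlaw W hW𝒢, hJlaw Y hY𝒢, if_true, Bool.false_eq_true, if_false]
  rw [← Finset.sum_mul, ← Finset.sum_mul, M.ρ_sum, hW, hX.integral_indicator_next t s' hY hπ]
  have hP : EssBdd P (𝓕 t) (fun x => Pmat M pol (θ t x) (X.stateT t x) s') := by
    simp only [Pmat, Matrix.of_apply]
    exact EssBdd.sum _ fun a _ =>
      (essBdd_comp_finite P (hX.meas_state t) fun s => M.p s a s').mul (hπ a)
  rw [← integral_const_mul, ← integral_const_mul, ← integral_add]
  · refine integral_congr_ae (ae_of_all _ fun x => ?_)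
    simp only [PmatTilde_apply]
    ring
  · exact ((hY.mul hP).integrable (𝓕.le t)).const_mul _
  · exact (hY.integrable (𝓕.le t)).const_mul _

end Sampling

/-- An adapted process, possibly unbounded, whose increments are almost surely `O(r t)`. -/
structure SlowParam {Ω E : Type*} {mΩ : MeasurableSpace Ω} [NormedAddCommGroup E]
    (P : Measure Ω) (𝓕 : Filtration ℕ mΩ) (r : ℕ → ℝ) (θ : ℕ → Ω → E) : Prop where
  meas : ∀ t, StronglyMeasurable[𝓕 t] (θ t)
  incr : ∃ K : ℝ, ∀ᵐ x ∂P, ∀ t, ‖θ (t + 1) x - θ t x‖ ≤ K * r t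

/-! ### Slow variation of all quantities that depend on the actor -/

section ParamFunctions

variable {Ω : Type*} {mΩ : MeasurableSpace Ω} {P : Measure Ω} {𝓕 : Filtration ℕ mΩ}
  {r : ℕ → ℝ} {θ : ℕ → Ω → EuclideanSpace ℝ (Fin d)} {M : MDP S A} {pol : PolicyFamily S A d}
  {Φ : Matrix S (Fin m) ℝ}

/-- The matrices and vectors below depend on θ only through these probabilities, so their Lipschitz
property is the only regularity in θ needed for them. -/
lemma SlowParam.prob (hθ : SlowParam P 𝓕 r θ) (hpol : PolicyRegular pol) (s : S) (a : A) :
    SlowAdapted P 𝓕 r (fun t x => pol.prob (θ t x) s a) := by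
  obtain ⟨L, hL⟩ := hpol.lipschitz
  obtain ⟨K, hK⟩ := hθ.incr
  refine SlowAdapted.lipschitz_comp (hL s a) (C := 1) (fun y => ?_) hθ.meas hK
  rw [Real.norm_of_nonneg (pol.nonneg _ _ _), ← pol.sum_one y s]
  exact Finset.single_le_sum (fun i _ => pol.nonneg y _ i) (Finset.mem_univ a)

lemma SlowParam.Pmat (hθ : SlowParam P 𝓕 r θ) (hpol : PolicyRegular pol) (s s' : S) :
    SlowAdapted P 𝓕 r (fun t x => Pmat M pol (θ t x) s s') := by
  simp only [TargetAC.Pmat, Matrix.of_apply]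
  exact SlowAdapted.sum _ fun a _ => (SlowAdapted.const _).mul (hθ.prob hpol s a)

lemma SlowParam.discounted (hθ : SlowParam P 𝓕 r θ) (hpol : PolicyRegular pol) (s s' : S) :
    SlowAdapted P 𝓕 r
      (fun t x => (1 - M.γ • TargetAC.Pmat M pol (θ t x) : Matrix S S ℝ) s s') := by
  simp only [Matrix.sub_apply, Matrix.smul_apply, smul_eq_mul]
  exact (SlowAdapted.const _).sub ((SlowAdapted.const _).mul (hθ.Pmat hpol s s'))

lemma SlowParam.resolvent (hθ : SlowParam P 𝓕 r θ) (hpol : PolicyRegular pol) (s s' : S) :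
    SlowAdapted P 𝓕 r (fun t x => resolvent M pol (θ t x) s s') :=
  SlowAdapted.matrix_inv (hθ.discounted hpol) (fun _ _ => isUnit_det_discounted M pol _)
    (fun _ _ => abs_resolvent_le M pol _) s s'

lemma SlowParam.occ (hθ : SlowParam P 𝓕 r θ) (hpol : PolicyRegular pol) (s : S) :
    SlowAdapted P 𝓕 r (fun t x => occ M pol (θ t x) s) := by
  simp only [occ_eq_resolvent]
  exact (SlowAdapted.const _).mul
    (SlowAdapted.sum _ fun s' _ => (SlowAdapted.const _).mul (hθ.resolvent hpol s' s))

lemma SlowParam.Rvec (hθ : SlowParam P 𝓕 r θ) (hpol : PolicyRegular pol) (s : S) :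
    SlowAdapted P 𝓕 r (fun t x => Rvec M pol (θ t x) s) := by
  simp only [TargetAC.Rvec]
  exact SlowAdapted.sum _ fun a _ => (hθ.prob hpol s a).mul (SlowAdapted.const _)

lemma SlowParam.transpose_mul_Dmat (hθ : SlowParam P 𝓕 r θ) (hpol : PolicyRegular pol)
    (i : Fin m) (s : S) :
    SlowAdapted P 𝓕 r (fun t x => (Φ.transpose * Dmat M pol (θ t x)) i s) := by
  simp only [Dmat, Matrix.mul_diagonal]
  exact (SlowAdapted.const _).mul (hθ.occ hpol s)

lemma SlowParam.Gbar (hθ : SlowParam P 𝓕 r θ) (hpol : PolicyRegular pol) (i j : Fin m) :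
    SlowAdapted P 𝓕 r (fun t x => Gbar M pol Φ (θ t x) i j) :=
  SlowAdapted.matrix_mul (B := fun _ _ => Φ) (hθ.transpose_mul_Dmat hpol)
    (fun k l => SlowAdapted.const (Φ k l)) i j

lemma SlowParam.Gmat (hθ : SlowParam P 𝓕 r θ) (hpol : PolicyRegular pol) (i j : Fin m) :
    SlowAdapted P 𝓕 r (fun t x => Gmat M pol Φ (θ t x) i j) :=
  SlowAdapted.matrix_mul (B := fun _ _ => Φ)
    (SlowAdapted.matrix_mul (hθ.transpose_mul_Dmat hpol) (hθ.discounted hpol))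
    (fun k l => SlowAdapted.const (Φ k l)) i j

lemma SlowParam.hvec (hθ : SlowParam P 𝓕 r θ) (hpol : PolicyRegular pol) (i : Fin m) :
    SlowAdapted P 𝓕 r (fun t x => hvec M pol Φ (θ t x) i) :=
  SlowAdapted.mulVec (hθ.transpose_mul_Dmat hpol) (hθ.Rvec hpol) i

lemma SlowParam.Gbar_inv (hθ : SlowParam P 𝓕 r θ) (hpol : PolicyRegular pol)
    (herg : ErgodicClosure M pol) (hΦ : Φ.rank = m) (i j : Fin m) :
    SlowAdapted P 𝓕 r (fun t x => (TargetAC.Gbar M pol Φ (θ t x))⁻¹ i j) := by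
  obtain ⟨κ, hκ, h⟩ := exists_Gbar_coercive M pol Φ herg hΦ
  exact SlowAdapted.matrix_inv (hθ.Gbar hpol) (fun _ _ => isUnit_det_of_coercive hκ (h _))
    (fun _ _ => abs_inv_le_of_coercive hκ (h _)) i j

lemma SlowParam.Gbar_inv_mul_Gmat (hθ : SlowParam P 𝓕 r θ) (hpol : PolicyRegular pol)
    (herg : ErgodicClosure M pol) (hΦ : Φ.rank = m) (i j : Fin m) :
    SlowAdapted P 𝓕 r
      (fun t x => ((TargetAC.Gbar M pol Φ (θ t x))⁻¹ * TargetAC.Gmat M pol Φ (θ t x)) i j) :=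
  SlowAdapted.matrix_mul (hθ.Gbar_inv hpol herg hΦ) (hθ.Gmat hpol) i j

lemma isUnit_det_Gbar (herg : ErgodicClosure M pol) (hΦ : Φ.rank = m)
    (θ : EuclideanSpace ℝ (Fin d)) : IsUnit (Gbar M pol Φ θ).det := by
  obtain ⟨κ, hκ, h⟩ := exists_Gbar_coercive M pol Φ herg hΦ
  exact isUnit_det_of_coercive hκ (h θ)

lemma UnifPosDef.isUnit_det_Gmat (hpd : UnifPosDef M pol Φ) (θ : EuclideanSpace ℝ (Fin d)) :
    IsUnit (TargetAC.Gmat M pol Φ θ).det := by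
  obtain ⟨ζ, hζ, h⟩ := hpd
  exact TargetAC.isUnit_det_Gmat (isUnit_det_of_coercive hζ (h θ))

/-- Coercivity is known for Ḡ and Ḡ⁻¹G but not for G itself, hence the factorization G⁻¹ =
(Ḡ⁻¹G)⁻¹Ḡ⁻¹. -/
lemma SlowParam.Gmat_inv (hθ : SlowParam P 𝓕 r θ) (hpol : PolicyRegular pol)
    (herg : ErgodicClosure M pol) (hΦ : Φ.rank = m) (hpd : UnifPosDef M pol Φ) (i j : Fin m) :
    SlowAdapted P 𝓕 r (fun t x => (TargetAC.Gmat M pol Φ (θ t x))⁻¹ i j) := by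
  obtain ⟨ζ, hζ, h⟩ := hpd
  have e : ∀ t x, (TargetAC.Gmat M pol Φ (θ t x))⁻¹
      = ((TargetAC.Gbar M pol Φ (θ t x))⁻¹ * TargetAC.Gmat M pol Φ (θ t x))⁻¹
        * (TargetAC.Gbar M pol Φ (θ t x))⁻¹ := fun t x => by
    have hb := isUnit_det_Gbar herg hΦ (θ t x)
    rw [Matrix.mul_inv_rev, Matrix.nonsing_inv_nonsing_inv _ hb, Matrix.mul_assoc,
      Matrix.mul_nonsing_inv _ hb, Matrix.mul_one]
  simp only [e]
  exact SlowAdapted.matrix_mul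
    (SlowAdapted.matrix_inv (hθ.Gbar_inv_mul_Gmat hpol herg hΦ)
      (fun _ _ => isUnit_det_of_coercive hζ (h _)) (fun _ _ => abs_inv_le_of_coercive hζ (h _)))
    (hθ.Gbar_inv hpol herg hΦ) i j

lemma SlowParam.omegaBarStar (hθ : SlowParam P 𝓕 r θ) (hpol : PolicyRegular pol)
    (herg : ErgodicClosure M pol) (hΦ : Φ.rank = m) (hpd : UnifPosDef M pol Φ) :
    SlowAdapted P 𝓕 r (fun t x => omegaBarStar M pol Φ (θ t x)) :=
  SlowAdapted.of_coord fun i =>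
    SlowAdapted.mulVec (hθ.Gmat_inv hpol herg hΦ hpd) (hθ.hvec hpol) i

lemma SlowParam.omegaStar (hθ : SlowParam P 𝓕 r θ) (hpol : PolicyRegular pol)
    (herg : ErgodicClosure M pol) (hΦ : Φ.rank = m) {w : ℕ → Ω → EuclideanSpace ℝ (Fin m)}
    (hw : SlowAdapted P 𝓕 r w) :
    SlowAdapted P 𝓕 r (fun t x => omegaStar M pol Φ (θ t x) (w t x)) :=
  SlowAdapted.of_coord fun i => SlowAdapted.mulVec
    (v := fun t x => TargetAC.hvec M pol Φ (θ t x)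
      + (TargetAC.Gbar M pol Φ (θ t x) - TargetAC.Gmat M pol Φ (θ t x)).mulVec (w t x).ofLp)
    (hθ.Gbar_inv hpol herg hΦ)
    (fun j => (hθ.hvec hpol j).add (SlowAdapted.mulVec
      (A := fun t x => TargetAC.Gbar M pol Φ (θ t x) - TargetAC.Gmat M pol Φ (θ t x))
      (v := fun t x => (w t x).ofLp)
      (fun k l => (hθ.Gbar hpol k l).sub (hθ.Gmat hpol k l)) hw.coord j)) i

lemma SlowAdapted.feature_mulVec {w : ℕ → Ω → EuclideanSpace ℝ (Fin m)}
    (hw : SlowAdapted P 𝓕 r w) (s : S) :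
    SlowAdapted P 𝓕 r (fun t x => Φ.mulVec (w t x).ofLp s) :=
  SlowAdapted.mulVec (A := fun _ _ => Φ) (v := fun t x => (w t x).ofLp)
    (fun k l => SlowAdapted.const (Φ k l)) hw.coord s

lemma SlowParam.criticDrift (hθ : SlowParam P 𝓕 r θ) (hpol : PolicyRegular pol)
    {w wbar y : ℕ → Ω → EuclideanSpace ℝ (Fin m)}
    (hw : SlowAdapted P 𝓕 r w) (hwbar : SlowAdapted P 𝓕 r wbar) (hy : SlowAdapted P 𝓕 r y)
    (s : S) :
    SlowAdapted P 𝓕 r (fun t x => criticDrift M pol Φ (θ t x) (w t x) (wbar t x) (y t x) s) :=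
  (hy.feature_mulVec s).mul (((hθ.Rvec hpol s).add ((SlowAdapted.const M.γ).mul
    (SlowAdapted.mulVec (hθ.Pmat hpol) hwbar.feature_mulVec s))).sub (hw.feature_mulVec s))

end ParamFunctions

/-! ### Random functions evaluated at a random point of a finite set -/

section FiniteIndex

variable {Ω T : Type*} {mΩ : MeasurableSpace Ω} [Finite T]
  [MeasurableSpace T] [MeasurableSingletonClass T]

lemma stronglyMeasurable_finite_index {E : Type*} [NormedAddCommGroup E]
    {m' : MeasurableSpace Ω} {f : T → Ω → E} (hf : ∀ y, StronglyMeasurable[m'] (f y))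
    {g : Ω → T} (hg : Measurable[m'] g) : StronglyMeasurable[m'] (fun x => f (g x) x) := by
  classical
  cases nonempty_fintype T
  have e : (fun x => f (g x) x) = fun x => ∑ y, (g ⁻¹' {y}).indicator (f y) x := by
    funext x
    rw [Finset.sum_eq_single (g x)]
    · simp
    · intro b _ hb
      exact Set.indicator_of_notMem (fun h => hb h.symm) _
    · simp
  rw [e]
  exact Finset.stronglyMeasurable_fun_sum _ fun y _ =>
    (hf y).indicator (hg (measurableSet_singleton y))

lemma EssBdd.finite_index {P : Measure Ω} {m' : MeasurableSpace Ω} {f : T → Ω → ℝ}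
    (hf : ∀ y, EssBdd P m' (f y)) {g : Ω → T} (hg : Measurable[m'] g) :
    EssBdd P m' (fun x => f (g x) x) := by
  cases nonempty_fintype T
  choose C hC using fun y => (hf y).bdd
  refine ⟨stronglyMeasurable_finite_index (fun y => (hf y).meas) hg, ∑ y, |C y|, ?_⟩
  filter_upwards [ae_all_iff.2 hC] with x hx
  refine (hx (g x)).trans ((le_abs_self _).trans ?_)
  exact Finset.single_le_sum (f := fun y => |C y|) (fun y _ => abs_nonneg _)
    (Finset.mem_univ (g x))

end FiniteIndex

/-! ### Expectations over the next state -/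

section SamplingExpectation

variable {Ω : Type*} [mΩ : MeasurableSpace Ω] [MeasurableSpace S] [MeasurableSingletonClass S]
  [MeasurableSpace A] [MeasurableSingletonClass A] {P : Measure Ω} [IsProbabilityMeasure P]
  {M : MDP S A} {pol : PolicyFamily S A d} {θ : ℕ → Ω → EuclideanSpace ℝ (Fin d)}
  {X : Samples S A Ω} {𝓕 : Filtration ℕ mΩ} {r : ℕ → ℝ}

lemma integral_finite_index_eq_sum {T : Type*} [Fintype T] [DecidableEq T] [MeasurableSpace T]
    [MeasurableSingletonClass T] {f : T → Ω → ℝ} (hf : ∀ y, EssBdd P mΩ (f y)) {g : Ω → T}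
    (hg : Measurable g) :
    ∫ x, f (g x) x ∂P = ∑ y, ∫ x, f y x * (g ⁻¹' {y}).indicator (fun _ => (1 : ℝ)) x ∂P := by
  rw [← integral_finsetSum]
  · refine integral_congr_ae (ae_of_all _ fun x => ?_)
    dsimp only
    rw [Finset.sum_eq_single (g x)]
    · simp
    · intro b _ hb
      rw [Set.indicator_of_notMem (fun h => hb h.symm), mul_zero]
    · simp
  · exact fun y _ => ((hf y).mul ((EssBdd.const 1).indicator
      (hg (measurableSet_singleton y)))).integrable le_rfl

lemma IsSampling.essBdd_prob (hX : IsSampling M pol θ X 𝓕 P) (hpol : PolicyRegular pol)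
    (hθ : SlowParam P 𝓕 r θ) (t : ℕ) (a : A) :
    EssBdd P (𝓕 t) (fun x => pol.prob (θ t x) (X.stateT t x) a) :=
  EssBdd.finite_index (fun s => (hθ.prob hpol s a).essBdd t) (hX.meas_state t)

lemma IsSampling.essBdd_Pmat (hX : IsSampling M pol θ X 𝓕 P) (hpol : PolicyRegular pol)
    (hθ : SlowParam P 𝓕 r θ) (t : ℕ) (s' : S) :
    EssBdd P (𝓕 t) (fun x => Pmat M pol (θ t x) (X.stateT t x) s') :=
  EssBdd.finite_index (fun s => (hθ.Pmat hpol s s').essBdd t) (hX.meas_state t)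

lemma IsSampling.integral_next (hX : IsSampling M pol θ X 𝓕 P) (hpol : PolicyRegular pol)
    (hθ : SlowParam P 𝓕 r θ) (t : ℕ) {f : S → Ω → ℝ} (hf : ∀ s, EssBdd P (𝓕 t) (f s)) :
    ∫ x, f (X.next t x) x ∂P
      = ∫ x, ∑ s', Pmat M pol (θ t x) (X.stateT t x) s' * f s' x ∂P := by
  rw [integral_finite_index_eq_sum (fun s => (hf s).mono (𝓕.le t))
    ((hX.meas_next t).mono (𝓕.le _) le_rfl), integral_finsetSum]
  · refine Finset.sum_congr rfl fun s' _ => ?_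
    rw [hX.integral_indicator_next t s' (hf s') (hX.essBdd_prob hpol hθ t)]
    simp only [mul_comm]
  · exact fun s' _ => ((hX.essBdd_Pmat hpol hθ t s').mul (hf s')).integrable (𝓕.le t)

lemma IsSampling.integral_state_succ (hX : IsSampling M pol θ X 𝓕 P) (hpol : PolicyRegular pol)
    (hθ : SlowParam P 𝓕 r θ) (t : ℕ) {f : S → Ω → ℝ} (hf : ∀ s, EssBdd P (𝓕 t) (f s)) :
    ∫ x, f (X.stateT (t + 1) x) x ∂P
      = ∫ x, ∑ s', PmatTilde M pol (θ t x) (X.stateT t x) s' * f s' x ∂P := by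
  rw [integral_finite_index_eq_sum (fun s => (hf s).mono (𝓕.le t))
    ((hX.meas_state (t + 1)).mono (𝓕.le _) le_rfl), integral_finsetSum]
  · refine Finset.sum_congr rfl fun s' _ => ?_
    rw [hX.integral_indicator_state_succ t s' (hf s') (hX.essBdd_prob hpol hθ t)]
    simp only [mul_comm]
  · refine fun s' _ => EssBdd.integrable ?_ (𝓕.le t)
    simp only [PmatTilde_apply]
    exact (((EssBdd.const M.γ).mul (hX.essBdd_Pmat hpol hθ t s')).add (EssBdd.const _)).mul (hf s')

end SamplingExpectation

/-- Qualitative properties of the three stepsizes: positivity, separation of the timescales,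
monotonicity and decay. -/
structure StepSizes (αs ξs βs : ℕ → ℝ) : Prop where
  actor_pos : ∀ t, 0 < αs t
  target_pos : ∀ t, 0 < ξs t
  critic_pos : ∀ t, 0 < βs t
  actor_le : ∃ c, ∀ t, αs t ≤ c * ξs t
  target_le : ∃ c, ∀ t, ξs t ≤ c * βs t
  critic_antitone : Antitone βs
  target_antitone : Antitone ξs
  target_tendsto : Filter.Tendsto ξs Filter.atTop (nhds 0)

/-- Once ξ_t < 1 the recursion is a convex combination of b_t and B, which preserves any bound above
B. The absolute value covers the finitely many earlier steps. `C` is chosen before `b`, so that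
pathwise use yields a deterministic bound. -/
lemma exists_bound_of_relaxation {ξs : ℕ → ℝ} (hpos : ∀ t, 0 < ξs t)
    (hlim : Filter.Tendsto ξs Filter.atTop (nhds 0)) (B b₀ : ℝ) :
    ∃ C : ℝ, ∀ b : ℕ → ℝ, b 0 = b₀ → (∀ t, b (t + 1) ≤ |1 - ξs t| * b t + ξs t * B) →
      ∀ t, b t ≤ C := by
  obtain ⟨N, hN⟩ := Filter.eventually_atTop.1 (hlim.eventually (gt_mem_nhds one_pos))
  -- The requirement B ≤ C is kept so that the bound reached at time `N` survives all later convex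
  -- combinations.
  have key : ∀ n : ℕ, ∃ C : ℝ, B ≤ C ∧ ∀ b : ℕ → ℝ, b 0 = b₀ →
      (∀ t, b (t + 1) ≤ |1 - ξs t| * b t + ξs t * B) → ∀ t ≤ n, b t ≤ C := by
    intro n
    induction n with
    | zero =>
      refine ⟨max B b₀, le_max_left _ _, fun b hb _ t ht => ?_⟩
      rw [Nat.le_zero.1 ht, hb]
      exact le_max_right _ _
    | succ n ih =>
      obtain ⟨C, hBC, hC⟩ := ih
      refine ⟨max C (|1 - ξs n| * C + ξs n * B), hBC.trans (le_max_left _ _),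
        fun b hb hstep t ht => ?_⟩
      rcases Nat.le_succ_iff.1 ht with h | rfl
      · exact (hC b hb hstep t h).trans (le_max_left _ _)
      · refine (hstep n).trans (le_trans ?_ (le_max_right _ _))
        gcongr
        exact hC b hb hstep n le_rfl
  obtain ⟨C, hBC, hC⟩ := key N
  refine ⟨C, fun b hb hstep t => ?_⟩
  induction t with
  | zero => exact hC b hb hstep 0 (Nat.zero_le N)
  | succ t ih =>
    rcases le_or_gt (t + 1) N with h | h
    · exact hC b hb hstep _ h
    · have h1 := hN t (Nat.lt_succ_iff.1 h)
      have h0 := hpos t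
      have h2 := hstep t
      rw [abs_of_pos (by linarith)] at h2
      nlinarith

/-! ### Measurability, boundedness and speed of the iterates -/

section Iterates

variable {Ω : Type*} [mΩ : MeasurableSpace Ω] [MeasurableSpace S] [MeasurableSingletonClass S]
  [MeasurableSpace A] [MeasurableSingletonClass A] {P : Measure Ω} [IsProbabilityMeasure P]
  {M : MDP S A} {pol : PolicyFamily S A d} {Φ : Matrix S (Fin m) ℝ} {αs ξs βs : ℕ → ℝ}
  {X : Samples S A Ω} {𝓕 : Filtration ℕ mΩ} {Z : ℕ → Ω → Params d m}

/-- The temporal difference with bootstrap weight `wbar`, at the `t`-th transition. -/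
def tdError (M : MDP S A) (Φ : Matrix S (Fin m) ℝ) (X : Samples S A Ω) (t : ℕ)
    (wbar w : EuclideanSpace ℝ (Fin m)) (x : Ω) : ℝ :=
  X.rew t x + M.γ * inner ℝ (feat Φ (X.next t x)) wbar - inner ℝ (feat Φ (X.stateT t x)) w

/-- The recursion satisfied by the iterates of the algorithm. -/
structure IsIterate (M : MDP S A) (pol : PolicyFamily S A d) (Φ : Matrix S (Fin m) ℝ)
    (αs ξs βs : ℕ → ℝ) (X : Samples S A Ω) (z₀ : Params d m) (Z : ℕ → Ω → Params d m) : Prop where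
  zero : ∀ x, Z 0 x = z₀
  theta_succ : ∀ t x, (Z (t + 1) x).theta = (Z t x).theta
    + (αs t * (1 / (1 - M.γ)) * tdError M Φ X t (Z t x).omega (Z t x).omega x)
      • score pol (Z t x).theta (X.stateT t x) (X.act t x)
  omega_succ : ∀ t x, (Z (t + 1) x).omega = (Z t x).omega
    + (βs t * tdError M Φ X t (Z t x).omegaBar (Z t x).omega x) • feat Φ (X.stateT t x)
  omegaBar_succ : ∀ t x, (Z (t + 1) x).omegaBar = (Z t x).omegaBar
    + ξs t • ((Z (t + 1) x).omega - (Z t x).omegaBar)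

lemma isIterate_iter (M : MDP S A) (pol : PolicyFamily S A d) (Φ : Matrix S (Fin m) ℝ)
    (αs ξs βs : ℕ → ℝ) (z₀ : Params d m) (X : Samples S A Ω) :
    IsIterate M pol Φ αs ξs βs X z₀ (iter M pol Φ αs ξs βs z₀ X) :=
  ⟨fun _ => rfl, fun _ _ => rfl, fun _ _ => rfl, fun _ _ => rfl⟩

lemma IsSampling.stronglyMeasurable_feat_state {θ : ℕ → Ω → EuclideanSpace ℝ (Fin d)}
    (hX : IsSampling M pol θ X 𝓕 P) (t : ℕ) :
    StronglyMeasurable[𝓕 (t + 1)] (fun x => feat Φ (X.stateT t x)) :=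
  stronglyMeasurable_finite_index (f := fun s _ => feat Φ s)
    (fun _ => stronglyMeasurable_const) ((hX.meas_state t).mono (𝓕.mono (Nat.le_succ t)) le_rfl)

lemma IsSampling.stronglyMeasurable_tdError {θ : ℕ → Ω → EuclideanSpace ℝ (Fin d)}
    (hX : IsSampling M pol θ X 𝓕 P) (t : ℕ) {wbar w : Ω → EuclideanSpace ℝ (Fin m)}
    (hwbar : StronglyMeasurable[𝓕 (t + 1)] wbar) (hw : StronglyMeasurable[𝓕 (t + 1)] w) :
    StronglyMeasurable[𝓕 (t + 1)] (fun x => tdError M Φ X t (wbar x) (w x) x) := by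
  have hfeat : StronglyMeasurable[𝓕 (t + 1)] (fun x => feat Φ (X.next t x)) :=
    stronglyMeasurable_finite_index (f := fun s _ => feat Φ s)
      (fun _ => stronglyMeasurable_const) (hX.meas_next t)
  exact ((hX.meas_rew t).stronglyMeasurable.add ((hfeat.inner hwbar).const_mul M.γ)).sub
    ((hX.stronglyMeasurable_feat_state t).inner hw)

lemma stronglyMeasurable_iterates {z₀ : Params d m} (hZ : IsIterate M pol Φ αs ξs βs X z₀ Z)
    (hX : IsSampling M pol (fun t x => (Z t x).theta) X 𝓕 P) (hpol : PolicyRegular pol) (t : ℕ) :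
    StronglyMeasurable[𝓕 t] (fun x => (Z t x).theta) ∧
    StronglyMeasurable[𝓕 t] (fun x => (Z t x).omega) ∧
    StronglyMeasurable[𝓕 t] (fun x => (Z t x).omegaBar) := by
  induction t with
  | zero =>
    simp only [hZ.zero]
    exact ⟨stronglyMeasurable_const, stronglyMeasurable_const, stronglyMeasurable_const⟩
  | succ t ih =>
    obtain ⟨h1, h2, h3⟩ := ih
    have hle : (𝓕 t : MeasurableSpace Ω) ≤ 𝓕 (t + 1) := 𝓕.mono (Nat.le_succ t)
    replace h1 := h1.mono hle
    replace h2 := h2.mono hle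
    replace h3 := h3.mono hle
    have hst : Measurable[𝓕 (t + 1)] (X.stateT t) := (hX.meas_state t).mono hle le_rfl
    have hfeat := hX.stronglyMeasurable_feat_state (Φ := Φ) t
    have htd : ∀ w : Ω → EuclideanSpace ℝ (Fin m), StronglyMeasurable[𝓕 (t + 1)] w →
        StronglyMeasurable[𝓕 (t + 1)] (fun x => tdError M Φ X t (w x) (Z t x).omega x) :=
      fun w hw => hX.stronglyMeasurable_tdError t hw h2
    -- The score is continuous in θ, being Lipschitz, and state and action take finitely many
    -- values.
    have hscore : StronglyMeasurable[𝓕 (t + 1)]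
        (fun x => score pol (Z t x).theta (X.stateT t x) (X.act t x)) := by
      obtain ⟨L, hL⟩ := hpol.score_lipschitz
      exact stronglyMeasurable_finite_index
        (f := fun s x => score pol (Z t x).theta s (X.act t x))
        (fun s => stronglyMeasurable_finite_index
          (f := fun a x => score pol (Z t x).theta s a)
          (fun a => (hL s a).continuous.comp_stronglyMeasurable h1) (hX.meas_act t)) hst
    have homega : StronglyMeasurable[𝓕 (t + 1)] (fun x => (Z (t + 1) x).omega) := by
      simp only [hZ.omega_succ]
      exact h2.add (((htd _ h3).const_mul _).smul hfeat)
    refine ⟨?_, homega, ?_⟩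
    · simp only [hZ.theta_succ]
      exact h1.add (((htd _ h2).const_mul _).smul hscore)
    · simp only [hZ.omegaBar_succ]
      exact h3.add ((homega.sub h3).fun_const_smul (ξs t))

/-- The target relaxes towards the critic, so the deterministic bound of the critic passes to it. -/
lemma exists_omegaBar_bound {z₀ : Params d m} (hZ : IsIterate M pol Φ αs ξs βs X z₀ Z)
    (hs : StepSizes αs ξs βs) (hstab : ∃ B : ℝ, ∀ᵐ x ∂P, ∀ t, ‖(Z t x).omega‖ ≤ B) :
    ∃ B : ℝ, ∀ᵐ x ∂P, ∀ t, ‖(Z t x).omegaBar‖ ≤ B := by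
  obtain ⟨B, hB⟩ := hstab
  obtain ⟨C, hC⟩ := exists_bound_of_relaxation hs.target_pos hs.target_tendsto B ‖z₀.omegaBar‖
  refine ⟨C, ?_⟩
  filter_upwards [hB] with x hx
  refine hC (fun t => ‖(Z t x).omegaBar‖) (by simp only [hZ.zero]) fun t => ?_
  have e : (Z (t + 1) x).omegaBar
      = (1 - ξs t) • (Z t x).omegaBar + ξs t • (Z (t + 1) x).omega := by
    rw [hZ.omegaBar_succ]
    module
  rw [e]
  refine (norm_add_le _ _).trans ?_
  rw [norm_smul, norm_smul, Real.norm_eq_abs, Real.norm_of_nonneg (hs.target_pos t).le]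
  exact add_le_add le_rfl (mul_le_mul_of_nonneg_left (hx (t + 1)) (hs.target_pos t).le)

lemma norm_feat_le (Φ : Matrix S (Fin m) ℝ) (s : S) : ‖feat Φ s‖ ≤ ∑ s, ‖feat Φ s‖ :=
  Finset.single_le_sum (f := fun s => ‖feat Φ s‖) (fun _ _ => norm_nonneg _) (Finset.mem_univ s)

lemma exists_tdError_bound {w wbar : ℕ → Ω → EuclideanSpace ℝ (Fin m)}
    {θ : ℕ → Ω → EuclideanSpace ℝ (Fin d)} (hX : IsSampling M pol θ X 𝓕 P)
    (hw : ∃ B : ℝ, ∀ᵐ x ∂P, ∀ t, ‖w t x‖ ≤ B) (hwbar : ∃ B : ℝ, ∀ᵐ x ∂P, ∀ t, ‖wbar t x‖ ≤ B) :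
    ∃ D : ℝ, 0 ≤ D ∧ ∀ᵐ x ∂P, ∀ t, |tdError M Φ X t (wbar t x) (w t x) x| ≤ D := by
  obtain ⟨B, hB⟩ := hw
  obtain ⟨B', hB'⟩ := hwbar
  set F := ∑ s, ‖feat Φ s‖ with hF
  have hF0 : 0 ≤ F := Finset.sum_nonneg fun s _ => norm_nonneg _
  refine ⟨M.UR + M.γ * (F * |B'|) + F * |B|, ?_, ?_⟩
  · have := M.UR_pos
    have := M.γ_pos
    positivity
  filter_upwards [ae_all_iff.2 hX.rew_bound, hB, hB'] with x hr h h' t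
  have i1 : |inner ℝ (feat Φ (X.next t x)) (wbar t x)| ≤ F * |B'| :=
    (abs_real_inner_le_norm _ _).trans (mul_le_mul (norm_feat_le Φ _)
      ((h' t).trans (le_abs_self _)) (norm_nonneg _) hF0)
  have i2 : |inner ℝ (feat Φ (X.stateT t x)) (w t x)| ≤ F * |B| :=
    (abs_real_inner_le_norm _ _).trans (mul_le_mul (norm_feat_le Φ _)
      ((h t).trans (le_abs_self _)) (norm_nonneg _) hF0)
  rw [tdError]
  refine (abs_sub _ _).trans (add_le_add ((abs_add_le _ _).trans (add_le_add (hr t) ?_)) i2)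
  rw [abs_mul, abs_of_pos M.γ_pos]
  exact mul_le_mul_of_nonneg_left i1 M.γ_pos.le

/-- Along the algorithm the actor, critic and target move at the speed of their stepsizes. -/
lemma slow_iterates {z₀ : Params d m} (hZ : IsIterate M pol Φ αs ξs βs X z₀ Z)
    (hX : IsSampling M pol (fun t x => (Z t x).theta) X 𝓕 P) (hpol : PolicyRegular pol)
    (hs : StepSizes αs ξs βs) (hstab : ∃ B : ℝ, ∀ᵐ x ∂P, ∀ t, ‖(Z t x).omega‖ ≤ B) :
    SlowParam P 𝓕 αs (fun t x => (Z t x).theta) ∧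
    SlowAdapted P 𝓕 βs (fun t x => (Z t x).omega) ∧
    SlowAdapted P 𝓕 ξs (fun t x => (Z t x).omegaBar) := by
  have hmeas := stronglyMeasurable_iterates hZ hX hpol
  have hbar := exists_omegaBar_bound hZ hs hstab
  set F := ∑ s, ‖feat Φ s‖ with hF
  have hF0 : 0 ≤ F := Finset.sum_nonneg fun s _ => norm_nonneg _
  refine ⟨⟨fun t => (hmeas t).1, ?_⟩, ⟨fun t => (hmeas t).2.1, hstab, ?_⟩,
    ⟨fun t => (hmeas t).2.2, hbar, ?_⟩⟩
  · obtain ⟨D, hD0, hD⟩ := exists_tdError_bound (Φ := Φ) hX hstab hstab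
    obtain ⟨C, hC⟩ := hpol.score_bounded
    refine ⟨1 / (1 - M.γ) * D * C, ?_⟩
    filter_upwards [hD] with x hx t
    have hγ : 0 < 1 / (1 - M.γ) := one_div_pos.2 (sub_pos.2 M.γ_lt_one)
    rw [hZ.theta_succ, add_sub_cancel_left, norm_smul, norm_mul, norm_mul,
      Real.norm_of_nonneg (hs.actor_pos t).le, Real.norm_of_nonneg hγ.le, Real.norm_eq_abs]
    have := mul_le_mul (hx t) (hC (Z t x).theta (X.stateT t x) (X.act t x)) (norm_nonneg _) hD0
    have h2 := mul_le_mul_of_nonneg_left this (mul_nonneg (hs.actor_pos t).le hγ.le)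
    linarith
  · obtain ⟨D, hD0, hD⟩ := exists_tdError_bound (Φ := Φ) hX hstab hbar
    refine ⟨D * F, ?_⟩
    filter_upwards [hD] with x hx t
    rw [hZ.omega_succ, add_sub_cancel_left, norm_smul, norm_mul,
      Real.norm_of_nonneg (hs.critic_pos t).le, Real.norm_eq_abs]
    have := mul_le_mul (hx t) (norm_feat_le Φ (X.stateT t x)) (norm_nonneg _) hD0
    have h2 := mul_le_mul_of_nonneg_left this (hs.critic_pos t).le
    linarith
  · obtain ⟨B, hB⟩ := hstab
    obtain ⟨B', hB'⟩ := hbar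
    refine ⟨B + B', ?_⟩
    filter_upwards [hB, hB'] with x h h' t
    rw [hZ.omegaBar_succ, add_sub_cancel_left, norm_smul, Real.norm_of_nonneg (hs.target_pos t).le,
      mul_comm]
    exact mul_le_mul_of_nonneg_right (norm_sub_le_of_le (h (t + 1)) (h' t)) (hs.target_pos t).le

end Iterates

/-! ### Pathwise inequalities for one step -/

lemma inner_feat (Φ : Matrix S (Fin m) ℝ) (s : S) (w : EuclideanSpace ℝ (Fin m)) :
    inner ℝ (feat Φ s) w = Φ.mulVec w.ofLp s := by
  simp [feat, EuclideanSpace.inner_eq_star_dotProduct, Matrix.mulVec, dotProduct_comm]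

lemma SlowAdapted.essBdd_norm_sq {Ω E : Type*} {mΩ : MeasurableSpace Ω} [NormedAddCommGroup E]
    {P : Measure Ω} {𝓕 : Filtration ℕ mΩ} {r : ℕ → ℝ} {u : ℕ → Ω → E}
    (hu : SlowAdapted P 𝓕 r u) (t : ℕ) : EssBdd P (𝓕 t) (fun x => ‖u t x‖ ^ 2) := by
  obtain ⟨C, hC⟩ := hu.bdd
  refine ⟨(hu.meas t).norm.pow 2, C ^ 2, ?_⟩
  filter_upwards [hC] with x hx
  rw [norm_pow, norm_norm]
  exact pow_le_pow_left₀ (norm_nonneg _) (hx t) 2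

lemma SlowAdapted.exists_integral_norm_sq_le {Ω E : Type*} {mΩ : MeasurableSpace Ω}
    [NormedAddCommGroup E] {P : Measure Ω} [IsProbabilityMeasure P] {𝓕 : Filtration ℕ mΩ}
    {r : ℕ → ℝ} {u : ℕ → Ω → E} (hu : SlowAdapted P 𝓕 r u) :
    ∃ B : ℝ, ∀ t, ∫ x, ‖u t x‖ ^ 2 ∂P ≤ B := by
  obtain ⟨C, hC⟩ := hu.bdd
  refine ⟨C ^ 2, fun t => ?_⟩
  calc ∫ x, ‖u t x‖ ^ 2 ∂P ≤ ∫ _, C ^ 2 ∂P := by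
        refine integral_mono_ae ((hu.essBdd_norm_sq t).integrable (𝓕.le t))
          (integrable_const _) ?_
        filter_upwards [hC] with x hx
        exact pow_le_pow_left₀ (norm_nonneg _) (hx t) 2
    _ = C ^ 2 := by simp

/-- For the critic: `v` is the stochastic increment, `e` the displacement of the equilibrium.
Young's inequality with weight κb spends half of the contraction 2κb supplied by the mean drift; the
price ε²/(κb) becomes (ξ/β)² once ε is of order ξ and the recursion is divided by b. -/
lemma norm_sq_add_add_le {E : Type*} [NormedAddCommGroup E] [InnerProductSpace ℝ E] (x v e : E)
    {b κ K ε : ℝ} (hb : 0 < b) (hκ : 0 < κ) (hv : ‖v‖ ≤ K) (he : ‖e‖ ≤ ε) :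
    ‖x + v + e‖ ^ 2 ≤ ‖x‖ ^ 2 + 2 * inner ℝ x v + κ * b * ‖x‖ ^ 2 + ε ^ 2 / (κ * b)
      + 2 * K ^ 2 + 2 * ε ^ 2 := by
  have hε : 0 ≤ ε := (norm_nonneg e).trans he
  have hκb : 0 < κ * b := mul_pos hκ hb
  have h1 : ‖x + v + e‖ ^ 2 = ‖x‖ ^ 2 + 2 * inner ℝ x v + 2 * inner ℝ x e + ‖v + e‖ ^ 2 := by
    rw [add_assoc, norm_add_sq_real, inner_add_right]
    ring
  have h2 : ‖v + e‖ ^ 2 ≤ 2 * K ^ 2 + 2 * ε ^ 2 := by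
    have := pow_le_pow_left₀ (norm_nonneg _) (norm_add_le_of_le hv he) 2
    nlinarith [sq_nonneg (K - ε)]
  have h3 : 2 * inner ℝ x e ≤ κ * b * ‖x‖ ^ 2 + ε ^ 2 / (κ * b) := by
    have i1 : inner ℝ x e ≤ ‖x‖ * ε :=
      (real_inner_le_norm x e).trans (mul_le_mul_of_nonneg_left he (norm_nonneg x))
    have i2 : 2 * (‖x‖ * ε) ≤ κ * b * ‖x‖ ^ 2 + ε ^ 2 / (κ * b) := by
      have : κ * b * ‖x‖ ^ 2 + ε ^ 2 / (κ * b) - 2 * (‖x‖ * ε)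
          = (κ * b * ‖x‖ - ε) ^ 2 / (κ * b) := by
        field_simp
        ring
      have h0 : 0 ≤ (κ * b * ‖x‖ - ε) ^ 2 / (κ * b) := by positivity
      linarith
    linarith
  linarith

/-- For the target, with `b` the critic stepsize and `q` the ratio of actor to target stepsize.
Coercivity gives -2ζc‖y‖²; the cross terms with `x` and `e` each take back ζc‖y‖²/2, and the
quadratic term is bounded by the step length Lc. -/
lemma norm_sq_target_step_le {E : Type*} [NormedAddCommGroup E] [InnerProductSpace ℝ E]
    {y y' g x e : E} {ζ c K L b q : ℝ} (hζ : 0 < ζ) (hc : 0 < c)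
    (hy' : y' = y - c • g + c • x + e) (hg : ζ * ‖y‖ ^ 2 ≤ inner ℝ y g)
    (he : ‖e‖ ≤ c * (K * (b + q))) (hL : ‖y' - y‖ ≤ L * c) :
    ζ * c * ‖y‖ ^ 2 ≤ ‖y‖ ^ 2 - ‖y'‖ ^ 2
      + c * (2 / ζ * ‖x‖ ^ 2 + 4 * K ^ 2 / ζ * (b ^ 2 + q ^ 2) + L ^ 2 * c) := by
  have h1 : ‖y'‖ ^ 2 = ‖y‖ ^ 2 + 2 * inner ℝ y (y' - y) + ‖y' - y‖ ^ 2 := by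
    rw [← norm_add_sq_real, add_sub_cancel]
  have h2 : inner ℝ y (y' - y) = - c * inner ℝ y g + c * inner ℝ y x + inner ℝ y e := by
    have : y' - y = (-c) • g + c • x + e := by rw [hy']; module
    rw [this, inner_add_right, inner_add_right, inner_smul_right, inner_smul_right]
  have young : ∀ s u : ℝ, 2 * (s * u) ≤ ζ / 2 * s ^ 2 + 2 / ζ * u ^ 2 := by
    intro s u
    have : ζ / 2 * s ^ 2 + 2 / ζ * u ^ 2 - 2 * (s * u) = (ζ * s - 2 * u) ^ 2 / (2 * ζ) := by
      field_simp
      ring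
    have h0 : 0 ≤ (ζ * s - 2 * u) ^ 2 / (2 * ζ) := by positivity
    linarith
  have h3 : 2 * inner ℝ y x ≤ ζ / 2 * ‖y‖ ^ 2 + 2 / ζ * ‖x‖ ^ 2 := by
    have := real_inner_le_norm y x
    have := young ‖y‖ ‖x‖
    linarith
  have h4 : 2 * inner ℝ y e ≤ c * (ζ / 2 * ‖y‖ ^ 2 + 2 / ζ * (K * (b + q)) ^ 2) := by
    have i1 := real_inner_le_norm y e
    have i2 := mul_le_mul_of_nonneg_left he (norm_nonneg y)
    have i3 := mul_le_mul_of_nonneg_left (young ‖y‖ (K * (b + q))) hc.le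
    linarith
  have h5 : 2 / ζ * (K * (b + q)) ^ 2 ≤ 4 * K ^ 2 / ζ * (b ^ 2 + q ^ 2) := by
    have : 4 * K ^ 2 / ζ * (b ^ 2 + q ^ 2) - 2 / ζ * (K * (b + q)) ^ 2
        = 2 / ζ * K ^ 2 * (b - q) ^ 2 := by
      field_simp
      ring
    have h0 : 0 ≤ 2 / ζ * K ^ 2 * (b - q) ^ 2 := by positivity
    linarith
  have h6 : ‖y' - y‖ ^ 2 ≤ L ^ 2 * c * c := by
    have := pow_le_pow_left₀ (norm_nonneg _) hL 2
    nlinarith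
  have h7 := mul_le_mul_of_nonneg_left hg hc.le
  have h8 := mul_le_mul_of_nonneg_left h5 hc.le
  have h9 := mul_le_mul_of_nonneg_left h3 hc.le
  rw [h1, h2]
  linarith

/-! ### Markovian noise and the mean temporal difference -/

section Expectation

variable {Ω : Type*} [mΩ : MeasurableSpace Ω] [MeasurableSpace S] [MeasurableSingletonClass S]
  [MeasurableSpace A] [MeasurableSingletonClass A] {P : Measure Ω} [IsProbabilityMeasure P]
  {M : MDP S A} {pol : PolicyFamily S A d} {Φ : Matrix S (Fin m) ℝ} {αs ξs βs r : ℕ → ℝ}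
  {X : Samples S A Ω} {𝓕 : Filtration ℕ mΩ} {θ : ℕ → Ω → EuclideanSpace ℝ (Fin d)}

/-- The Markovian noise is a telescoping term plus a remainder of the order of the stepsize. -/
lemma IsSampling.exists_poisson_decomposition (hX : IsSampling M pol θ X 𝓕 P)
    (hpol : PolicyRegular pol) (hθ : SlowParam P 𝓕 r θ) {f : S → ℕ → Ω → ℝ}
    (hf : ∀ s, SlowAdapted P 𝓕 r (f s)) :
    ∃ v : ℕ → ℝ, (∃ B, ∀ t, |v t| ≤ B) ∧ ∃ C : ℝ, ∀ t,
      ∫ x, f (X.stateT t x) t x ∂P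
        ≤ ∫ x, ∑ s, occ M pol (θ t x) s * f s t x ∂P + (v t - v (t + 1)) + C * r t := by
  set V : S → ℕ → Ω → ℝ := fun s t x => (resolvent M pol (θ t x)).mulVec (fun s' => f s' t x) s
    with hV
  have hVs : ∀ s, SlowAdapted P 𝓕 r (V s) := fun s =>
    SlowAdapted.mulVec (v := fun t x s' => f s' t x) (hθ.resolvent hpol) hf s
  have hVb : ∀ t, EssBdd P (𝓕 t) (fun x => V (X.stateT t x) t x) := fun t =>
    EssBdd.finite_index (fun s => (hVs s).essBdd t) (hX.meas_state t)
  have hfb : ∀ t, EssBdd P (𝓕 t) (fun x => f (X.stateT t x) t x) := fun t =>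
    EssBdd.finite_index (fun s => (hf s).essBdd t) (hX.meas_state t)
  have hof : ∀ t, EssBdd P (𝓕 t) (fun x => ∑ s, occ M pol (θ t x) s * f s t x) := fun t =>
    EssBdd.sum _ fun s _ => ((hθ.occ hpol s).mul (hf s)).essBdd t
  have hPV : ∀ t, EssBdd P (𝓕 t)
      (fun x => ∑ s', PmatTilde M pol (θ t x) (X.stateT t x) s' * V s' t x) := fun t => by
    simp only [PmatTilde_apply]
    exact EssBdd.sum _ fun s' _ => (((EssBdd.const M.γ).mul
      (hX.essBdd_Pmat hpol hθ t s')).add (EssBdd.const _)).mul ((hVs s').essBdd t)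
  have hVn : ∀ t, EssBdd P mΩ (fun x => V (X.stateT (t + 1) x) t x) := fun t =>
    EssBdd.finite_index (fun s => ((hVs s).essBdd t).mono (𝓕.le t))
      ((hX.meas_state (t + 1)).mono (𝓕.le _) le_rfl)
  choose B hB using fun s => (hVs s).bdd
  choose C hC using fun s => (hVs s).incr
  refine ⟨fun t => ∫ x, V (X.stateT t x) t x ∂P, ⟨∑ s, |B s|, fun t => ?_⟩, ∑ s, C s, fun t => ?_⟩
  · rw [← Real.norm_eq_abs]
    have := norm_integral_le_of_norm_le_const (μ := P) (f := fun x => V (X.stateT t x) t x)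
      (C := ∑ s, |B s|) ?_
    · simpa using this
    · filter_upwards [ae_all_iff.2 hB] with x hx
      exact (hx _ t).trans ((le_abs_self _).trans (Finset.single_le_sum (f := fun s => |B s|)
        (fun _ _ => abs_nonneg _) (Finset.mem_univ (X.stateT t x))))
  -- Given the past, the mean of V_t at the next state is P̃V_t, so the Poisson equation at time `t`
  -- is exact in expectation.
  · have e1 : ∫ x, f (X.stateT t x) t x ∂P - ∫ x, ∑ s, occ M pol (θ t x) s * f s t x ∂P
        = ∫ x, V (X.stateT t x) t x ∂P - ∫ x, V (X.stateT (t + 1) x) t x ∂P := by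
      rw [hX.integral_state_succ hpol hθ t (f := fun s x => V s t x) fun s => (hVs s).essBdd t,
        ← integral_sub ((hfb t).integrable (𝓕.le t)) ((hof t).integrable (𝓕.le t)),
        ← integral_sub ((hVb t).integrable (𝓕.le t)) ((hPV t).integrable (𝓕.le t))]
      exact integral_congr_ae (ae_of_all _ fun x =>
        (poisson_equation M pol (θ t x) (fun s => f s t x) (X.stateT t x)).symm)
    -- Telescoping needs V_{t+1} at the new state in place of V_t; the swap costs one increment of a
    -- slow process.
    have e2 : ∫ x, V (X.stateT (t + 1) x) (t + 1) x ∂P - ∫ x, V (X.stateT (t + 1) x) t x ∂P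
        ≤ (∑ s, C s) * r t := by
      rw [← integral_sub ((hVb (t + 1)).integrable (𝓕.le _)) ((hVn t).integrable le_rfl)]
      have := norm_integral_le_of_norm_le_const (μ := P)
        (f := fun x => V (X.stateT (t + 1) x) (t + 1) x - V (X.stateT (t + 1) x) t x)
        (C := (∑ s, C s) * r t) ?_
      · exact (le_abs_self _).trans (by simpa using this)
      · filter_upwards [ae_all_iff.2 hC] with x hx
        rw [Finset.sum_mul]
        exact (hx _ t).trans (Finset.single_le_sum (f := fun s => C s * r t)
          (fun s _ => (norm_nonneg _).trans (hx s t)) (Finset.mem_univ (X.stateT (t + 1) x)))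
    linarith

/-- The weight and both parameters are known at time `t`, so only the reward and the next state are
averaged. -/
lemma IsSampling.integral_tdError_mul (hX : IsSampling M pol θ X 𝓕 P)
    (hpol : PolicyRegular pol) (hθ : SlowParam P 𝓕 r θ)
    {w wbar y : ℕ → Ω → EuclideanSpace ℝ (Fin m)}
    (hw : SlowAdapted P 𝓕 r w) (hwbar : SlowAdapted P 𝓕 r wbar) (hy : SlowAdapted P 𝓕 r y)
    (t : ℕ) :
    ∫ x, Φ.mulVec (y t x).ofLp (X.stateT t x) * tdError M Φ X t (wbar t x) (w t x) x ∂P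
      = ∫ x, criticDrift M pol Φ (θ t x) (w t x) (wbar t x) (y t x) (X.stateT t x) ∂P := by
  set Y : Ω → ℝ := fun x => Φ.mulVec (y t x).ofLp (X.stateT t x) with hY
  have hYb : EssBdd P (𝓕 t) Y :=
    EssBdd.finite_index (fun s => (hy.feature_mulVec s).essBdd t) (hX.meas_state t)
  have hwb : EssBdd P (𝓕 t) (fun x => Φ.mulVec (w t x).ofLp (X.stateT t x)) :=
    EssBdd.finite_index (fun s => (hw.feature_mulVec s).essBdd t) (hX.meas_state t)
  have hR : EssBdd P (𝓕 t) (fun x => Rvec M pol (θ t x) (X.stateT t x)) :=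
    EssBdd.finite_index (fun s => (hθ.Rvec hpol s).essBdd t) (hX.meas_state t)
  have hf : ∀ s, EssBdd P (𝓕 t) (fun x => Y x * Φ.mulVec (wbar t x).ofLp s) := fun s =>
    hYb.mul ((hwbar.feature_mulVec s).essBdd t)
  have hnext : Measurable (X.next t) := (hX.meas_next t).mono (𝓕.le _) le_rfl
  have hfn : Integrable (fun x => Y x * Φ.mulVec (wbar t x).ofLp (X.next t x)) P :=
    (EssBdd.finite_index (P := P) (m' := mΩ) (fun s => (hf s).mono (𝓕.le t)) hnext).integrable
      le_rfl
  have hPf : EssBdd P (𝓕 t) (fun x => ∑ s', Pmat M pol (θ t x) (X.stateT t x) s'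
      * (Y x * Φ.mulVec (wbar t x).ofLp s')) :=
    EssBdd.sum _ fun s' _ => (hX.essBdd_Pmat hpol hθ t s').mul (hf s')
  have hrew : Integrable (fun x => Y x * X.rew t x) P := by
    refine EssBdd.integrable (m' := mΩ) ((hYb.mono (𝓕.le t)).mul
      ⟨((hX.meas_rew t).mono (𝓕.le _) le_rfl).stronglyMeasurable, M.UR, hX.rew_bound t⟩) le_rfl
  have e1 : ∀ x, Y x * tdError M Φ X t (wbar t x) (w t x) x
      = Y x * X.rew t x + M.γ * (Y x * Φ.mulVec (wbar t x).ofLp (X.next t x))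
        - Y x * Φ.mulVec (w t x).ofLp (X.stateT t x) := fun x => by
    rw [tdError, inner_feat, inner_feat]
    ring
  have e2 : ∀ x, criticDrift M pol Φ (θ t x) (w t x) (wbar t x) (y t x) (X.stateT t x)
      = Y x * Rvec M pol (θ t x) (X.stateT t x)
        + M.γ * (∑ s', Pmat M pol (θ t x) (X.stateT t x) s' * (Y x * Φ.mulVec (wbar t x).ofLp s'))
        - Y x * Φ.mulVec (w t x).ofLp (X.stateT t x) := fun x => by
    have : ∑ s', Pmat M pol (θ t x) (X.stateT t x) s' * (Y x * Φ.mulVec (wbar t x).ofLp s')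
        = Y x * (Pmat M pol (θ t x)).mulVec (Φ.mulVec (wbar t x).ofLp) (X.stateT t x) := by
      conv_rhs => rw [Matrix.mulVec, dotProduct, Finset.mul_sum]
      exact Finset.sum_congr rfl fun s' _ => by ring
    rw [this, criticDrift, hY]
    ring
  have hA : Integrable (fun x => Y x * X.rew t x
      + M.γ * (Y x * Φ.mulVec (wbar t x).ofLp (X.next t x))) P := hrew.add (hfn.const_mul _)
  have hYR := (hYb.mul hR).integrable (𝓕.le t)
  have hPfi := hPf.integrable (𝓕.le t)
  have hB : Integrable (fun x => Y x * Rvec M pol (θ t x) (X.stateT t x)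
      + M.γ * (∑ s', Pmat M pol (θ t x) (X.stateT t x) s' * (Y x * Φ.mulVec (wbar t x).ofLp s'))) P :=
    hYR.add (hPfi.const_mul _)
  have hYw := (hYb.mul hwb).integrable (𝓕.le t)
  refine (integral_congr_ae (ae_of_all _ e1)).trans
    (Eq.trans ?_ (integral_congr_ae (ae_of_all _ e2)).symm)
  rw [integral_sub hA hYw, integral_sub hB hYw, integral_add hrew (hfn.const_mul _),
    integral_add hYR (hPfi.const_mul _), integral_const_mul, integral_const_mul,
    hX.integral_rew t hYb (hX.essBdd_prob hpol hθ t),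
    hX.integral_next hpol hθ t (f := fun s x => Y x * Φ.mulVec (wbar t x).ofLp s) hf]

end Expectation

lemma SlowParam.mono_rate {Ω E : Type*} {mΩ : MeasurableSpace Ω} [NormedAddCommGroup E]
    {P : Measure Ω} {𝓕 : Filtration ℕ mΩ} {r r' : ℕ → ℝ} {θ : ℕ → Ω → E}
    (hθ : SlowParam P 𝓕 r θ) (hr : ∀ t, 0 ≤ r t) {c : ℝ} (h : ∀ t, r t ≤ c * r' t) :
    SlowParam P 𝓕 r' θ := by
  obtain ⟨C, hC⟩ := hθ.incr
  refine ⟨hθ.meas, |C| * c, ?_⟩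
  filter_upwards [hC] with x hx t
  calc _ ≤ C * r t := hx t
    _ ≤ |C| * r t := mul_le_mul_of_nonneg_right (le_abs_self C) (hr t)
    _ ≤ |C| * (c * r' t) := mul_le_mul_of_nonneg_left (h t) (abs_nonneg C)
    _ = _ := by ring

/-- The distance of the critic to its equilibrium for frozen actor and target. -/
def criticError {Ω : Type*} (M : MDP S A) (pol : PolicyFamily S A d) (Φ : Matrix S (Fin m) ℝ)
    (Z : ℕ → Ω → Params d m) (t : ℕ) (x : Ω) : EuclideanSpace ℝ (Fin m) :=
  (Z t x).omega - omegaStar M pol Φ (Z t x).theta (Z t x).omegaBar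

/-- The distance of the target variable to its equilibrium for a frozen actor. -/
def targetError {Ω : Type*} (M : MDP S A) (pol : PolicyFamily S A d) (Φ : Matrix S (Fin m) ℝ)
    (Z : ℕ → Ω → Params d m) (t : ℕ) (x : Ω) : EuclideanSpace ℝ (Fin m) :=
  (Z t x).omegaBar - omegaBarStar M pol Φ (Z t x).theta

/-! ### Recursions for the mean square errors -/

section Recursions

variable {Ω : Type*} [mΩ : MeasurableSpace Ω] [MeasurableSpace S] [MeasurableSingletonClass S]
  [MeasurableSpace A] [MeasurableSingletonClass A] {P : Measure Ω} [IsProbabilityMeasure P]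
  {M : MDP S A} {pol : PolicyFamily S A d} {Φ : Matrix S (Fin m) ℝ} {αs ξs βs : ℕ → ℝ}
  {X : Samples S A Ω} {𝓕 : Filtration ℕ mΩ} {Z : ℕ → Ω → Params d m} {z₀ : Params d m}

/-- The equilibrium moves at the target's rate ξ, not at the critic's; this sharper rate is what
makes ξ/β appear in the critic recursion. -/
lemma slow_omegaStar_iterates (hθ : SlowParam P 𝓕 αs (fun t x => (Z t x).theta))
    (hbar : SlowAdapted P 𝓕 ξs (fun t x => (Z t x).omegaBar)) (hpol : PolicyRegular pol)
    (herg : ErgodicClosure M pol) (hΦ : Φ.rank = m) (hs : StepSizes αs ξs βs) :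
    SlowAdapted P 𝓕 ξs
      (fun t x => omegaStar M pol Φ (Z t x).theta (Z t x).omegaBar) := by
  obtain ⟨c, hc⟩ := hs.actor_le
  exact (hθ.mono_rate (fun t => (hs.actor_pos t).le) hc).omegaStar hpol herg hΦ hbar

lemma slow_criticError (hθ : SlowParam P 𝓕 αs (fun t x => (Z t x).theta))
    (hw : SlowAdapted P 𝓕 βs (fun t x => (Z t x).omega))
    (hbar : SlowAdapted P 𝓕 ξs (fun t x => (Z t x).omegaBar)) (hpol : PolicyRegular pol)
    (herg : ErgodicClosure M pol) (hΦ : Φ.rank = m) (hs : StepSizes αs ξs βs) :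
    SlowAdapted P 𝓕 βs (criticError M pol Φ Z) := by
  obtain ⟨c, hc⟩ := hs.target_le
  exact hw.sub ((slow_omegaStar_iterates hθ hbar hpol herg hΦ hs).mono_rate
    (fun t => (hs.target_pos t).le) hc)

lemma slow_targetError (hθ : SlowParam P 𝓕 αs (fun t x => (Z t x).theta))
    (hbar : SlowAdapted P 𝓕 ξs (fun t x => (Z t x).omegaBar)) (hpol : PolicyRegular pol)
    (herg : ErgodicClosure M pol) (hΦ : Φ.rank = m) (hpd : UnifPosDef M pol Φ)
    (hs : StepSizes αs ξs βs) :
    SlowAdapted P 𝓕 ξs (targetError M pol Φ Z) := by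
  obtain ⟨c, hc⟩ := hs.actor_le
  exact hbar.sub ((hθ.mono_rate (fun t => (hs.actor_pos t).le) hc).omegaBarStar hpol herg hΦ hpd)

/-- The mean drift contributes -2κβ_t, of which Young's inequality takes back κβ_t. Dividing by β_t
leaves the noise terms v_t with constant weight, so they still telescope. -/
lemma exists_critic_recursion (hZ : IsIterate M pol Φ αs ξs βs X z₀ Z)
    (hX : IsSampling M pol (fun t x => (Z t x).theta) X 𝓕 P) (hpol : PolicyRegular pol)
    (herg : ErgodicClosure M pol) (hΦ : Φ.rank = m)
    (hs : StepSizes αs ξs βs) (hstab : ∃ B : ℝ, ∀ᵐ x ∂P, ∀ t, ‖(Z t x).omega‖ ≤ B) :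
    ∃ κ > 0, ∃ C : ℝ, ∃ v : ℕ → ℝ, (∃ B, ∀ t, |v t| ≤ B) ∧ ∀ t,
      κ * ∫ x, ‖criticError M pol Φ Z t x‖ ^ 2 ∂P
        ≤ (∫ x, ‖criticError M pol Φ Z t x‖ ^ 2 ∂P
            - ∫ x, ‖criticError M pol Φ Z (t + 1) x‖ ^ 2 ∂P) / βs t
          + 2 * (v t - v (t + 1)) + C * (βs t + (ξs t / βs t) ^ 2) := by
  obtain ⟨hθ, hw, hbar⟩ := slow_iterates hZ hX hpol hs hstab
  have herr := slow_criticError hθ hw hbar hpol herg hΦ hs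
  have hbarstab := exists_omegaBar_bound hZ hs hstab
  obtain ⟨c₁, hc₁⟩ := hs.actor_le
  obtain ⟨c₂, hc₂⟩ := hs.target_le
  have hθβ : SlowParam P 𝓕 βs (fun t x => (Z t x).theta) :=
    (hθ.mono_rate (fun t => (hs.actor_pos t).le) hc₁).mono_rate (fun t => (hs.target_pos t).le) hc₂
  have hbarβ := hbar.mono_rate (fun t => (hs.target_pos t).le) hc₂
  obtain ⟨L, hL⟩ := (slow_omegaStar_iterates hθ hbar hpol herg hΦ hs).incr
  obtain ⟨D, hD0, hD⟩ := exists_tdError_bound (Φ := Φ) hX hstab hbarstab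
  obtain ⟨κ, hκ, hcoer⟩ := exists_Gbar_coercive M pol Φ herg hΦ
  obtain ⟨v, hv, C, hvC⟩ := hX.exists_poisson_decomposition hpol hθβ
    (fun s => hθβ.criticDrift (Φ := Φ) (M := M) hpol hw hbarβ herr s)
  set F := ∑ s, ‖feat Φ s‖ with hF
  have hF0 : 0 ≤ F := Finset.sum_nonneg fun s _ => norm_nonneg _
  -- The first summand collects the terms of order β_t: Poisson remainder and squared increment. The
  -- second collects those in (ξ_t/β_t)², with one spare factor β_t bounded by `βs 0`.
  refine ⟨κ, hκ, |2 * C + 2 * (D * F) ^ 2| + (L ^ 2 / κ + 2 * L ^ 2 * βs 0), v, hv, fun t => ?_⟩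
  have hβ := hs.critic_pos t
  have hξ := hs.target_pos t
  set E : ℕ → ℝ := fun t => ∫ x, ‖criticError M pol Φ Z t x‖ ^ 2 ∂P with hE
  have hEi : ∀ t, Integrable (fun x => ‖criticError M pol Φ Z t x‖ ^ 2) P := fun t =>
    (herr.essBdd_norm_sq t).integrable (𝓕.le t)
  set I : Ω → ℝ := fun x => Φ.mulVec (criticError M pol Φ Z t x).ofLp (X.stateT t x)
    * tdError M Φ X t (Z t x).omegaBar (Z t x).omega x with hI
  have hIi : Integrable I P := by
    refine EssBdd.integrable (m' := 𝓕 (t + 1)) (EssBdd.mul ?_ ⟨?_, D, ?_⟩) (𝓕.le _)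
    · exact (EssBdd.finite_index (fun s => (herr.feature_mulVec s).essBdd t)
        (hX.meas_state t)).mono (𝓕.mono (Nat.le_succ t))
    · exact hX.stronglyMeasurable_tdError t ((hbar.meas t).mono (𝓕.mono (Nat.le_succ t)))
        ((hw.meas t).mono (𝓕.mono (Nat.le_succ t)))
    · exact hD.mono fun x hx => hx t
  have hpath : ∀ᵐ x ∂P, ‖criticError M pol Φ Z (t + 1) x‖ ^ 2
      ≤ (1 + κ * βs t) * ‖criticError M pol Φ Z t x‖ ^ 2 + (2 * βs t) * I x
        + ((L * ξs t) ^ 2 / (κ * βs t) + 2 * (βs t * D * F) ^ 2 + 2 * (L * ξs t) ^ 2) := by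
    filter_upwards [hL, hD] with x hLx hDx
    have h := norm_sq_add_add_le (criticError M pol Φ Z t x)
      ((βs t * tdError M Φ X t (Z t x).omegaBar (Z t x).omega x) • feat Φ (X.stateT t x))
      (-(omegaStar M pol Φ (Z (t + 1) x).theta (Z (t + 1) x).omegaBar
        - omegaStar M pol Φ (Z t x).theta (Z t x).omegaBar))
      (K := βs t * D * F) hβ hκ ?_ ((norm_neg _).trans_le (hLx t))
    · rw [inner_smul_right, real_inner_comm, inner_feat] at h
      have e : criticError M pol Φ Z (t + 1) x = criticError M pol Φ Z t x
          + (βs t * tdError M Φ X t (Z t x).omegaBar (Z t x).omega x) • feat Φ (X.stateT t x)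
          + -(omegaStar M pol Φ (Z (t + 1) x).theta (Z (t + 1) x).omegaBar
            - omegaStar M pol Φ (Z t x).theta (Z t x).omegaBar) := by
        simp only [criticError]
        rw [hZ.omega_succ]
        abel
      rw [e]
      simp only [hI]
      linarith
    · rw [norm_smul, norm_mul, Real.norm_of_nonneg hβ.le, Real.norm_eq_abs]
      have := mul_le_mul_of_nonneg_left (hDx t) hβ.le
      exact mul_le_mul this (norm_feat_le Φ _) (norm_nonneg _) (mul_nonneg hβ.le hD0)
  have hint : E (t + 1) ≤ (1 + κ * βs t) * E t + (2 * βs t) * ∫ x, I x ∂P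
      + ((L * ξs t) ^ 2 / (κ * βs t) + 2 * (βs t * D * F) ^ 2 + 2 * (L * ξs t) ^ 2) := by
    have i1 := (hEi t).const_mul (1 + κ * βs t)
    have i2 := hIi.const_mul (2 * βs t)
    have i12 : Integrable (fun x => (1 + κ * βs t) * ‖criticError M pol Φ Z t x‖ ^ 2
      + (2 * βs t) * I x) P := i1.add i2
    refine (integral_mono_ae (hEi (t + 1)) (i12.add (integrable_const _)) hpath).trans_eq ?_
    refine (integral_add i12 (integrable_const _)).trans ?_
    rw [integral_add i1 i2, integral_const_mul,
      integral_const_mul]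
    simp [hE]
  -- Poisson decomposition replaces the sampled state by the occupancy average, where coercivity of
  -- Ḡ applies.
  have hdrift : ∫ x, I x ∂P ≤ - κ * E t + (v t - v (t + 1)) + C * βs t := by
    have h1 := hvC t
    rw [← hX.integral_tdError_mul hpol hθβ hw hbarβ herr t] at h1
    have h2 : ∫ x, ∑ s, occ M pol (Z t x).theta s * criticDrift M pol Φ (Z t x).theta (Z t x).omega
        (Z t x).omegaBar (criticError M pol Φ Z t x) s ∂P ≤ - κ * E t := by
      rw [hE, ← integral_const_mul]
      refine integral_mono_ae ?_ ((hEi t).const_mul _) (ae_of_all _ fun x => ?_)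
      · exact (EssBdd.sum _ fun s _ => ((hθβ.occ hpol s).mul
          (hθβ.criticDrift hpol hw hbarβ herr s)).essBdd t).integrable (𝓕.le t)
      · dsimp only
        rw [sum_occ_mul_criticDrift (isUnit_det_Gbar herg hΦ _)]
        have := hcoer (Z t x).theta (criticError M pol Φ Z t x)
        simp only [criticError] at this ⊢
        linarith
    linarith
  have hcomb : κ * E t * βs t ≤ E t - E (t + 1) + 2 * (v t - v (t + 1)) * βs t + 2 * C * βs t ^ 2
      + (L * ξs t) ^ 2 / (κ * βs t) + 2 * (βs t * D * F) ^ 2 + 2 * (L * ξs t) ^ 2 := by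
    have := mul_le_mul_of_nonneg_left hdrift (mul_pos two_pos hβ).le
    linarith
  have hdiv : κ * E t ≤ (E t - E (t + 1)) / βs t + 2 * (v t - v (t + 1))
      + (2 * C + 2 * (D * F) ^ 2) * βs t + (L ^ 2 / κ + 2 * L ^ 2 * βs t) * (ξs t / βs t) ^ 2 := by
    rw [← le_div_iff₀ hβ] at hcomb
    refine hcomb.trans_eq ?_
    field_simp
    ring
  have hβ0 : βs t ≤ βs 0 := hs.critic_antitone (Nat.zero_le t)
  have hu := sq_nonneg (ξs t / βs t)
  have k1 := mul_le_mul_of_nonneg_right (le_abs_self (2 * C + 2 * (D * F) ^ 2)) hβ.le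
  have k2 : (L ^ 2 / κ + 2 * L ^ 2 * βs t) * (ξs t / βs t) ^ 2
      ≤ (L ^ 2 / κ + 2 * L ^ 2 * βs 0) * (ξs t / βs t) ^ 2 := by gcongr
  have hb0 := hs.critic_pos 0
  have k3 : 0 ≤ (L ^ 2 / κ + 2 * L ^ 2 * βs 0) * βs t := by positivity
  have k4 : 0 ≤ |2 * C + 2 * (D * F) ^ 2| * (ξs t / βs t) ^ 2 := by positivity
  refine hdiv.trans ?_
  linarith

/-- The samples enter the target only through the critic, so the inequality holds pathwise and needs
no Poisson argument. Writing ω_{t+1} - ω̄_t as x_t - Ḡ⁻¹G y_t plus one critic step isolates the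
contraction. -/
lemma exists_target_recursion (hZ : IsIterate M pol Φ αs ξs βs X z₀ Z)
    (hX : IsSampling M pol (fun t x => (Z t x).theta) X 𝓕 P) (hpol : PolicyRegular pol)
    (herg : ErgodicClosure M pol) (hΦ : Φ.rank = m) (hpd : UnifPosDef M pol Φ)
    (hs : StepSizes αs ξs βs) (hstab : ∃ B : ℝ, ∀ᵐ x ∂P, ∀ t, ‖(Z t x).omega‖ ≤ B) :
    ∃ ζ > 0, ∃ C ≥ 0, ∀ t,
      ζ * ∫ x, ‖targetError M pol Φ Z t x‖ ^ 2 ∂P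
        ≤ (∫ x, ‖targetError M pol Φ Z t x‖ ^ 2 ∂P
            - ∫ x, ‖targetError M pol Φ Z (t + 1) x‖ ^ 2 ∂P) / ξs t
          + C * (∫ x, ‖criticError M pol Φ Z t x‖ ^ 2 ∂P
            + βs t ^ 2 + (αs t / ξs t) ^ 2 + ξs t) := by
  obtain ⟨hθ, hw, hbar⟩ := slow_iterates hZ hX hpol hs hstab
  have herr := slow_criticError hθ hw hbar hpol herg hΦ hs
  have hterr := slow_targetError hθ hbar hpol herg hΦ hpd hs
  have hunit := fun θ => UnifPosDef.isUnit_det_Gmat hpd θ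
  obtain ⟨ζ, hζ, hcoer⟩ := hpd
  obtain ⟨L, hL⟩ := hterr.incr
  obtain ⟨K₁, hK₁⟩ := hw.incr
  obtain ⟨K₂, hK₂⟩ := (hθ.omegaBarStar (M := M) (Φ := Φ) hpol herg hΦ ⟨ζ, hζ, hcoer⟩).incr
  set K := |K₁| + |K₂| with hK
  refine ⟨ζ, hζ, 2 / ζ + 4 * K ^ 2 / ζ + L ^ 2, by positivity, fun t => ?_⟩
  have hβ := hs.critic_pos t
  have hξ := hs.target_pos t
  have hα := hs.actor_pos t
  have hpath : ∀ᵐ x ∂P, ζ * ξs t * ‖targetError M pol Φ Z t x‖ ^ 2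
      ≤ ‖targetError M pol Φ Z t x‖ ^ 2 - ‖targetError M pol Φ Z (t + 1) x‖ ^ 2
        + (ξs t * (2 / ζ) * ‖criticError M pol Φ Z t x‖ ^ 2
          + ξs t * (4 * K ^ 2 / ζ * (βs t ^ 2 + (αs t / ξs t) ^ 2) + L ^ 2 * ξs t)) := by
    filter_upwards [hL, hK₁, hK₂] with x hLx h₁ h₂
    have h := norm_sq_target_step_le (y := targetError M pol Φ Z t x)
      (y' := targetError M pol Φ Z (t + 1) x)
      (g := targetDrift M pol Φ (Z t x).theta (targetError M pol Φ Z t x))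
      (x := criticError M pol Φ Z t x)
      (e := ξs t • ((Z (t + 1) x).omega - (Z t x).omega)
        - (omegaBarStar M pol Φ (Z (t + 1) x).theta - omegaBarStar M pol Φ (Z t x).theta))
      (K := K) (b := βs t) (q := αs t / ξs t) hζ hξ ?_ ?_ ?_ (hLx t)
    · linarith
    · have h0 := omegaStar_sub (isUnit_det_Gbar herg hΦ (Z t x).theta) (hunit (Z t x).theta)
        (Z t x).omegaBar
      have h3 : targetDrift M pol Φ (Z t x).theta (targetError M pol Φ Z t x)
          = (Z t x).omegaBar - omegaStar M pol Φ (Z t x).theta (Z t x).omegaBar := by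
        rw [← neg_sub (omegaStar M pol Φ (Z t x).theta (Z t x).omegaBar), h0, neg_neg,
            targetError]
      rw [h3]
      simp only [targetError, criticError]
      rw [hZ.omegaBar_succ]
      module
    · have h3 := hcoer (Z t x).theta (targetError M pol Φ Z t x)
      rwa [EuclideanSpace.inner_eq_star_dotProduct, star_trivial, dotProduct_comm]
    · refine (norm_sub_le_of_le (r₁ := ξs t * (K₁ * βs t)) (r₂ := K₂ * αs t) ?_ (h₂ t)).trans ?_
      · rw [norm_smul, Real.norm_of_nonneg hξ.le]
        exact mul_le_mul_of_nonneg_left (h₁ t) hξ.le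
      · have e : ξs t * (K * (βs t + αs t / ξs t)) = ξs t * (K * βs t) + K * αs t := by
          field_simp
        rw [e]
        have l₁ : K₁ ≤ K := (le_abs_self _).trans (le_add_of_nonneg_right (abs_nonneg _))
        have l₂ : K₂ ≤ K := (le_abs_self _).trans (le_add_of_nonneg_left (abs_nonneg _))
        gcongr
  have hTi : ∀ t, Integrable (fun x => ‖targetError M pol Φ Z t x‖ ^ 2) P := fun t =>
    (hterr.essBdd_norm_sq t).integrable (𝓕.le t)
  have hEi : Integrable (fun x => ‖criticError M pol Φ Z t x‖ ^ 2) P :=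
    (herr.essBdd_norm_sq t).integrable (𝓕.le t)
  set E := ∫ x, ‖criticError M pol Φ Z t x‖ ^ 2 ∂P with hE
  set Y : ℕ → ℝ := fun t => ∫ x, ‖targetError M pol Φ Z t x‖ ^ 2 ∂P with hY
  have hE0 : 0 ≤ E := integral_nonneg fun x => sq_nonneg _
  have hint : ζ * ξs t * Y t ≤ Y t - Y (t + 1) + (ξs t * (2 / ζ) * E
      + ξs t * (4 * K ^ 2 / ζ * (βs t ^ 2 + (αs t / ξs t) ^ 2) + L ^ 2 * ξs t)) := by
    have i1 : Integrable (fun x => ‖targetError M pol Φ Z t x‖ ^ 2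
      - ‖targetError M pol Φ Z (t + 1) x‖ ^ 2) P := (hTi t).sub (hTi (t + 1))
    have i2 : Integrable (fun x => ξs t * (2 / ζ) * ‖criticError M pol Φ Z t x‖ ^ 2
      + ξs t * (4 * K ^ 2 / ζ * (βs t ^ 2 + (αs t / ξs t) ^ 2) + L ^ 2 * ξs t)) P :=
      (hEi.const_mul _).add (integrable_const _)
    have h := integral_mono_ae ((hTi t).const_mul (ζ * ξs t)) (i1.add i2) hpath
    refine (integral_const_mul _ _).symm.trans_le (h.trans_eq ?_)
    refine (integral_add i1 i2).trans ?_
    rw [integral_sub (hTi t) (hTi (t + 1)), integral_add (hEi.const_mul _) (integrable_const _),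
      integral_const_mul]
    simp [hE, hY]
  have hdiv : ζ * Y t ≤ (Y t - Y (t + 1)) / ξs t + (2 / ζ * E
      + (4 * K ^ 2 / ζ * (βs t ^ 2 + (αs t / ξs t) ^ 2) + L ^ 2 * ξs t)) := by
    have h2 : ζ * Y t * ξs t ≤ Y t - Y (t + 1) + (2 / ζ * E
      + (4 * K ^ 2 / ζ * (βs t ^ 2 + (αs t / ξs t) ^ 2) + L ^ 2 * ξs t)) * ξs t := by linarith
    rw [← le_div_iff₀ hξ, add_div, mul_div_cancel_right₀ _ hξ.ne'] at h2
    exact h2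
  refine hdiv.trans (add_le_add le_rfl ?_)
  have a1 : 0 ≤ 2 / ζ := by positivity
  have a2 : 0 ≤ 4 * K ^ 2 / ζ := by positivity
  have a3 : 0 ≤ L ^ 2 := sq_nonneg L
  have b1 : 0 ≤ βs t ^ 2 + (αs t / ξs t) ^ 2 := by positivity
  have p1 := mul_nonneg a1 (add_nonneg b1 hξ.le)
  have p2 := mul_nonneg a2 (add_nonneg hE0 hξ.le)
  have p3 := mul_nonneg a3 (add_nonneg hE0 b1)
  linarith

/-- By `omegaStar_sub` the error is x_t + (y_t - Ḡ⁻¹G y_t), and the entries of Ḡ⁻¹G are bounded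
along the trajectory. -/
lemma exists_error_decomposition (hZ : IsIterate M pol Φ αs ξs βs X z₀ Z)
    (hX : IsSampling M pol (fun t x => (Z t x).theta) X 𝓕 P) (hpol : PolicyRegular pol)
    (herg : ErgodicClosure M pol) (hΦ : Φ.rank = m) (hpd : UnifPosDef M pol Φ)
    (hs : StepSizes αs ξs βs) (hstab : ∃ B : ℝ, ∀ᵐ x ∂P, ∀ t, ‖(Z t x).omega‖ ≤ B) :
    (∀ t, Integrable
      (fun x => ‖(Z t x).omega - omegaBarStar M pol Φ (Z t x).theta‖ ^ 2) P) ∧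
    ∃ C ≥ 0, ∀ t, ∫ x, ‖(Z t x).omega - omegaBarStar M pol Φ (Z t x).theta‖ ^ 2 ∂P
      ≤ C * (∫ x, ‖criticError M pol Φ Z t x‖ ^ 2 ∂P
        + ∫ x, ‖targetError M pol Φ Z t x‖ ^ 2 ∂P) := by
  obtain ⟨hθ, hw, hbar⟩ := slow_iterates hZ hX hpol hs hstab
  have herr := slow_criticError hθ hw hbar hpol herg hΦ hs
  have hterr := slow_targetError hθ hbar hpol herg hΦ hpd hs
  obtain ⟨c₁, hc₁⟩ := hs.actor_le
  obtain ⟨c₂, hc₂⟩ := hs.target_le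
  have hθβ : SlowParam P 𝓕 βs (fun t x => (Z t x).theta) :=
    (hθ.mono_rate (fun t => (hs.actor_pos t).le) hc₁).mono_rate (fun t => (hs.target_pos t).le) hc₂
  have hdiff := hw.sub (hθβ.omegaBarStar (M := M) (Φ := Φ) hpol herg hΦ hpd)
  have hint : ∀ t, Integrable
      (fun x => ‖(Z t x).omega - omegaBarStar M pol Φ (Z t x).theta‖ ^ 2) P := fun t =>
    (hdiff.essBdd_norm_sq t).integrable (𝓕.le t)
  refine ⟨hint, ?_⟩
  choose B hB using fun i j =>
    (hθ.Gbar_inv_mul_Gmat (M := M) (Φ := Φ) hpol herg hΦ i j).bdd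
  set b := ∑ i, ∑ j, |B i j| with hb
  have hb0 : 0 ≤ b := Finset.sum_nonneg fun i _ => Finset.sum_nonneg fun j _ => abs_nonneg (B i j)
  -- From (p + (1 + b)q)² ≤ 2p² + 2(1 + b)²q², where 1 + b bounds the map y ↦ y - Ḡ⁻¹G y.
  refine ⟨2 * (1 + (1 + b) ^ 2), by positivity, fun t => ?_⟩
  have hTi : Integrable (fun x => ‖targetError M pol Φ Z t x‖ ^ 2) P :=
    (hterr.essBdd_norm_sq t).integrable (𝓕.le t)
  have hEi : Integrable (fun x => ‖criticError M pol Φ Z t x‖ ^ 2) P :=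
    (herr.essBdd_norm_sq t).integrable (𝓕.le t)
  rw [← integral_add hEi hTi, ← integral_const_mul]
  refine integral_mono_ae (hint t) ((hEi.add hTi).const_mul _) ?_
  filter_upwards [ae_all_iff.2 fun i => ae_all_iff.2 (hB i)] with x hx
  set y := targetError M pol Φ Z t x with hy
  set g := targetDrift M pol Φ (Z t x).theta y with hg
  have hgle : ‖g‖ ≤ b * ‖y‖ := by
    refine (SlowAdapted.norm_le_sum_abs g).trans ?_
    rw [hb, Finset.sum_mul]
    refine Finset.sum_le_sum fun i _ => ?_
    rw [Finset.sum_mul]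
    change |∑ j, _ * y j| ≤ _
    refine (Finset.abs_sum_le_sum_abs _ _).trans (Finset.sum_le_sum fun j _ => ?_)
    rw [abs_mul]
    exact mul_le_mul ((hx i j t).trans (le_abs_self _)) (PiLp.norm_apply_le y j) (abs_nonneg _)
      (abs_nonneg _)
  have h0 := omegaStar_sub (isUnit_det_Gbar herg hΦ (Z t x).theta)
    (hpd.isUnit_det_Gmat (Z t x).theta) (Z t x).omegaBar
  have e : (Z t x).omega - omegaBarStar M pol Φ (Z t x).theta
      = criticError M pol Φ Z t x + (y - g) := by
    have h3 : g = (Z t x).omegaBar - omegaStar M pol Φ (Z t x).theta (Z t x).omegaBar := by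
      rw [← neg_sub (omegaStar M pol Φ (Z t x).theta (Z t x).omegaBar), h0, neg_neg, hg, hy,
        targetError]
    rw [h3, hy, criticError, targetError]
    abel
  have h1 : ‖criticError M pol Φ Z t x + (y - g)‖
      ≤ ‖criticError M pol Φ Z t x‖ + (1 + b) * ‖y‖ := by
    refine norm_add_le_of_le le_rfl ((norm_sub_le_of_le le_rfl hgle).trans_eq (by ring))
  have h2 := pow_le_pow_left₀ (norm_nonneg _) h1 2
  rw [e]
  have h4 := sq_nonneg (‖criticError M pol Φ Z t x‖ - (1 + b) * ‖y‖)
  have h5 : 0 ≤ (1 + b) ^ 2 * ‖criticError M pol Φ Z t x‖ ^ 2 := by positivity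
  have h6 : 0 ≤ ‖y‖ ^ 2 := sq_nonneg _
  nlinarith

end Recursions

/-! ### Cesàro averages and polynomial rates -/

section Rates

/-- Induction replaces the comparison with an integral: Bernoulli's inequality with exponent 1 - q ≤
1 shows that T^{1-q} grows by at least (1 - q)(T + 1)^{-q}. -/
lemma sum_Icc_one_div_rpow_le {q : ℝ} (hq0 : 0 < q) (hq1 : q < 1) (T : ℕ) :
    ∑ t ∈ Finset.Icc 1 T, 1 / (1 + (t : ℝ)) ^ q ≤ (T : ℝ) ^ (1 - q) / (1 - q) := by
  have h1q : 0 < 1 - q := sub_pos.2 hq1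
  induction T with
  | zero => simp [Real.zero_rpow h1q.ne']
  | succ T ih =>
    rw [Finset.sum_Icc_succ_top (Nat.le_add_left 1 T)]
    push_cast
    have hT : (0 : ℝ) < T + 1 := by positivity
    have h1 : 1 / (1 + ((T : ℝ) + 1)) ^ q ≤ 1 / ((T : ℝ) + 1) ^ q :=
      one_div_le_one_div_of_le (Real.rpow_pos_of_pos hT q)
        (Real.rpow_le_rpow hT.le (by linarith) hq0.le)
    have h2 : (T : ℝ) ^ (1 - q) ≤ ((T : ℝ) + 1) ^ (1 - q) - (1 - q) * (1 / ((T : ℝ) + 1) ^ q) := by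
      have hs : -1 ≤ -(1 / ((T : ℝ) + 1)) := by
        rw [neg_le_neg_iff, div_le_one hT]
        linarith [(Nat.cast_nonneg T : (0 : ℝ) ≤ T)]
      have h3 := rpow_one_add_le_one_add_mul_self hs h1q.le (by linarith)
      have e1 : (1 + -(1 / ((T : ℝ) + 1))) = T / (T + 1) := by field_simp; ring
      rw [e1, Real.div_rpow (Nat.cast_nonneg T) hT.le, div_le_iff₀ (Real.rpow_pos_of_pos hT _)] at h3
      have e2 : ((T : ℝ) + 1) ^ (1 - q) = (T + 1) * (1 / ((T : ℝ) + 1) ^ q) := by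
        rw [Real.rpow_sub hT, Real.rpow_one]
        ring
      refine h3.trans_eq ?_
      rw [e2]
      field_simp
      ring
    have h4 : (T : ℝ) ^ (1 - q) / (1 - q) + 1 / ((T : ℝ) + 1) ^ q
        ≤ ((T : ℝ) + 1) ^ (1 - q) / (1 - q) := by
      rw [div_add' _ _ _ h1q.ne']
      gcongr
      linarith
    linarith

/-- Summation by parts as an induction: since B - E ≥ 0, passing to the smaller denominator s(T + 1)
only enlarges the bound. -/
lemma sum_Icc_div_sub_le {E s : ℕ → ℝ} {B : ℝ} (hE : ∀ t, E t ≤ B)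
    (hs : ∀ t, 0 < s t) (hanti : Antitone s) (T : ℕ) :
    ∑ t ∈ Finset.Icc 1 T, (E t - E (t + 1)) / s t ≤ (B - E (T + 1)) / s T := by
  induction T with
  | zero => simpa using div_nonneg (sub_nonneg.2 (hE 1)) (hs 0).le
  | succ T ih =>
    rw [Finset.sum_Icc_succ_top (Nat.le_add_left 1 T)]
    have h1 : (B - E (T + 1)) / s T ≤ (B - E (T + 1)) / s (T + 1) :=
      div_le_div_of_nonneg_left (sub_nonneg.2 (hE _)) (hs _) (hanti (Nat.le_succ T))
    calc _ ≤ (B - E (T + 1)) / s (T + 1) + (E (T + 1) - E (T + 1 + 1)) / s (T + 1) := by linarith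
      _ = _ := by rw [← add_div]; ring

/-- The Cesàro means of `u` are dominated by `R`. -/
def AvgLE (R u : ℕ → ℝ) : Prop :=
  ∃ C : ℝ, ∀ T : ℕ, 1 ≤ T → (1 / (T : ℝ)) * ∑ t ∈ Finset.Icc 1 T, u t ≤ C * R T

namespace AvgLE

variable {R u v : ℕ → ℝ}

lemma mono (hv : AvgLE R v) (h : ∀ t, u t ≤ v t) : AvgLE R u := by
  obtain ⟨C, hC⟩ := hv
  refine ⟨C, fun T hT => le_trans ?_ (hC T hT)⟩
  gcongr
  exact h _

lemma add (hu : AvgLE R u) (hv : AvgLE R v) : AvgLE R (fun t => u t + v t) := by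
  obtain ⟨C, hC⟩ := hu
  obtain ⟨D, hD⟩ := hv
  refine ⟨C + D, fun T hT => ?_⟩
  rw [Finset.sum_add_distrib, mul_add, add_mul]
  exact add_le_add (hC T hT) (hD T hT)

lemma const_mul (hu : AvgLE R u) {c : ℝ} (hc : 0 ≤ c) : AvgLE R (fun t => c * u t) := by
  obtain ⟨C, hC⟩ := hu
  refine ⟨c * C, fun T hT => ?_⟩
  rw [← Finset.mul_sum, mul_left_comm, mul_assoc]
  exact mul_le_mul_of_nonneg_left (hC T hT) hc

lemma of_rpow_lt_one {q C : ℝ} (hq0 : 0 < q) (hq1 : q < 1)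
    (h : ∀ T : ℕ, 1 ≤ T → 1 / (T : ℝ) ^ q ≤ C * R T) : AvgLE R (fun t => 1 / (1 + (t : ℝ)) ^ q) := by
  have h1q : 0 < 1 - q := sub_pos.2 hq1
  refine ⟨1 / (1 - q) * C, fun T hT => ?_⟩
  have hT0 : (0 : ℝ) < T := by exact_mod_cast hT
  calc (1 / (T : ℝ)) * ∑ t ∈ Finset.Icc 1 T, 1 / (1 + (t : ℝ)) ^ q
      ≤ (1 / (T : ℝ)) * ((T : ℝ) ^ (1 - q) / (1 - q)) := by
        gcongr
        exact sum_Icc_one_div_rpow_le hq0 hq1 T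
    _ = 1 / (1 - q) * (1 / (T : ℝ) ^ q) := by
        rw [Real.rpow_sub hT0, Real.rpow_one]
        field_simp
    _ ≤ 1 / (1 - q) * (C * R T) := by
        gcongr
        exact h T hT
    _ = _ := by ring

/-- For q ≥ 1 the average no longer decays like T^{-q}; the summand is then compared with an
exponent p < 1 already dominated by `R`. -/
lemma of_rpow {q p : ℝ} (hq0 : 0 < q) (hp0 : 0 < p) (hp1 : p < 1)
    (hq : ∀ T : ℕ, 1 ≤ T → 1 / (T : ℝ) ^ q ≤ R T) (hp : ∀ T : ℕ, 1 ≤ T → 1 / (T : ℝ) ^ p ≤ R T) :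
    AvgLE R (fun t => 1 / (1 + (t : ℝ)) ^ q) := by
  rcases lt_or_ge q 1 with h | h
  · exact of_rpow_lt_one (C := 1) hq0 h (by simpa using hq)
  · refine (of_rpow_lt_one (C := 1) hp0 hp1 (by simpa using hp)).mono fun t => ?_
    have h0 : (0 : ℝ) < 1 + t := by positivity
    refine div_le_div_of_nonneg_left zero_le_one (Real.rpow_pos_of_pos h0 p) ?_
    exact Real.rpow_le_rpow_of_exponent_le (by linarith [(Nat.cast_nonneg t : (0 : ℝ) ≤ t)])
      (by linarith)

lemma of_telescoping {E s : ℕ → ℝ} {B C : ℝ} (hE0 : ∀ t, 0 ≤ E t) (hE : ∀ t, E t ≤ B)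
    (hs : ∀ t, 0 < s t) (hanti : Antitone s)
    (h : ∀ T : ℕ, 1 ≤ T → 1 / ((T : ℝ) * s T) ≤ C * R T) :
    AvgLE R (fun t => (E t - E (t + 1)) / s t) := by
  refine ⟨B * C, fun T hT => ?_⟩
  have hT0 : (0 : ℝ) < T := by exact_mod_cast hT
  have hB : 0 ≤ B := (hE0 0).trans (hE 0)
  have h1 : (B - E (T + 1)) / s T ≤ B / s T := by
    have := hs T
    have := hE0 (T + 1)
    gcongr
    linarith
  calc (1 / (T : ℝ)) * ∑ t ∈ Finset.Icc 1 T, (E t - E (t + 1)) / s t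
      ≤ (1 / (T : ℝ)) * (B / s T) := by
        gcongr
        exact (sum_Icc_div_sub_le hE hs hanti T).trans h1
    _ = B * (1 / ((T : ℝ) * s T)) := by ring
    _ ≤ B * (C * R T) := by
        gcongr
        exact h T hT
    _ = _ := by ring

lemma of_telescoping_one {v : ℕ → ℝ} {B C : ℝ} (hv : ∀ t, |v t| ≤ B)
    (h : ∀ T : ℕ, 1 ≤ T → 1 / (T : ℝ) ≤ C * R T) : AvgLE R (fun t => v t - v (t + 1)) := by
  -- Shifting by `B` makes the sequence nonnegative without changing its differences.
  have := of_telescoping (R := R) (E := fun t => v t + B) (s := fun _ => 1) (B := 2 * B) (C := C)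
    (fun t => by linarith [(abs_le.1 (hv t)).1]) (fun t => by linarith [(abs_le.1 (hv t)).2])
    (fun _ => one_pos) antitone_const (by simpa using h)
  simpa using this

end AvgLE

lemma stepSizes_of_rpow {c₁ c₂ c₃ α ξ β : ℝ} (hc₁ : 0 < c₁) (hc₂ : 0 < c₂) (hc₃ : 0 < c₃)
    (hβ : 0 < β) (hβξ : β < ξ) (hξα : ξ < α) {αs ξs βs : ℕ → ℝ}
    (hαs : ∀ t : ℕ, αs t = c₁ / (1 + (t : ℝ)) ^ α)
    (hξs : ∀ t : ℕ, ξs t = c₂ / (1 + (t : ℝ)) ^ ξ)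
    (hβs : ∀ t : ℕ, βs t = c₃ / (1 + (t : ℝ)) ^ β) : StepSizes αs ξs βs := by
  have h0 : ∀ t : ℕ, (0 : ℝ) < 1 + t := fun t => by positivity
  have h1 : ∀ t : ℕ, (1 : ℝ) ≤ 1 + t := fun t => by
    linarith [(Nat.cast_nonneg t : (0 : ℝ) ≤ t)]
  have hp : ∀ (q : ℝ) (t : ℕ), 0 < (1 + (t : ℝ)) ^ q := fun q t => Real.rpow_pos_of_pos (h0 t) q
  have hle : ∀ {c c' p q : ℝ}, 0 < c → 0 < c' → q < p → ∀ t : ℕ,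
      c / (1 + (t : ℝ)) ^ p ≤ c / c' * (c' / (1 + (t : ℝ)) ^ q) := by
    intro c c' p q hc hc' hqp t
    rw [div_mul_div_cancel₀ hc'.ne']
    exact div_le_div_of_nonneg_left hc.le (hp q t)
      (Real.rpow_le_rpow_of_exponent_le (h1 t) hqp.le)
  have hanti : ∀ {c q : ℝ}, 0 < c → 0 < q → Antitone fun t : ℕ => c / (1 + (t : ℝ)) ^ q := by
    intro c q hc hq s t hst
    refine div_le_div_of_nonneg_left hc.le (hp q s) (Real.rpow_le_rpow (h0 s).le ?_ hq.le)
    have : (s : ℝ) ≤ t := by exact_mod_cast hst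
    linarith
  obtain rfl := funext hαs
  obtain rfl := funext hξs
  obtain rfl := funext hβs
  refine ⟨fun t => div_pos hc₁ (hp _ t), fun t => div_pos hc₂ (hp _ t),
    fun t => div_pos hc₃ (hp _ t), ⟨_, hle hc₁ hc₂ hξα⟩, ⟨_, hle hc₂ hc₃ hβξ⟩,
    hanti hc₃ hβ, hanti hc₂ (hβ.trans hβξ), ?_⟩
  refine Filter.Tendsto.const_div_atTop ?_ c₂
  exact (tendsto_rpow_atTop (hβ.trans hβξ)).comp
    (Filter.tendsto_atTop_add_const_left _ _ tendsto_natCast_atTop_atTop)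

/-- The factor 2 absorbs 1 + T ≤ 2T, since η < 1. Allowing any η ≤ ξ lets the boundary terms of both
recursions share the rate T^{-(1-ξ)}. -/
lemma one_div_mul_stepsize_le {c η ξ : ℝ} (hc : 0 < c) (hη : 0 < η) (hηξ : η ≤ ξ) (hξ : ξ < 1)
    {T : ℕ} (hT : 1 ≤ T) :
    1 / ((T : ℝ) * (c / (1 + (T : ℝ)) ^ η)) ≤ 2 / c * (1 / (T : ℝ) ^ (1 - ξ)) := by
  have hT1 : (1 : ℝ) ≤ T := by exact_mod_cast hT
  have hT0 : (0 : ℝ) < T := by linarith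
  have h1 : (1 + (T : ℝ)) ^ η ≤ 2 * (T : ℝ) ^ ξ := by
    calc (1 + (T : ℝ)) ^ η ≤ (2 * (T : ℝ)) ^ η := by gcongr; linarith
      _ = 2 ^ η * (T : ℝ) ^ η := Real.mul_rpow (by norm_num) hT0.le
      _ ≤ 2 ^ (1 : ℝ) * (T : ℝ) ^ ξ := by
        gcongr
        · norm_num
        · linarith
      _ = _ := by rw [Real.rpow_one]
  have e : 1 / ((T : ℝ) * (c / (1 + (T : ℝ)) ^ η)) = (1 + (T : ℝ)) ^ η / (T * c) := by
    have := Real.rpow_pos_of_pos (show (0 : ℝ) < 1 + T by positivity) η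
    field_simp
  rw [e]
  calc (1 + (T : ℝ)) ^ η / (T * c) ≤ 2 * (T : ℝ) ^ ξ / (T * c) := by gcongr
    _ = _ := by
      rw [Real.rpow_sub hT0, Real.rpow_one]
      field_simp

/-- The convergence rate of the critic. -/
def criticRate (α ξ β : ℝ) (T : ℕ) : ℝ :=
  1 / (T : ℝ) ^ (1 - ξ) + Real.log T / (T : ℝ) ^ β
    + 1 / (T : ℝ) ^ (2 * (α - ξ)) + 1 / (T : ℝ) ^ (2 * (ξ - β))

lemma criticRate_bounds {α ξ β : ℝ} {T : ℕ} (hT : 1 ≤ T) :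
    1 / (T : ℝ) ^ (1 - ξ) ≤ criticRate α ξ β T ∧ Real.log T / (T : ℝ) ^ β ≤ criticRate α ξ β T ∧
    1 / (T : ℝ) ^ (2 * (α - ξ)) ≤ criticRate α ξ β T ∧
    1 / (T : ℝ) ^ (2 * (ξ - β)) ≤ criticRate α ξ β T := by
  have h0 : 0 ≤ Real.log T / (T : ℝ) ^ β := div_nonneg (Real.log_natCast_nonneg T) (by positivity)
  have h1 : 0 ≤ 1 / (T : ℝ) ^ (1 - ξ) := by positivity
  have h2 : 0 ≤ 1 / (T : ℝ) ^ (2 * (α - ξ)) := by positivity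
  have h3 : 0 ≤ 1 / (T : ℝ) ^ (2 * (ξ - β)) := by positivity
  unfold criticRate
  refine ⟨?_, ?_, ?_, ?_⟩ <;> linarith

/-- For T ≥ 2 the logarithm is at least log 2. At T = 1 it vanishes, and the term T^{-(1-ξ)} = 1
takes over. -/
lemma one_div_rpow_le_criticRate {α ξ β : ℝ} {T : ℕ} (hT : 1 ≤ T) :
    1 / (T : ℝ) ^ β ≤ (1 + 1 / Real.log 2) * criticRate α ξ β T := by
  have hlog2 : 0 < Real.log 2 := Real.log_pos (by norm_num)
  have hb := criticRate_bounds (α := α) (ξ := ξ) (β := β) hT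
  have hr0 : 0 ≤ criticRate α ξ β T := le_trans (by positivity) hb.1
  rcases hT.eq_or_lt with rfl | h
  · have h1 : (1 : ℝ) ≤ criticRate α ξ β 1 := by simpa using hb.1
    have h2 : 0 ≤ 1 / Real.log 2 * criticRate α ξ β 1 := by positivity
    simp only [Nat.cast_one, Real.one_rpow, div_one]
    linarith
  · have hT2 : (2 : ℝ) ≤ T := by exact_mod_cast h
    have h1 : Real.log 2 ≤ Real.log T := Real.log_le_log (by norm_num) hT2
    have hTβ : 0 < (T : ℝ) ^ β := Real.rpow_pos_of_pos (by linarith) β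
    calc 1 / (T : ℝ) ^ β = 1 / Real.log 2 * (Real.log 2 / (T : ℝ) ^ β) := by field_simp
      _ ≤ 1 / Real.log 2 * (Real.log T / (T : ℝ) ^ β) := by gcongr
      _ ≤ 1 / Real.log 2 * criticRate α ξ β T := by gcongr; exact hb.2.1
      _ ≤ _ := by linarith

lemma sq_div_div_rpow {c c' p q : ℝ} (t : ℕ) :
    (c / (1 + (t : ℝ)) ^ p / (c' / (1 + (t : ℝ)) ^ q)) ^ 2
      = (c / c') ^ 2 * (1 / (1 + (t : ℝ)) ^ (2 * (p - q))) := by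
  have h0 : (0 : ℝ) < 1 + t := by positivity
  rw [mul_comm 2 (p - q), Real.rpow_mul h0.le, Real.rpow_sub h0, Real.rpow_two]
  have := Real.rpow_pos_of_pos h0 p
  have := Real.rpow_pos_of_pos h0 q
  field_simp

/-- Two coupled stochastic approximation inequalities with polynomial stepsizes yield the
convergence rate of the averages. -/
lemma avgLE_of_recursions {c₁ c₂ c₃ α ξ β : ℝ} (hc₁ : 0 < c₁) (hc₂ : 0 < c₂) (hc₃ : 0 < c₃)
    (hβ : 0 < β) (hβξ : β < ξ) (hξα : ξ < α) (hα : α < 1) {αs ξs βs : ℕ → ℝ}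
    (hαs : ∀ t : ℕ, αs t = c₁ / (1 + (t : ℝ)) ^ α)
    (hξs : ∀ t : ℕ, ξs t = c₂ / (1 + (t : ℝ)) ^ ξ)
    (hβs : ∀ t : ℕ, βs t = c₃ / (1 + (t : ℝ)) ^ β)
    {E Y v : ℕ → ℝ} {κ ζ C D BE BY Bv : ℝ} (hκ : 0 < κ) (hζ : 0 < ζ) (hD : 0 ≤ D)
    (hE0 : ∀ t, 0 ≤ E t) (hE : ∀ t, E t ≤ BE) (hY0 : ∀ t, 0 ≤ Y t) (hY : ∀ t, Y t ≤ BY)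
    (hv : ∀ t, |v t| ≤ Bv)
    (hrecE : ∀ t, κ * E t ≤ (E t - E (t + 1)) / βs t + 2 * (v t - v (t + 1))
      + C * (βs t + (ξs t / βs t) ^ 2))
    (hrecY : ∀ t, ζ * Y t ≤ (Y t - Y (t + 1)) / ξs t
      + D * (E t + βs t ^ 2 + (αs t / ξs t) ^ 2 + ξs t)) :
    AvgLE (criticRate α ξ β) (fun t => E t + Y t) := by
  have hξ1 : ξ < 1 := hξα.trans hα
  have hξ0 : 0 < ξ := hβ.trans hβξ
  have hs := stepSizes_of_rpow hc₁ hc₂ hc₃ hβ hβξ hξα hαs hξs hβs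
  have hr : ∀ T : ℕ, 1 ≤ T → 1 / (T : ℝ) ^ (1 - ξ) ≤ criticRate α ξ β T := fun T hT =>
    (criticRate_bounds hT).1
  have aβ : AvgLE (criticRate α ξ β) βs := by
    refine ((AvgLE.of_rpow_lt_one hβ (hβξ.trans hξ1)
      fun T hT => one_div_rpow_le_criticRate hT).const_mul hc₃.le).mono fun t => ?_
    rw [hβs, mul_one_div]
  have aβ2 : AvgLE (criticRate α ξ β) (fun t => βs t ^ 2) := by
    refine (aβ.const_mul (hs.critic_pos 0).le).mono fun t => ?_
    rw [sq]
    exact mul_le_mul_of_nonneg_right (hs.critic_antitone (Nat.zero_le t)) (hs.critic_pos t).le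
  have aξ : AvgLE (criticRate α ξ β) ξs := by
    obtain ⟨c, hc⟩ := hs.target_le
    refine (aβ.const_mul (abs_nonneg c)).mono fun t => (hc t).trans ?_
    exact mul_le_mul_of_nonneg_right (le_abs_self c) (hs.critic_pos t).le
  have aξβ : AvgLE (criticRate α ξ β) (fun t => (ξs t / βs t) ^ 2) := by
    -- The exponent 2(ξ - β) may exceed 1; the fallback 1 - ξ is itself part of the rate.
    refine ((AvgLE.of_rpow (p := 1 - ξ) (q := 2 * (ξ - β)) (by linarith) (by linarith)
      (by linarith) (fun T hT => (criticRate_bounds hT).2.2.2) hr).const_mul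
      (sq_nonneg (c₂ / c₃))).mono fun t => ?_
    rw [hξs, hβs, sq_div_div_rpow]
  have aαξ : AvgLE (criticRate α ξ β) (fun t => (αs t / ξs t) ^ 2) := by
    refine ((AvgLE.of_rpow (p := 1 - ξ) (q := 2 * (α - ξ)) (by linarith) (by linarith)
      (by linarith) (fun T hT => (criticRate_bounds hT).2.2.1) hr).const_mul
      (sq_nonneg (c₁ / c₂))).mono fun t => ?_
    rw [hαs, hξs, sq_div_div_rpow]
  have hstep : ∀ {c η : ℝ}, 0 < c → 0 < η → η ≤ ξ → ∀ T : ℕ, 1 ≤ T →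
      1 / ((T : ℝ) * (c / (1 + (T : ℝ)) ^ η)) ≤ 2 / c * criticRate α ξ β T := by
    intro c η hc hη hηξ T hT
    refine (one_div_mul_stepsize_le hc hη hηξ hξ1 hT).trans ?_
    exact mul_le_mul_of_nonneg_left (hr T hT) (by positivity)
  have aE : AvgLE (criticRate α ξ β) (fun t => (E t - E (t + 1)) / βs t) := by
    refine AvgLE.of_telescoping (C := 2 / c₃) hE0 hE hs.critic_pos hs.critic_antitone fun T hT => ?_
    rw [hβs]
    exact hstep hc₃ hβ hβξ.le T hT
  have aY : AvgLE (criticRate α ξ β) (fun t => (Y t - Y (t + 1)) / ξs t) := by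
    refine AvgLE.of_telescoping (C := 2 / c₂) hY0 hY hs.target_pos hs.target_antitone fun T hT => ?_
    rw [hξs]
    exact hstep hc₂ hξ0 le_rfl T hT
  have av : AvgLE (criticRate α ξ β) (fun t => v t - v (t + 1)) := by
    refine AvgLE.of_telescoping_one (C := 1) hv fun T hT => ?_
    rw [one_mul]
    refine le_trans ?_ (hr T hT)
    have hT1 : (1 : ℝ) ≤ T := by exact_mod_cast hT
    refine div_le_div_of_nonneg_left zero_le_one (Real.rpow_pos_of_pos (by linarith) _) ?_
    calc (T : ℝ) ^ (1 - ξ) ≤ (T : ℝ) ^ (1 : ℝ) :=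
          Real.rpow_le_rpow_of_exponent_le hT1 (by linarith)
      _ = T := Real.rpow_one _
  have hEavg : AvgLE (criticRate α ξ β) E := by
    refine (((aE.add (av.const_mul zero_le_two)).add
      ((aβ.add aξβ).const_mul (abs_nonneg C))).const_mul (one_div_pos.2 hκ).le).mono fun t => ?_
    rw [one_div_mul_eq_div, le_div_iff₀ hκ, mul_comm]
    refine (hrecE t).trans (add_le_add le_rfl ?_)
    exact mul_le_mul_of_nonneg_right (le_abs_self C)
      (add_nonneg (hs.critic_pos t).le (sq_nonneg _))
  -- The coupling is one-sided: the critic recursion is free of `Y`, so its average is available as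
  -- an input here.
  have hYavg : AvgLE (criticRate α ξ β) Y := by
    refine ((aY.add ((((hEavg.add aβ2).add aαξ).add aξ).const_mul hD)).const_mul
      (one_div_pos.2 hζ).le).mono fun t => ?_
    rw [one_div_mul_eq_div, le_div_iff₀ hζ, mul_comm]
    exact hrecY t
  exact hEavg.add hYavg

end Rates

end TargetAC

end

theorem mainTheorem4
    {S A : Type*} [Fintype S] [DecidableEq S] [Fintype A] [DecidableEq A]
    [MeasurableSpace S] [MeasurableSingletonClass S]
    [MeasurableSpace A] [MeasurableSingletonClass A]
    {d m : ℕ}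
    (M : TargetAC.MDP S A) (pol : TargetAC.PolicyFamily S A d) (Φ : Matrix S (Fin m) ℝ)
    (hpol : TargetAC.PolicyRegular pol)
    (herg : TargetAC.ErgodicClosure M pol)
    (hΦ : Φ.rank = m)
    (hmix : TargetAC.GeomMixing M pol)
    (hpd : TargetAC.UnifPosDef M pol Φ)
    (c₁ c₂ c₃ α ξ β : ℝ) (hc₁ : 0 < c₁) (hc₂ : 0 < c₂) (hc₃ : 0 < c₃)
    (hβ : 0 < β) (hβξ : β < ξ) (hξα : ξ < α) (hα : α < 1)
    (αs ξs βs : ℕ → ℝ)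
    (hαs : ∀ t : ℕ, αs t = c₁ / (1 + (t : ℝ)) ^ α)
    (hξs : ∀ t : ℕ, ξs t = c₂ / (1 + (t : ℝ)) ^ ξ)
    (hβs : ∀ t : ℕ, βs t = c₃ / (1 + (t : ℝ)) ^ β)
    {Ω : Type*} [MeasurableSpace Ω] (P : MeasureTheory.Measure Ω)
    [MeasureTheory.IsProbabilityMeasure P]
    (𝓕 : MeasureTheory.Filtration ℕ ‹MeasurableSpace Ω›)
    (X : TargetAC.Samples S A Ω) (z₀ : TargetAC.Params d m)
    (Z : ℕ → Ω → TargetAC.Params d m)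
    (hZ : Z = TargetAC.iter M pol Φ αs ξs βs z₀ X)
    (hX : TargetAC.IsSampling M pol (fun t x => (Z t x).theta) X 𝓕 P)
    (hstabθ : ∀ᵐ x ∂P, BddAbove (Set.range fun t => ‖(Z t x).theta‖))
    (hstabω : ∃ B : ℝ, ∀ᵐ x ∂P, ∀ t, ‖(Z t x).omega‖ ≤ B) :
    (∀ (θ : EuclideanSpace ℝ (Fin d)) (w : EuclideanSpace ℝ (Fin m)),
      (TargetAC.Gmat M pol Φ θ).mulVec w.ofLp = TargetAC.hvec M pol Φ θ ↔
        w = TargetAC.omegaBarStar M pol Φ θ) ∧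
    (∀ t, MeasureTheory.Integrable
      (fun x => ‖(Z t x).omega - TargetAC.omegaBarStar M pol Φ (Z t x).theta‖ ^ 2) P) ∧
    ∃ C : ℝ, ∀ T : ℕ, 1 ≤ T →
      (1 / (T : ℝ)) * ∑ t ∈ Finset.Icc 1 T,
          ∫ x, ‖(Z t x).omega - TargetAC.omegaBarStar M pol Φ (Z t x).theta‖ ^ 2 ∂P
        ≤ C * (1 / (T : ℝ) ^ (1 - ξ) + Real.log T / (T : ℝ) ^ β
            + 1 / (T : ℝ) ^ (2 * (α - ξ)) + 1 / (T : ℝ) ^ (2 * (ξ - β))) := by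
  obtain rfl := hZ
  have hZ := TargetAC.isIterate_iter M pol Φ αs ξs βs z₀ X
  have hs := TargetAC.stepSizes_of_rpow hc₁ hc₂ hc₃ hβ hβξ hξα hαs hξs hβs
  refine ⟨fun θ w => TargetAC.Gmat_mulVec_eq_iff (hpd.isUnit_det_Gmat θ) w, ?_⟩
  obtain ⟨hint, D, hD0, hD⟩ :=
    TargetAC.exists_error_decomposition hZ hX hpol herg hΦ hpd hs hstabω
  refine ⟨hint, ?_⟩
  obtain ⟨κ, hκ, C₁, v, ⟨B, hv⟩, hE⟩ :=
    TargetAC.exists_critic_recursion hZ hX hpol herg hΦ hs hstabω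
  obtain ⟨ζ, hζ, C₂, hC₂, hY⟩ :=
    TargetAC.exists_target_recursion hZ hX hpol herg hΦ hpd hs hstabω
  obtain ⟨hθ, hw, hbar⟩ := TargetAC.slow_iterates hZ hX hpol hs hstabω
  -- Uniform second moment bounds control the boundary terms of the summation by parts.
  obtain ⟨BE, hBE⟩ :=
    (TargetAC.slow_criticError hθ hw hbar hpol herg hΦ hs).exists_integral_norm_sq_le
  obtain ⟨BY, hBY⟩ :=
    (TargetAC.slow_targetError hθ hbar hpol herg hΦ hpd hs).exists_integral_norm_sq_le
  exact ((TargetAC.avgLE_of_recursions hc₁ hc₂ hc₃ hβ hβξ hξα hα hαs hξs hβs hκ hζ hC₂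
    (fun t => MeasureTheory.integral_nonneg fun x => sq_nonneg _) hBE
    (fun t => MeasureTheory.integral_nonneg fun x => sq_nonneg _) hBY hv hE hY).const_mul
      hD0).mono hD
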